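/- Let $P\subset\mathbb R^{d+1}$ be a (not necessarily bounded) convex polyhedron of dimension $d+1$, that is, a finite intersection of closed half-spaces not contained in a proper affine subspace, and let $S=\partial P$, with the intrinsic metric $\mu$ (infimum of lengths of paths in $S$). The $d$-dimensional faces of $P$ are called facets, the $(d-1)$-dimensional ones ridges. Let $v$ be a source point, i.e. a point in the relative interior of some facet. A path in $S$ from $a$ to $b$ is a shortest path if its length is finite and equals $\mu(a,b)$; a point $x\in S$ is a cut point if it has more than one shortest path to $v$ (paths being regarded as subsets of $S$). Let $K_v$ be the set of cut points. For a facet $F$ let $T_F$ be its affine span. If facets $F,F'$ share a ridge $R=F\cap F'$, the folding map $\Phi_{F,F'}:T_F\to T_{F'}$ is the isometry that fixes $R$ pointwise and for which the image of $F$ does not meet the relative interior of $F'$. If a path $\gamma$ traverses the facets $F_1,\dots,F_\ell$ in this order (pieces of $\gamma$ may be single points), consecutive ones sharing a ridge, its sequential unfolding into $T_{F_1}$ is $\bigcup_{i=1}^{\ell}\Phi_{F_1,F_2}^{-1}\circ\cdots\circ\Phi_{F_{i-1},F_i}^{-1}(\gamma\cap F_i)$. A point $\nu\in T_F$ is a source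 image for $F$ if there are a point $x\in F$, lying on no face of dimension at most $d-2$, and a shortest path $\gamma$ between $x$ and $v$ which, read from $x$ to $v$, traverses a list of facets starting with $F_1=F$ along which its sequential unfolding into $T_F$ is the segment $[\nu,x]$. Let $\mathrm{src}_F$ be the set of source images for $F$. The Voronoi diagram of $\mathrm{src}_F$ is the subdivision of $T_F$ whose closed cells are the sets $V(\mathrm{src}_F,\nu)=\{\zeta\in T_F: |\zeta-\nu|\le|\zeta-\nu'| \text{ for all } \nu'\in\mathrm{src}_F\}$, $\nu\in\mathrm{src}_F$, and their faces. **Theorem.** Fix a facet $F$ of $S$. Then $\mathrm{src}_F$ is finite. Let $V_{d-1}\subseteq T_F$ be the union of the closed cells of dimension $d-1$ in the Voronoi diagram of $\mathrm{src}_F$. If $F^\circ$ is the relative interior of $F$, then $F^\circ\cap K_v=F^\circ\cap V_{d-1}$. Moreover, if $R^\circ$ is the relative interior of a ridge $R\subset F$, then $R^\circ\cap K_v=R^\circ\cap V_{d-1}$. -/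

import Mathlib

open Set
open scoped ENNReal unitInterval

namespace PolyhedralBoundary

/-- The ambient Euclidean space `ℝ^(d+1)`. -/
abbrev Ambient (d : ℕ) : Type := EuclideanSpace ℝ (Fin (d + 1))

section Polyhedra

variable {d : ℕ}

/-- A convex polyhedron of dimension `d + 1` in `ℝ^(d+1)`: a finite intersection of closed
half-spaces that does not lie in a proper affine subspace.  It need not be bounded. -/
def IsConvexPolyhedron (P : Set (Ambient d)) : Prop :=
  (∃ (n : ℕ) (a : Fin n → Ambient d) (b : Fin n → ℝ),
    (∀ i, a i ≠ 0) ∧ P = {x | ∀ i, inner ℝ (a i) x ≤ b i}) ∧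
  affineSpan ℝ P = ⊤

/-- `G` is a (nonempty, closed) face of dimension `k` of the polyhedron `C`: the set of points of
`C` at which some linear functional attains its maximum over `C`. -/
def IsFace (C G : Set (Ambient d)) (k : ℕ) : Prop :=
  G.Nonempty ∧ IsExposed ℝ C G ∧ Module.finrank ℝ (affineSpan ℝ G).direction = k

/-- The facets of `∂P` are the `d`-dimensional faces of `P`. -/
def IsFacet (P F : Set (Ambient d)) : Prop := IsFace P F d

/-- The ridges of `∂P` are the `(d-1)`-dimensional faces of `P`. -/
def IsRidge (P R : Set (Ambient d)) : Prop := ∃ k, k + 1 = d ∧ IsFace P R k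

/-- A point is warped if it lies on a face of dimension at most `d - 2`. -/
def IsWarped (P : Set (Ambient d)) (x : Ambient d) : Prop :=
  ∃ G k, k + 2 ≤ d ∧ IsFace P G k ∧ x ∈ G

/-- A source point is a point in the relative interior of some facet. -/
def IsSourcePoint (P : Set (Ambient d)) (v : Ambient d) : Prop :=
  ∃ F, IsFacet P F ∧ v ∈ intrinsicInterior ℝ F

end Polyhedra

section ShortestPaths

variable {d : ℕ}

/-- The Euclidean length of a path (infinite if the path is not rectifiable). -/
noncomputable def pathLength {a b : Ambient d} (γ : Path a b) : ℝ≥0∞ :=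
  eVariationOn (fun t : I => γ t) univ

/-- The intrinsic distance `μ(a,b)` on `S`: the infimum of the lengths of the paths in `S` from `a`
to `b` (infinite if there is no rectifiable one). -/
noncomputable def intrinsicDist (S : Set (Ambient d)) (a b : Ambient d) : ℝ≥0∞ :=
  ⨅ (γ : Path a b) (_ : range γ ⊆ S), pathLength γ

/-- A path in `S` is a shortest path if it is rectifiable and its length is the intrinsic distance
of its endpoints. -/
def IsShortestPath (S : Set (Ambient d)) {a b : Ambient d} (γ : Path a b) : Prop :=
  range γ ⊆ S ∧ pathLength γ ≠ ∞ ∧ pathLength γ = intrinsicDist S a b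

/-- The set of cut points of `∂P`, i.e. the points that have more than one shortest path to `v`.
Paths are told apart as subsets of `∂P`, so that reparametrizations do not count as different. -/
def cutPoints (P : Set (Ambient d)) (v : Ambient d) : Set (Ambient d) :=
  {x | x ∈ frontier P ∧ ∃ γ₁ γ₂ : Path x v,
    IsShortestPath (frontier P) γ₁ ∧ IsShortestPath (frontier P) γ₂ ∧ range γ₁ ≠ range γ₂}

end ShortestPaths

section Unfolding

variable {d : ℕ}

/-- `Φ` is a folding map of the facet `F` to the facet `F'`, which share the ridge `F ∩ F'`: it
carries the affine span of `F` isometrically onto that of `F'`, fixes the common ridge pointwise,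
and the image of `F` does not meet the relative interior of `F'`.  It is viewed as a motion of the
whole space; only its restriction to the affine span of `F` matters, and that restriction is
determined by these conditions. -/
structure IsFoldingMap (P F F' : Set (Ambient d)) (Φ : Ambient d ≃ᵃⁱ[ℝ] Ambient d) : Prop where
  ridge : IsRidge P (F ∩ F')
  image_span : Φ '' (affineSpan ℝ F : Set (Ambient d)) = affineSpan ℝ F'
  fixes : ∀ x ∈ F ∩ F', Φ x = x
  opposite : Disjoint (Φ '' F) (intrinsicInterior ℝ F')

/-- A list `F₀, …, F_len` of facets of `∂P` in which consecutive facets share a ridge, together with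
the folding maps `fold i` from `F_i` to `F_{i+1}`.  Entries beyond `len` are irrelevant. -/
structure FacetList (P : Set (Ambient d)) where
  len : ℕ
  facet : ℕ → Set (Ambient d)
  fold : ℕ → (Ambient d ≃ᵃⁱ[ℝ] Ambient d)
  isFacet : ∀ i ≤ len, IsFacet P (facet i)
  isFold : ∀ i < len, IsFoldingMap P (facet i) (facet (i + 1)) (fold i)

/-- The unfolding `(fold 0)⁻¹ ∘ ⋯ ∘ (fold (i-1))⁻¹` of the span of `F_i` onto the span of `F₀`. -/
noncomputable def FacetList.unfold {P : Set (Ambient d)} (L : FacetList P) : ℕ → Ambient d → Ambient d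
  | 0 => id
  | i + 1 => fun y => L.unfold i ((L.fold i).symm y)

/-- The sequential unfolding of a subset `Γ` of `F₀ ∪ ⋯ ∪ F_len` into the span of `F₀`. -/
noncomputable def FacetList.seqUnfolding {P : Set (Ambient d)} (L : FacetList P) (Γ : Set (Ambient d)) :
    Set (Ambient d) :=
  ⋃ i ∈ Iic L.len, L.unfold i '' (Γ ∩ L.facet i)

/-- The path `γ` traverses the facets `F₀, …, F_len` in this order.  A piece may be a single point;
so a path that reaches a ridge `R ⊆ F₀` from the other side of `R` can also be unfolded into the
span of `F₀`. -/
def FacetList.Traverses {P : Set (Ambient d)} (L : FacetList P) {a b : Ambient d}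
    (γ : Path a b) : Prop :=
  ∃ t : ℕ → I, Monotone t ∧ t 0 = 0 ∧ t (L.len + 1) = 1 ∧
    ∀ i ≤ L.len, ∀ s ∈ Icc (t i) (t (i + 1)), γ s ∈ L.facet i

/-- The set `src_F` of source images for the facet `F`: the points `ν` such that some shortest path
`γ` between `v` and a point `x` of `F` that is not warped has the segment `[ν, x]` as its sequential
unfolding into the affine span of `F`.  The path is read from `x` to `v`, so that its first facet
is `F`. -/
def sourceImages (P : Set (Ambient d)) (v : Ambient d) (F : Set (Ambient d)) : Set (Ambient d) :=
  {ν | ∃ x ∈ F, ¬ IsWarped P x ∧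
    ∃ γ : Path x v, IsShortestPath (frontier P) γ ∧
    ∃ L : FacetList P, L.facet 0 = F ∧ L.Traverses γ ∧ L.seqUnfolding (range γ) = segment ℝ ν x}

end Unfolding

section Voronoi

variable {d : ℕ}

/-- The closed Voronoi cell of `ν ∈ Υ` in the affine subspace `T`. -/
def voronoiCell (T : AffineSubspace ℝ (Ambient d)) (Υ : Set (Ambient d)) (ν : Ambient d) :
    Set (Ambient d) :=
  {z | z ∈ T ∧ ∀ ν' ∈ Υ, dist z ν ≤ dist z ν'}

/-- The union of the closed cells of dimension `d - 1` in the Voronoi diagram of `Υ` in `T`; the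
cells of the diagram are the faces of the sets `voronoiCell T Υ ν` with `ν ∈ Υ`. -/
def voronoiSkeleton (T : AffineSubspace ℝ (Ambient d)) (Υ : Set (Ambient d)) : Set (Ambient d) :=
  {z | ∃ ν ∈ Υ, ∃ G k, k + 1 = d ∧ IsFace (voronoiCell T Υ ν) G k ∧ z ∈ G}

end Voronoi

end PolyhedralBoundary

/-! Write μ for the intrinsic distance and call a point regular if it lies on at most two facets.
The core is a form of Mount's lemma: if `w ∈ F` is regular and at finite distance from `v`, then
μ(w, v) is the least distance from `w` to a source image, and the shortest paths from `w` to `v`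
correspond to the nearest source images. Cut points are thus the points with two nearest sites
(`mem_cutPoints_iff`), and these make up the walls of the Voronoi diagram
(`mem_voronoiSkeleton_iff`).

Structure of shortest paths. Between regular points they avoid warped points: a bend at a warped
point can be shortened outside the interior of the polyhedron, and nearest-point projection, which
does not increase length, carries the detour to the boundary (`idist_lt_of_three`, `Geo.regular`).
Across a ridge they are straight after unfolding (`Geo.wbtw_refl`). Hence a shortest path unfolds to
a segment ending at an image ν of `v` (`Good`, `Geo.good_spec`), and its endpoint and ν determine it
(`Geo.eqOn_of_good`). Facets are convex, so a shortest path meets each one in a single time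
interval; images therefore arise from boundedly many reflections and are finite in number
(`finite_dev`).

Comparison (`idist_le_of_good`). Let a shortest path to `x ∈ F` have image ν, let y(t) run along the
segment from `x` to `w`, and put h(t) = μ(y(t), v)² - |y(t) - ν|². If a shortest path to y(t) has
image ν', the same unfolding gives μ ≤ |· - ν'| nearby. A difference of two squared distances is
affine in t, so h has a local affine upper support everywhere and obeys a minimum principle. It
vanishes at 0 and is nonpositive just after 0, hence h ≤ 0 throughout and μ(w, v) ≤ |w - ν|. If
equality holds at `w`, then h = 0 throughout, and the set of t where ν arises from an unfolded path
is closed and open to the right, so it reaches `w`.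

All this is carried out for an irredundant `Presentation`, in which folding maps are explicit
reflections (`foldingMap_eq_refl`); `sourceImages_eq` returns to the source images of the statement.
-/

namespace PolyhedralBoundary

/-! ### Path length and the intrinsic distance -/

section Paths

variable {d : ℕ} {S : Set (Ambient d)} {a b c : Ambient d}

lemma edist_le_intrinsicDist : edist a b ≤ intrinsicDist S a b := by
  refine le_iInf₂ fun γ _ => ?_
  have := eVariationOn.edist_le (fun t : I => γ t) (mem_univ (0 : I)) (mem_univ (1 : I))
  simpa [pathLength] using this

lemma pathLength_eq_extend (γ : Path a b) : pathLength γ = eVariationOn γ.extend (Icc 0 1) := by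
  have h := eVariationOn.comp_eq_of_monotoneOn γ.extend (t := (univ : Set I))
    (Subtype.val : I → ℝ) (fun _ _ _ _ h => h)
  have h2 : (Subtype.val : I → ℝ) '' univ = Icc 0 1 := by
    simp [Icc]
  rw [h2] at h
  rw [← h, pathLength]
  congr 1
  funext t
  simp

lemma intrinsicDist_le_eVariationOn {f : ℝ → Ambient d} {s t : ℝ} (hst : s ≤ t)
    (hf : ContinuousOn f (Icc s t)) (hS : MapsTo f (Icc s t) S) :
    intrinsicDist S (f s) (f t) ≤ eVariationOn f (Icc s t) := by
  have hφ : ∀ u : I, s + u * (t - s) ∈ Icc s t := fun u => by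
    have h0 := u.2.1
    have h1 := u.2.2
    constructor <;> nlinarith
  let γ : Path (f s) (f t) :=
    { toFun := fun u => f (s + u * (t - s))
      continuous_toFun := by
        refine hf.comp_continuous (by fun_prop) hφ
      source' := by simp
      target' := by simp }
  refine (iInf₂_le γ ?_).trans ?_
  · rintro _ ⟨u, rfl⟩
    exact hS (hφ u)
  · exact eVariationOn.comp_le_of_monotoneOn f (t := (univ : Set I))
      (fun u : I => s + u * (t - s)) (fun u _ w _ h => by
        have : (u : ℝ) ≤ w := h
        dsimp only
        nlinarith) (fun u _ => hφ u)

lemma intrinsicDist_le_pathLength {γ : Path a b} (h : range γ ⊆ S) :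
    intrinsicDist S a b ≤ pathLength γ := iInf₂_le γ h

lemma intrinsicDist_triangle :
    intrinsicDist S a c ≤ intrinsicDist S a b + intrinsicDist S b c := by
  simp only [intrinsicDist]
  rw [ENNReal.iInf_add]
  refine le_iInf fun γ => ?_
  rw [ENNReal.iInf_add]
  refine le_iInf fun hγ => ?_
  rw [ENNReal.add_iInf]
  refine le_iInf fun δ => ?_
  rw [ENNReal.add_iInf]
  refine le_iInf fun hδ => ?_
  let f : ℝ → Ambient d := fun u => if u ≤ 1 then γ.extend u else δ.extend (u - 1)
  have hf : Continuous f := by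
    refine Continuous.if_le γ.continuous_extend (δ.continuous_extend.comp (by fun_prop))
      continuous_id continuous_const ?_
    rintro x rfl
    simp
  have hS : MapsTo f (Icc 0 2) S := by
    intro u _
    by_cases h : u ≤ 1
    · simp only [f, h, if_true]
      exact hγ (γ.extend_range ▸ mem_range_self u)
    · simp only [f, h, if_false]
      exact hδ (δ.extend_range ▸ mem_range_self (u - 1))
  have key := intrinsicDist_le_eVariationOn (by norm_num : (0 : ℝ) ≤ 2) hf.continuousOn hS
  have e0 : f 0 = a := by simp [f]
  have e2 : f 2 = c := by
    have : ¬ ((2 : ℝ) ≤ 1) := by norm_num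
    simp only [f, this, if_false]
    norm_num
  rw [e0, e2] at key
  refine (le_trans (by rfl) key).trans ?_
  have hsplit := eVariationOn.Icc_add_Icc f (s := univ) (by norm_num : (0 : ℝ) ≤ 1)
    (by norm_num : (1 : ℝ) ≤ 2) (mem_univ _)
  simp only [univ_inter] at hsplit
  rw [← hsplit, pathLength_eq_extend, pathLength_eq_extend]
  refine add_le_add (le_of_eq ?_) ?_
  · refine eVariationOn.congr fun u hu => ?_
    simp [f, hu.2]
  · have : EqOn f (δ.extend ∘ fun u => u - 1) (Icc 1 2) := by
      intro u hu
      rcases eq_or_lt_of_le hu.1 with h | h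
      · subst h
        simp [f]
      · simp [f, not_le.2 h]
    rw [eVariationOn.congr this]
    refine eVariationOn.comp_le_of_monotoneOn _ _ (fun _ _ _ _ h => by simpa using h) ?_
    intro u hu
    constructor <;> linarith [hu.1, hu.2]

/-- Intended for the nearest-point projection, which pushes segments outside the interior of a
polyhedron onto its boundary without lengthening them. -/
lemma intrinsicDist_le_edist_of_lipschitz {π : Ambient d → Ambient d} (hπ : LipschitzWith 1 π)
    (h : MapsTo π (segment ℝ a b) S) : intrinsicDist S (π a) (π b) ≤ edist a b := by
  let f : ℝ → Ambient d := fun u => π (AffineMap.lineMap a b u)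
  have hl : LipschitzWith (nndist a b) (AffineMap.lineMap a b : ℝ → Ambient d) :=
    LipschitzWith.of_dist_le_mul fun x y => by
      rw [dist_lineMap_lineMap, mul_comm, coe_nndist]
  have hf : LipschitzWith (nndist a b) f := by
    have := hπ.comp hl
    rwa [one_mul] at this
  have hS : MapsTo f (Icc 0 1) S := by
    intro u hu
    refine h ?_
    rw [segment_eq_image_lineMap]
    exact mem_image_of_mem _ hu
  have key := intrinsicDist_le_eVariationOn zero_le_one hf.continuous.continuousOn hS
  have := hf.lipschitzOnWith.comp_eVariationOn_le (g := (id : ℝ → ℝ)) (s := Icc (0 : ℝ) 1)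
    (t := univ) (fun _ _ => mem_univ _)
  rw [eVariationOn_id_Icc] at this
  simp only [f, AffineMap.lineMap_apply_zero, AffineMap.lineMap_apply_one] at key
  refine key.trans (this.trans ?_)
  rw [edist_nndist]
  simp

lemma intrinsicDist_le_edist (h : segment ℝ a b ⊆ S) : intrinsicDist S a b ≤ edist a b :=
  intrinsicDist_le_edist_of_lipschitz LipschitzWith.id (fun _ hx => h hx)

lemma intrinsicDist_eq_edist (h : segment ℝ a b ⊆ S) : intrinsicDist S a b = edist a b :=
  le_antisymm (intrinsicDist_le_edist h) edist_le_intrinsicDist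

/-- The path runs backwards along `Γ`: arc length is measured from `v`, whereas the paths of the
statement end at `v`. -/
lemma exists_path_pathLength_le {Γ : ℝ → Ambient d} {D : ℝ} (hD : 0 ≤ D)
    (hΓ : LipschitzOnWith 1 Γ (Icc 0 D)) :
    ∃ γ : Path (Γ D) (Γ 0), range γ = Γ '' Icc 0 D ∧ pathLength γ ≤ ENNReal.ofReal D := by
  have hφ : ∀ u : I, D * (1 - u) ∈ Icc 0 D := fun u => by
    have h0 := u.2.1
    have h1 := u.2.2
    constructor <;> nlinarith
  let γ : Path (Γ D) (Γ 0) :=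
    { toFun := fun u => Γ (D * (1 - u))
      continuous_toFun := hΓ.continuousOn.comp_continuous (by fun_prop) hφ
      source' := by simp
      target' := by simp }
  refine ⟨γ, ?_, ?_⟩
  · ext y
    constructor
    · rintro ⟨u, rfl⟩
      exact ⟨_, hφ u, rfl⟩
    · rintro ⟨r, hr, rfl⟩
      rcases hD.eq_or_lt with h | h
      · subst h
        have : r = 0 := le_antisymm hr.2 hr.1
        exact ⟨0, by simp [γ, this]⟩
      · refine ⟨⟨1 - r / D, ?_, ?_⟩, ?_⟩
        · have := (div_le_one h).2 hr.2
          linarith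
        · have := div_nonneg hr.1 hD
          linarith
        · change Γ (D * (1 - (1 - r / D))) = Γ r
          congr 1
          field_simp
          ring
  · have h1 : pathLength γ ≤ eVariationOn Γ (Icc 0 D) :=
      eVariationOn.comp_le_of_antitoneOn Γ (t := (univ : Set I))
        (fun u : I => D * (1 - u)) (fun u _ w _ h => by
          have : (u : ℝ) ≤ w := h
          dsimp only
          nlinarith) (fun u _ => hφ u)
    have h2 := hΓ.comp_eVariationOn_le (g := (id : ℝ → ℝ)) (s := Icc (0 : ℝ) D)
      (fun _ h => h)
    rw [eVariationOn_id_Icc] at h2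
    refine h1.trans (h2.trans ?_)
    simp

end Paths

/-! ### Irredundant inequalities and relative interiors -/

section Irredundant

variable {E : Type*} [NormedAddCommGroup E] [InnerProductSpace ℝ E]

/-- In a minimal equivalent subsystem, dropping the constraint `j` admits a point `y` that violates
only `j`. The segment from the strictly feasible `x₀` to `y` crosses the `j`-th hyperplane at a
point where the other constraints are strict. Used for polyhedra and again for Voronoi cells inside
`T`. -/
lemma exists_irredundant {ι : Type*} [Fintype ι] (a : ι → E) (b : ι → ℝ) {T : Set E}
    (hT : Convex ℝ T) {x₀ : E} (hx₀ : x₀ ∈ T) (h₀ : ∀ i, inner ℝ (a i) x₀ < b i) :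
    ∃ J : Finset ι, (∀ x ∈ T, (∀ i ∈ J, inner ℝ (a i) x ≤ b i) → ∀ i, inner ℝ (a i) x ≤ b i) ∧
      ∀ j ∈ J, ∃ c ∈ T, inner ℝ (a j) c = b j ∧ ∀ i ∈ J, i ≠ j → inner ℝ (a i) c < b i := by
  classical
  obtain ⟨J, hJ, hmin⟩ := WellFounded.has_min (wellFounded_lt (α := Finset ι))
    {J | ∀ x ∈ T, (∀ i ∈ J, inner ℝ (a i) x ≤ b i) → ∀ i, inner ℝ (a i) x ≤ b i}
    ⟨Finset.univ, fun x _ h i => h i (Finset.mem_univ i)⟩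
  refine ⟨J, hJ, fun j hj => ?_⟩
  have hne : ¬ ∀ x ∈ T, (∀ i ∈ J.erase j, inner ℝ (a i) x ≤ b i) → ∀ i, inner ℝ (a i) x ≤ b i :=
    fun h => hmin (J.erase j) h (Finset.erase_ssubset hj)
  simp only [not_forall] at hne
  obtain ⟨y, hyT, hy, k, hk⟩ := hne
  have hyj : b j < inner ℝ (a j) y := by
    by_contra hle
    refine hk (hJ y hyT (fun i hi => ?_) k)
    by_cases hij : i = j
    · subst hij
      exact not_lt.1 hle
    · exact hy i (Finset.mem_erase.2 ⟨hij, hi⟩)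
  have h0j := h₀ j
  set p := b j - inner ℝ (a j) x₀
  set q := inner ℝ (a j) y - b j
  have hp : 0 < p := sub_pos.2 h0j
  have hq : 0 < q := sub_pos.2 hyj
  have hpq : p + q ≠ 0 := (add_pos hp hq).ne'
  refine ⟨(q / (p + q)) • x₀ + (p / (p + q)) • y, hT hx₀ hyT (by positivity) (by positivity)
    (by field_simp; ring), ?_, fun i hi hij => ?_⟩
  · rw [inner_add_right, inner_smul_right, inner_smul_right]
    field_simp
    simp only [p, q]
    ring
  · have h1 := h₀ i
    have h2 := hy i (Finset.mem_erase.2 ⟨hij, hi⟩)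
    rw [inner_add_right, inner_smul_right, inner_smul_right]
    have h3 : q / (p + q) * inner ℝ (a i) x₀ < q / (p + q) * b i :=
      mul_lt_mul_of_pos_left h1 (by positivity)
    have h4 : p / (p + q) * inner ℝ (a i) y ≤ p / (p + q) * b i :=
      mul_le_mul_of_nonneg_left h2 (by positivity)
    have h5 : q / (p + q) * b i + p / (p + q) * b i = b i := by
      field_simp
      ring
    linarith

/-- The segment from `y` to `w` can be prolonged inside `K` slightly beyond `w`, where `l` would
exceed its maximum if `l y < l w`. -/
lemma eq_of_isMaxOn_of_mem_intrinsicInterior {l : StrongDual ℝ E} {K : Set E} {w : E}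
    (hw : w ∈ intrinsicInterior ℝ K) (hl : ∀ y ∈ K, l y ≤ l w) {y : E} (hy : y ∈ K) :
    l y = l w := by
  refine le_antisymm (hl y hy) ?_
  obtain ⟨w', hw', rfl⟩ := mem_intrinsicInterior.1 hw
  have hyA : y ∈ affineSpan ℝ K := subset_affineSpan ℝ K hy
  let f : ℝ → affineSpan ℝ K := fun t =>
    ⟨AffineMap.lineMap (w' : E) y t, AffineMap.lineMap_mem t w'.2 hyA⟩
  have hf : Continuous f := AffineMap.lineMap_continuous.subtype_mk _
  have hf0 : f 0 = w' := by simp [f]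
  have hmem : ∀ᶠ t in nhds (0 : ℝ), f t ∈ interior ((↑) ⁻¹' K : Set (affineSpan ℝ K)) :=
    hf.continuousAt.eventually (by rw [hf0]; exact isOpen_interior.mem_nhds hw')
  have hneg : ∀ᶠ t in nhdsWithin (0 : ℝ) (Iio 0), f t ∈ interior ((↑) ⁻¹' K) ∧ t < 0 :=
    (hmem.filter_mono nhdsWithin_le_nhds).and self_mem_nhdsWithin
  obtain ⟨t, ht, ht0⟩ := hneg.exists
  have h1 : ((f t : affineSpan ℝ K) : E) ∈ K := by
    have := interior_subset ht
    exact this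
  have h2 := hl _ h1
  have h3 : ((f t : affineSpan ℝ K) : E) = AffineMap.lineMap (w' : E) y t := rfl
  rw [h3, AffineMap.lineMap_apply_module', map_add, map_smul, map_sub, smul_eq_mul] at h2
  nlinarith

end Irredundant

/-! ### Presentations by facet inequalities; independence of normals -/

/-- A presentation of a polyhedron by unit normals in which every inequality defines a facet:
`center i` lies on the `i`-th hyperplane and satisfies all the other inequalities strictly. -/
structure Presentation (d : ℕ) (ι : Type) where
  normal : ι → Ambient d
  bound : ι → ℝ
  norm_normal : ∀ i, ‖normal i‖ = 1
  center : ι → Ambient d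
  inner_center : ∀ i, inner ℝ (normal i) (center i) = bound i
  inner_center_lt : ∀ i j, j ≠ i → inner ℝ (normal j) (center i) < bound j

namespace Presentation

variable {d : ℕ} {ι : Type} (Q : Presentation d ι)

/-- The signed distance of a point to the `i`-th hyperplane, nonnegative on the polyhedron. -/
noncomputable def slack (i : ι) (x : Ambient d) : ℝ := Q.bound i - inner ℝ (Q.normal i) x

/-- The polyhedron of a presentation. -/
def carrier : Set (Ambient d) := {x | ∀ i, 0 ≤ Q.slack i x}

/-- The `i`-th facet. -/
def facet (i : ι) : Set (Ambient d) := {x | x ∈ Q.carrier ∧ Q.slack i x = 0}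

/-- A point that lies on at most two facets. -/
def Regular (x : Ambient d) : Prop :=
  ∀ i j k, Q.slack i x = 0 → Q.slack j x = 0 → Q.slack k x = 0 → i = j ∨ i = k ∨ j = k

variable {Q} {i j k : ι} {x y z : Ambient d}

lemma slack_center : Q.slack i (Q.center i) = 0 := by
  simp [slack, Q.inner_center]

lemma slack_center_pos (h : j ≠ i) : 0 < Q.slack j (Q.center i) :=
  sub_pos.2 (Q.inner_center_lt i j h)

lemma center_mem_facet : Q.center i ∈ Q.facet i := by
  refine ⟨fun j => ?_, slack_center⟩
  by_cases h : j = i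
  · subst h
    exact slack_center.ge
  · exact (slack_center_pos h).le

lemma slack_add : Q.slack i (x + y) = Q.slack i x - inner ℝ (Q.normal i) y := by
  simp only [slack, inner_add_right]
  ring

lemma slack_combo {s t : ℝ} (h : s + t = 1) :
    Q.slack i (s • x + t • y) = s * Q.slack i x + t * Q.slack i y := by
  simp only [slack, inner_add_right, inner_smul_right]
  obtain rfl : s = 1 - t := by linarith
  ring

lemma slack_lineMap (t : ℝ) :
    Q.slack i (AffineMap.lineMap x y t) = (1 - t) * Q.slack i x + t * Q.slack i y := by
  rw [AffineMap.lineMap_apply_module, slack_combo (by ring)]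

lemma inner_sub_eq : inner ℝ (Q.normal i) (x - y) = Q.slack i y - Q.slack i x := by
  simp only [slack, inner_sub_right]
  ring

lemma continuous_slack : Continuous (Q.slack i) := by
  unfold slack
  fun_prop

lemma isClosed_carrier : IsClosed Q.carrier := by
  have : Q.carrier = ⋂ i, {x | 0 ≤ Q.slack i x} := by
    ext
    simp [carrier]
  rw [this]
  exact isClosed_iInter fun i => isClosed_le continuous_const continuous_slack

lemma isClosed_facet : IsClosed (Q.facet i) :=
  isClosed_carrier.inter (isClosed_eq continuous_slack continuous_const)

lemma convex_carrier : Convex ℝ Q.carrier := by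
  intro x hx y hy s t hs ht hst k
  rw [slack_combo hst]
  have := hx k
  have := hy k
  positivity

lemma convex_facet : Convex ℝ (Q.facet i) := by
  intro x hx y hy s t hs ht hst
  refine ⟨convex_carrier hx.1 hy.1 hs ht hst, ?_⟩
  rw [slack_combo hst, hx.2, hy.2]
  ring

lemma slack_eventually_pos [Finite ι] (z : Ambient d) :
    ∀ᶠ y in nhds z, ∀ k, 0 < Q.slack k z → 0 < Q.slack k y := by
  rw [Filter.eventually_all]
  intro k
  by_cases h : 0 < Q.slack k z
  · filter_upwards [continuous_slack.continuousAt.eventually (lt_mem_nhds h)] with y hy _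
    exact hy
  · exact Filter.Eventually.of_forall fun _ h' => (h h').elim

/-- Strict inequalities persist nearby, so close to `z` only the facets through `z` occur. -/
lemma tight_eventually_subset [Finite ι] (hz : z ∈ Q.carrier) :
    ∀ᶠ y in nhds z, ∀ k, Q.slack k y = 0 → Q.slack k z = 0 := by
  filter_upwards [slack_eventually_pos (Q := Q) z] with y hy k hk
  by_contra hne
  exact (hy k ((hz k).lt_of_ne' hne)).ne' hk

lemma mem_frontier_iff [Finite ι] : x ∈ frontier Q.carrier ↔ ∃ i, x ∈ Q.facet i := by
  rw [isClosed_carrier.frontier_eq]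
  constructor
  · rintro ⟨hx, hint⟩
    by_contra! hne
    refine hint (mem_interior_iff_mem_nhds.2 ?_)
    filter_upwards [slack_eventually_pos (Q := Q) x] with y hy k
    exact (hy k ((hx k).lt_of_ne' fun h => hne k ⟨hx, h⟩)).le
  · rintro ⟨i, hx⟩
    refine ⟨hx.1, fun hint => ?_⟩
    have hc : Filter.Tendsto (fun t : ℝ => x + t • Q.normal i) (nhds 0) (nhds x) := by
      have : Continuous (fun t : ℝ => x + t • Q.normal i) := by fun_prop
      simpa using this.tendsto 0
    have := (hc.eventually (mem_interior_iff_mem_nhds.1 hint)).filter_mono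
      (nhdsWithin_le_nhds (s := Ioi 0))
    obtain ⟨t, ht, ht0⟩ := (this.and self_mem_nhdsWithin).exists
    have h1 : 0 ≤ Q.slack i (x + t • Q.normal i) := ht i
    have ht0 : 0 < t := ht0
    rw [slack_add, hx.2, inner_smul_right, real_inner_self_eq_norm_sq, Q.norm_normal] at h1
    linarith

lemma facet_subset_frontier [Finite ι] : Q.facet i ⊆ frontier Q.carrier :=
  fun _ h => mem_frontier_iff.2 ⟨i, h⟩

lemma segment_subset_facet (hx : x ∈ Q.facet i) (hy : y ∈ Q.facet i) :
    segment ℝ x y ⊆ Q.facet i := convex_facet.segment_subset hx hy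

lemma segment_subset_frontier [Finite ι] (hx : x ∈ Q.facet i) (hy : y ∈ Q.facet i) :
    segment ℝ x y ⊆ frontier Q.carrier :=
  (segment_subset_facet hx hy).trans facet_subset_frontier

lemma sum_smul_slack {α β γ : ℝ} (hi : Q.slack i z = 0) (hj : Q.slack j z = 0)
    (hk : Q.slack k z = 0)
    (h : α • Q.normal i + β • Q.normal j + γ • Q.normal k = 0) (y : Ambient d) :
    α * Q.slack i y + β * Q.slack j y + γ * Q.slack k y = 0 := by
  have := congrArg (fun v => inner ℝ v (z - y)) h
  simp only [inner_add_left, real_inner_smul_left, inner_sub_eq, hi, hj, hk, sub_zero,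
    inner_zero_left] at this
  exact this

/-- A relation between the normals is a relation between the three slacks, since all vanish at `z`.
Evaluated at the three centers, it forces any two of the coefficients to have opposite signs, which
three nonzero numbers cannot do. -/
lemma normal_independent_three (hi : Q.slack i z = 0) (hj : Q.slack j z = 0)
    (hk : Q.slack k z = 0) (hij : i ≠ j) (hik : i ≠ k) (hjk : j ≠ k) {α β γ : ℝ}
    (h : α • Q.normal i + β • Q.normal j + γ • Q.normal k = 0) : α = 0 ∧ β = 0 ∧ γ = 0 := by
  have h1 := sum_smul_slack hi hj hk h (Q.center i)
  have h2 := sum_smul_slack hi hj hk h (Q.center j)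
  have h3 := sum_smul_slack hi hj hk h (Q.center k)
  rw [slack_center] at h1 h2 h3
  have a1 : 0 < Q.slack j (Q.center i) := slack_center_pos hij.symm
  have a2 : 0 < Q.slack k (Q.center i) := slack_center_pos hik.symm
  have b1 : 0 < Q.slack i (Q.center j) := slack_center_pos hij
  have b2 : 0 < Q.slack k (Q.center j) := slack_center_pos hjk.symm
  have c1 : 0 < Q.slack i (Q.center k) := slack_center_pos hik
  have c2 : 0 < Q.slack j (Q.center k) := slack_center_pos hjk
  have sgn : ∀ {u v p q : ℝ}, 0 < p → 0 < q → u * p + v * q = 0 → (0 < u → v < 0) ∧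
      (u < 0 → 0 < v) ∧ (u = 0 → v = 0) := by
    intro u v p q hp hq h
    refine ⟨fun hu => ?_, fun hu => ?_, fun hu => ?_⟩
    · by_contra hv
      nlinarith [mul_pos hu hp]
    · by_contra hv
      nlinarith [mul_pos (neg_pos.2 hu) hp]
    · subst hu
      have : v * q = 0 := by linarith
      exact (mul_eq_zero.1 this).resolve_right hq.ne'
  have s1 := sgn a1 a2 (by linarith : β * _ + γ * _ = 0)
  have s2 := sgn b1 b2 (by linarith : α * _ + γ * _ = 0)
  have s3 := sgn c1 c2 (by linarith : α * _ + β * _ = 0)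
  rcases lt_trichotomy α 0 with h0 | h0 | h0
  · have := s3.2.1 h0
    have := s2.2.1 h0
    have := s1.1 (s3.2.1 h0)
    linarith
  · exact ⟨h0, s3.2.2 h0, s2.2.2 h0⟩
  · have := s3.1 h0
    have := s2.1 h0
    have := s1.2.1 (s3.1 h0)
    linarith

lemma normal_independent_two (hi : Q.slack i z = 0) (hj : Q.slack j z = 0) (hij : i ≠ j)
    {α β : ℝ} (h : α • Q.normal i + β • Q.normal j = 0) : α = 0 ∧ β = 0 := by
  have h' : α • Q.normal i + β • Q.normal j + (0 : ℝ) • Q.normal j = 0 := by simpa using h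
  have h1 := sum_smul_slack hi hj hj h' (Q.center i)
  have h2 := sum_smul_slack hi hj hj h' (Q.center j)
  rw [slack_center] at h1 h2
  have a1 : 0 < Q.slack j (Q.center i) := slack_center_pos hij.symm
  have b1 : 0 < Q.slack i (Q.center j) := slack_center_pos hij
  constructor
  · have : α * Q.slack i (Q.center j) = 0 := by linarith
    exact (mul_eq_zero.1 this).resolve_right b1.ne'
  · have : β * Q.slack j (Q.center i) = 0 := by linarith
    exact (mul_eq_zero.1 this).resolve_right a1.ne'

end Presentation

lemma IsConvexPolyhedron.exists_presentation {d : ℕ} {P : Set (Ambient d)}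
    (hP : IsConvexPolyhedron P) :
    ∃ (ι : Type) (_ : Fintype ι) (Q : Presentation d ι), Q.carrier = P := by
  obtain ⟨⟨n, a, b, ha, rfl⟩, hspan⟩ := hP
  have hconv : Convex ℝ {x : Ambient d | ∀ i, inner ℝ (a i) x ≤ b i} := by
    intro x hx y hy s t hs ht hst i
    have h1 := hx i
    have h2 := hy i
    rw [inner_add_right, inner_smul_right, inner_smul_right]
    obtain rfl : s = 1 - t := by linarith
    nlinarith
  obtain ⟨x₀, hx₀⟩ := (hconv.interior_nonempty_iff_affineSpan_eq_top).2 hspan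
  have hstrict : ∀ i, inner ℝ (a i) x₀ < b i := by
    intro i
    have hc : Filter.Tendsto (fun t : ℝ => x₀ + t • a i) (nhds 0) (nhds x₀) := by
      have : Continuous (fun t : ℝ => x₀ + t • a i) := by fun_prop
      simpa using this.tendsto 0
    have := (hc.eventually (mem_interior_iff_mem_nhds.1 hx₀)).filter_mono
      (nhdsWithin_le_nhds (s := Ioi 0))
    obtain ⟨t, ht, ht0⟩ := (this.and self_mem_nhdsWithin).exists
    have h1 : inner ℝ (a i) (x₀ + t • a i) ≤ b i := ht i
    have ht0 : 0 < t := ht0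
    rw [inner_add_right, inner_smul_right, real_inner_self_eq_norm_sq] at h1
    have := norm_pos_iff.2 (ha i)
    have : 0 < t * ‖a i‖ ^ 2 := by positivity
    linarith
  obtain ⟨J, hJ, hc⟩ := exists_irredundant a b convex_univ (mem_univ x₀) hstrict
  choose c _ hcj hci using hc
  have hscale : ∀ (i : Fin n) (x : Ambient d),
      inner ℝ (‖a i‖⁻¹ • a i) x = ‖a i‖⁻¹ * inner ℝ (a i) x := fun i x => real_inner_smul_left _ _ _
  have hpos : ∀ i, 0 < ‖a i‖⁻¹ := fun i => inv_pos.2 (norm_pos_iff.2 (ha i))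
  refine ⟨{j // j ∈ J}, inferInstance,
    { normal := fun j => ‖a j‖⁻¹ • a j
      bound := fun j => ‖a j‖⁻¹ * b j
      norm_normal := fun j => norm_smul_inv_norm (𝕜 := ℝ) (ha j)
      center := fun j => c j j.2
      inner_center := fun j => by rw [hscale, hcj]
      inner_center_lt := fun i j hij => by
        rw [hscale]
        exact mul_lt_mul_of_pos_left
          (hci i i.2 j j.2 fun h => hij (Subtype.ext h)) (hpos _) }, ?_⟩
  ext x
  have : ∀ j : {j // j ∈ J}, 0 ≤ ‖a j‖⁻¹ * b j - inner ℝ (‖a j‖⁻¹ • a (j : Fin n)) x ↔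
      inner ℝ (a j) x ≤ b j := by
    intro j
    rw [hscale, sub_nonneg, mul_le_mul_iff_right₀ (hpos _)]
  constructor
  · intro h
    exact hJ x (mem_univ x) fun i hi => (this ⟨i, hi⟩).1 (h ⟨i, hi⟩)
  · intro h j
    exact (this j).2 (h j)

/-! ### Facets, ridges and warped points in terms of tight inequalities -/

lemma IsFace.exists_functional {d k : ℕ} {C G : Set (Ambient d)} (h : IsFace C G k) :
    ∃ l : StrongDual ℝ (Ambient d), G = {x ∈ C | ∀ y ∈ C, l y ≤ l x} := h.2.1 h.1

lemma finrank_direction_mono {d : ℕ} {A B : Set (Ambient d)} (h : A ⊆ B) :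
    Module.finrank ℝ (affineSpan ℝ A).direction ≤ Module.finrank ℝ (affineSpan ℝ B).direction :=
  Submodule.finrank_mono (AffineSubspace.direction_le (affineSpan_mono ℝ h))

lemma direction_le_orthogonal {d : ℕ} {G s : Set (Ambient d)}
    (h : ∀ n ∈ s, ∀ x ∈ G, ∀ y ∈ G, inner ℝ n (x - y) = 0) :
    (affineSpan ℝ G).direction ≤ (Submodule.span ℝ s)ᗮ := by
  rw [direction_affineSpan, vectorSpan_def, Submodule.span_le]
  rintro _ ⟨x, hx, y, hy, rfl⟩
  rw [SetLike.mem_coe, Submodule.mem_orthogonal]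
  intro u hu
  induction hu using Submodule.span_induction with
  | mem n hn => exact h n hn x hx y hy
  | zero => simp
  | add a b _ _ ha hb => rw [inner_add_left, ha, hb, add_zero]
  | smul a b _ hb => rw [real_inner_smul_left, hb, mul_zero]

lemma finrank_orthogonal_add {d : ℕ} (K : Submodule ℝ (Ambient d)) :
    Module.finrank ℝ K + Module.finrank ℝ Kᗮ = d + 1 := by
  rw [Submodule.finrank_add_finrank_orthogonal]
  simp

lemma mem_orthogonal_span_iff {d : ℕ} {s : Set (Ambient d)} {y : Ambient d} :
    y ∈ (Submodule.span ℝ s)ᗮ ↔ ∀ n ∈ s, inner ℝ n y = 0 := by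
  rw [Submodule.mem_orthogonal]
  constructor
  · exact fun h n hn => h n (Submodule.subset_span hn)
  · intro h u hu
    induction hu using Submodule.span_induction with
    | mem n hn => exact h n hn
    | zero => simp
    | add a b _ _ ha hb => rw [inner_add_left, ha, hb, add_zero]
    | smul a b _ hb => rw [real_inner_smul_left, hb, mul_zero]

namespace Presentation

variable {d : ℕ} {ι : Type} {Q : Presentation d ι} {i j k : ι} {x y z : Ambient d}

lemma isExposed_of_forall_slack {G : Set (Ambient d)} (u : Ambient d)
    (h : ∃ β : ℝ, (∀ x ∈ Q.carrier, inner ℝ u x ≤ β) ∧ ∃ z ∈ Q.carrier, inner ℝ u z = β ∧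
      G = {x | x ∈ Q.carrier ∧ inner ℝ u x = β}) : IsExposed ℝ Q.carrier G := by
  obtain ⟨β, hβ, z, hz, hzβ, rfl⟩ := h
  refine fun _ => ⟨innerSL ℝ u, ?_⟩
  ext x
  constructor
  · rintro ⟨hx, hxβ⟩
    exact ⟨hx, fun y hy => by simpa [hxβ] using hβ y hy⟩
  · rintro ⟨hx, hmax⟩
    refine ⟨hx, le_antisymm (hβ x hx) ?_⟩
    have := hmax z hz
    simpa [hzβ] using this

lemma isExposed_facet : IsExposed ℝ Q.carrier (Q.facet i) := by
  refine isExposed_of_forall_slack (Q.normal i) ⟨Q.bound i, fun x hx => sub_nonneg.1 (hx i),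
    Q.center i, center_mem_facet.1, Q.inner_center i, ?_⟩
  ext x
  simp only [facet, slack, mem_ofPred_eq, sub_eq_zero]
  exact and_congr_right fun _ => eq_comm

lemma isExposed_inter_facet (hi : x ∈ Q.facet i) (hj : x ∈ Q.facet j) :
    IsExposed ℝ Q.carrier (Q.facet i ∩ Q.facet j) := by
  have key : ∀ y, inner ℝ (Q.normal i + Q.normal j) y =
      Q.bound i + Q.bound j - (Q.slack i y + Q.slack j y) := fun y => by
    simp only [slack, inner_add_left]
    ring
  refine isExposed_of_forall_slack (Q.normal i + Q.normal j) ⟨Q.bound i + Q.bound j,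
    fun y hy => ?_, x, hi.1, ?_, ?_⟩
  · rw [key]
    linarith [hy i, hy j]
  · rw [key, hi.2, hj.2]
    ring
  · ext y
    simp only [mem_ofPred_eq, key]
    constructor
    · rintro ⟨h1, h2⟩
      exact ⟨h1.1, by rw [h1.2, h2.2]; ring⟩
    · rintro ⟨h1, h2⟩
      have a := h1 i
      have b := h1 j
      exact ⟨⟨h1, by linarith⟩, ⟨h1, by linarith⟩⟩

lemma add_smul_mem_carrier_eventually [Finite ι] (hz : z ∈ Q.carrier)
    (hy : ∀ k, Q.slack k z = 0 → inner ℝ (Q.normal k) y ≤ 0) :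
    ∀ᶠ t in nhdsWithin (0 : ℝ) (Ioi 0), z + t • y ∈ Q.carrier := by
  have hc : Filter.Tendsto (fun t : ℝ => z + t • y) (nhds 0) (nhds z) := by
    have : Continuous (fun t : ℝ => z + t • y) := by fun_prop
    simpa using this.tendsto 0
  filter_upwards [(hc.eventually (slack_eventually_pos (Q := Q) z)).filter_mono nhdsWithin_le_nhds,
    self_mem_nhdsWithin] with t ht ht0 k
  have ht0 : 0 < t := ht0
  rcases (hz k).eq_or_lt with h | h
  · rw [slack_add, ← h, inner_smul_right]
    have := hy k h.symm
    nlinarith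
  · exact (ht k h).le

/-- Such a `y` can be followed a little in both directions inside the polyhedron; as `l` is maximal
at `z`, it is constant along the way, so the whole short segment lies in the face. -/
lemma mem_direction_of_face [Finite ι] {l : StrongDual ℝ (Ambient d)}
    (hz : z ∈ {x ∈ Q.carrier | ∀ y ∈ Q.carrier, l y ≤ l x})
    (hy : ∀ k, Q.slack k z = 0 → inner ℝ (Q.normal k) y = 0) :
    y ∈ (affineSpan ℝ {x ∈ Q.carrier | ∀ y ∈ Q.carrier, l y ≤ l x}).direction := by
  have h1 := add_smul_mem_carrier_eventually hz.1 fun k hk => (hy k hk).le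
  have h2 := add_smul_mem_carrier_eventually (y := -y) hz.1 fun k hk => by
    rw [inner_neg_right, hy k hk, neg_zero]
  obtain ⟨t, ⟨ht1, ht2⟩, ht0⟩ := ((h1.and h2).and self_mem_nhdsWithin).exists
  have ht0 : 0 < t := ht0
  have l1 := hz.2 _ ht1
  have l2 := hz.2 _ ht2
  have l3 : l (z + t • y) = l z := by
    rw [map_add, map_smul, smul_eq_mul] at l1 ⊢
    rw [map_add, map_smul, map_neg, smul_eq_mul] at l2
    linarith
  have hm : z + t • y ∈ {x ∈ Q.carrier | ∀ y ∈ Q.carrier, l y ≤ l x} :=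
    ⟨ht1, fun w hw => l3 ▸ hz.2 w hw⟩
  have := AffineSubspace.vsub_mem_direction (subset_affineSpan ℝ _ hm) (subset_affineSpan ℝ _ hz)
  rw [vsub_eq_sub, add_sub_cancel_left] at this
  exact (Submodule.smul_mem_iff _ ht0.ne').1 this

lemma finrank_span_normal : Module.finrank ℝ (Submodule.span ℝ {Q.normal i}) = 1 :=
  finrank_span_singleton fun h => by
    have := Q.norm_normal i
    rw [h, norm_zero] at this
    exact zero_ne_one this

lemma finrank_orthogonal_normal : Module.finrank ℝ (Submodule.span ℝ {Q.normal i})ᗮ = d := by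
  have := finrank_orthogonal_add (Submodule.span ℝ {Q.normal i})
  rw [finrank_span_normal] at this
  omega

lemma mem_affineSpan_of_direction {K : Set (Ambient d)} (hz : z ∈ K)
    (h : y - z ∈ (affineSpan ℝ K).direction) : y ∈ affineSpan ℝ K := by
  have := AffineSubspace.vadd_mem_of_mem_direction h (subset_affineSpan ℝ K hz)
  simpa using this

lemma facet_eq_exposed : ∃ l : StrongDual ℝ (Ambient d),
    Q.facet i = {x ∈ Q.carrier | ∀ y ∈ Q.carrier, l y ≤ l x} :=
  isExposed_facet ⟨_, center_mem_facet⟩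

lemma direction_facet [Finite ι] :
    (affineSpan ℝ (Q.facet i)).direction = (Submodule.span ℝ {Q.normal i})ᗮ := by
  apply le_antisymm
  · refine direction_le_orthogonal ?_
    rintro _ rfl x hx y hy
    rw [inner_sub_eq, hx.2, hy.2, sub_zero]
  · intro y hy
    obtain ⟨l, hl⟩ := facet_eq_exposed (Q := Q) (i := i)
    rw [hl]
    refine mem_direction_of_face (z := Q.center i) (hl ▸ center_mem_facet) fun k hk => ?_
    by_cases h : k = i
    · subst h
      exact mem_orthogonal_span_iff.1 hy _ rfl
    · exact absurd hk (slack_center_pos h).ne'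

lemma mem_affineSpan_facet [Finite ι] : x ∈ affineSpan ℝ (Q.facet i) ↔ Q.slack i x = 0 := by
  constructor
  · intro h
    have := AffineSubspace.vsub_mem_direction h (subset_affineSpan ℝ _ (center_mem_facet (Q := Q)))
    rw [direction_facet, mem_orthogonal_span_iff] at this
    have := this _ rfl
    rw [vsub_eq_sub, inner_sub_eq, slack_center] at this
    linarith
  · intro h
    refine mem_affineSpan_of_direction (center_mem_facet (Q := Q)) ?_
    rw [direction_facet, mem_orthogonal_span_iff]
    rintro _ rfl
    rw [inner_sub_eq, slack_center, h, sub_zero]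

lemma isFacet_facet [Finite ι] : IsFacet Q.carrier (Q.facet i) :=
  ⟨⟨_, center_mem_facet⟩, isExposed_facet, by rw [direction_facet, finrank_orthogonal_normal]⟩

lemma slack_eq_zero_of_mem_intrinsicInterior {K : Set (Ambient d)} (hK : K ⊆ Q.carrier)
    {w : Ambient d} (hw : w ∈ intrinsicInterior ℝ K) (hk : Q.slack k w = 0) (hy : y ∈ K) :
    Q.slack k y = 0 := by
  have := eq_of_isMaxOn_of_mem_intrinsicInterior (l := innerSL ℝ (Q.normal k)) hw
    (fun y hy => by
      have h := hK hy k
      simp only [slack] at h hk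
      simp only [innerSL_apply_apply]
      linarith) hy
  simp only [innerSL_apply_apply] at this
  simp only [slack] at hk ⊢
  rw [this, hk]

/-- Some inequality is tight at a relatively interior point `w` of `F`, since otherwise `F` would
have dimension `d + 1`. It is then tight on all of `F`, and equality of dimensions makes the
functional exposing `F` constant on the whole `i`-th facet. -/
lemma exists_eq_facet [Finite ι] {F : Set (Ambient d)} (hF : IsFacet Q.carrier F) :
    ∃ i, F = Q.facet i := by
  obtain ⟨l, hl⟩ := hF.exists_functional
  have hFP : F ⊆ Q.carrier := hl ▸ sep_subset _ _
  have hconv : Convex ℝ F := hF.2.1.convex convex_carrier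
  obtain ⟨w, hw⟩ := (intrinsicInterior_nonempty hconv).2 hF.1
  have hwF : w ∈ F := intrinsicInterior_subset hw
  have hrank : Module.finrank ℝ (affineSpan ℝ F).direction = d := hF.2.2
  by_cases htight : ∃ i, Q.slack i w = 0
  · obtain ⟨i, hi⟩ := htight
    have hsub : F ⊆ Q.facet i := fun y hy =>
      ⟨hFP hy, slack_eq_zero_of_mem_intrinsicInterior hFP hw hi hy⟩
    refine ⟨i, hsub.antisymm fun y hy => ?_⟩
    have hdir : (affineSpan ℝ F).direction = (affineSpan ℝ (Q.facet i)).direction := by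
      refine Submodule.eq_of_le_of_finrank_eq
        (AffineSubspace.direction_le (affineSpan_mono ℝ hsub)) ?_
      rw [hrank, direction_facet, finrank_orthogonal_normal]
    have hyw : y - w ∈ (affineSpan ℝ F).direction := by
      rw [hdir]
      exact AffineSubspace.vsub_mem_direction (subset_affineSpan ℝ _ hy)
        (subset_affineSpan ℝ _ (hsub hwF))
    have hker : (affineSpan ℝ F).direction ≤ LinearMap.ker l.toLinearMap := by
      rw [direction_affineSpan, vectorSpan_def, Submodule.span_le]
      rintro _ ⟨a, ha, b, hb, rfl⟩
      rw [hl] at ha hb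
      have := le_antisymm (ha.2 b hb.1) (hb.2 a ha.1)
      simp [this]
    have h0 : l y = l w := by
      have := hker hyw
      simpa [sub_eq_zero] using this
    rw [hl] at hwF ⊢
    exact ⟨hy.1, fun x hx => h0 ▸ hwF.2 x hx⟩
  · push Not at htight
    exfalso
    have htop : (affineSpan ℝ F).direction = ⊤ := by
      rw [eq_top_iff]
      intro y _
      rw [hl] at hwF ⊢
      exact mem_direction_of_face hwF fun k hk => absurd hk (htight k)
    rw [htop, finrank_top] at hrank
    simp at hrank

lemma facet_injective (h : Q.facet i = Q.facet j) : i = j := by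
  by_contra hne
  have h1 : Q.center i ∈ Q.facet j := h ▸ center_mem_facet
  exact (slack_center_pos (Q := Q) (Ne.symm hne)).ne' h1.2

/-- The sum of the three normals exposes the common face, and independence of the normals gives it
codimension at least 3. -/
lemma isWarped_of_three [Finite ι] (hx : x ∈ Q.carrier) (hi : Q.slack i x = 0)
    (hj : Q.slack j x = 0) (hk : Q.slack k x = 0) (hij : i ≠ j) (hik : i ≠ k) (hjk : j ≠ k) :
    IsWarped Q.carrier x := by
  have key : ∀ y, inner ℝ (Q.normal i + Q.normal j + Q.normal k) y =
      Q.bound i + Q.bound j + Q.bound k - (Q.slack i y + Q.slack j y + Q.slack k y) := fun y => by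
    simp only [slack, inner_add_left]
    ring
  let G : Set (Ambient d) :=
    {y | y ∈ Q.carrier ∧ Q.slack i y = 0 ∧ Q.slack j y = 0 ∧ Q.slack k y = 0}
  have hexp : IsExposed ℝ Q.carrier G := by
    refine isExposed_of_forall_slack (Q.normal i + Q.normal j + Q.normal k)
      ⟨Q.bound i + Q.bound j + Q.bound k, fun y hy => ?_, x, hx, ?_, ?_⟩
    · rw [key]
      linarith [hy i, hy j, hy k]
    · rw [key, hi, hj, hk]
      ring
    · ext y
      simp only [G, mem_ofPred_eq, key]
      refine and_congr_right fun hy => ?_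
      have a := hy i
      have b := hy j
      have c := hy k
      constructor
      · rintro ⟨h1, h2, h3⟩
        rw [h1, h2, h3]
        ring
      · intro h
        refine ⟨?_, ?_, ?_⟩ <;> linarith
  have hli : LinearIndependent ℝ ![Q.normal i, Q.normal j, Q.normal k] := by
    rw [Fintype.linearIndependent_iff]
    intro g hg
    simp only [Fin.sum_univ_three, Matrix.cons_val_zero, Matrix.cons_val_one,
      Matrix.cons_val_two] at hg
    obtain ⟨h0, h1, h2⟩ := normal_independent_three hi hj hk hij hik hjk hg
    intro m
    fin_cases m
    · exact h0
    · exact h1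
    · exact h2
  have h3 := finrank_span_eq_card hli
  have hle : (affineSpan ℝ G).direction ≤
      (Submodule.span ℝ (range ![Q.normal i, Q.normal j, Q.normal k]))ᗮ := by
    refine direction_le_orthogonal ?_
    rintro _ ⟨m, rfl⟩ a ha b hb
    fin_cases m
    · simp [inner_sub_eq, ha.2.1, hb.2.1]
    · simp [inner_sub_eq, ha.2.2.1, hb.2.2.1]
    · simp [inner_sub_eq, ha.2.2.2, hb.2.2.2]
  have h4 := Submodule.finrank_mono hle
  have h5 := finrank_orthogonal_add
    (Submodule.span ℝ (range ![Q.normal i, Q.normal j, Q.normal k]))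
  simp only [Fintype.card_fin] at h3
  exact ⟨G, _, by omega, ⟨⟨x, hx, hi, hj, hk⟩, hexp, rfl⟩, hx, hi, hj, hk⟩

lemma regular_of_not_isWarped [Finite ι] (hx : x ∈ Q.carrier) (h : ¬ IsWarped Q.carrier x) :
    Q.Regular x := by
  intro i j k hi hj hk
  by_contra! hne
  exact h (isWarped_of_three hx hi hj hk hne.1 hne.2.1 hne.2.2)

lemma Regular.exists_cover (h : Q.Regular x) :
    ∃ u₁ u₂ : Ambient d, ∀ k, Q.slack k x = 0 → Q.normal k = u₁ ∨ Q.normal k = u₂ := by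
  by_cases h1 : ∃ i, Q.slack i x = 0
  · obtain ⟨i, hi⟩ := h1
    by_cases h2 : ∃ j, Q.slack j x = 0 ∧ j ≠ i
    · obtain ⟨j, hj, hji⟩ := h2
      refine ⟨Q.normal i, Q.normal j, fun k hk => ?_⟩
      rcases h i j k hi hj hk with e | e | e
      · exact absurd e.symm hji
      · exact Or.inl (e ▸ rfl)
      · exact Or.inr (e ▸ rfl)
    · push Not at h2
      exact ⟨Q.normal i, 0, fun k hk => Or.inl (h2 k hk ▸ rfl)⟩
  · push Not at h1
    exact ⟨0, 0, fun k hk => absurd hk (h1 k)⟩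

/-- A face through `x` contains in its direction everything orthogonal to the at most two tight
normals, so its dimension is at least `d - 1`. -/
lemma Regular.not_isWarped [Finite ι] (h : Q.Regular x) : ¬ IsWarped Q.carrier x := by
  rintro ⟨G, k, hk, hG, hxG⟩
  obtain ⟨l, hl⟩ := hG.exists_functional
  obtain ⟨u₁, u₂, hu⟩ := h.exists_cover
  classical
  have hle : (Submodule.span ℝ {u₁, u₂})ᗮ ≤ (affineSpan ℝ G).direction := by
    intro y hy
    rw [mem_orthogonal_span_iff] at hy
    rw [hl] at hxG ⊢
    refine mem_direction_of_face hxG fun k hk => ?_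
    rcases hu k hk with e | e
    · rw [e]
      exact hy _ (by simp)
    · rw [e]
      exact hy _ (by simp)
  have h1 := Submodule.finrank_mono hle
  have h2 := finrank_orthogonal_add (Submodule.span ℝ {u₁, u₂})
  have h3 : Module.finrank ℝ (Submodule.span ℝ ({u₁, u₂} : Set (Ambient d))) ≤ 2 := by
    have := finrank_span_finset_le_card (R := ℝ) ({u₁, u₂} : Finset (Ambient d))
    simp only [Finset.coe_pair] at this
    exact this.trans Finset.card_le_two
  have h4 := hG.2.2
  omega

lemma finrank_span_pair (hi : Q.slack i x = 0) (hj : Q.slack j x = 0) (hij : i ≠ j) :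
    Module.finrank ℝ (Submodule.span ℝ {Q.normal i, Q.normal j}) = 2 := by
  have hli : LinearIndependent ℝ ![Q.normal i, Q.normal j] := by
    rw [Fintype.linearIndependent_iff]
    intro g hg
    simp only [Fin.sum_univ_two, Matrix.cons_val_zero, Matrix.cons_val_one] at hg
    obtain ⟨h0, h1⟩ := normal_independent_two hi hj hij hg
    intro m
    fin_cases m
    · exact h0
    · exact h1
  have h3 := finrank_span_eq_card hli
  rw [Matrix.range_cons_cons_empty] at h3
  simpa using h3

lemma direction_inter_facet [Finite ι] (hx : x ∈ Q.carrier) (hi : Q.slack i x = 0)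
    (hj : Q.slack j x = 0) (hij : i ≠ j) (hreg : Q.Regular x) :
    (affineSpan ℝ (Q.facet i ∩ Q.facet j)).direction =
      (Submodule.span ℝ {Q.normal i, Q.normal j})ᗮ := by
  apply le_antisymm
  · refine direction_le_orthogonal ?_
    rintro n (rfl | rfl) a ha b hb
    · rw [inner_sub_eq, ha.1.2, hb.1.2, sub_zero]
    · rw [inner_sub_eq, ha.2.2, hb.2.2, sub_zero]
  · intro y hy
    rw [mem_orthogonal_span_iff] at hy
    have hxm : x ∈ Q.facet i ∩ Q.facet j := ⟨⟨hx, hi⟩, ⟨hx, hj⟩⟩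
    obtain ⟨l, hl⟩ := isExposed_inter_facet (Q := Q) ⟨hx, hi⟩ ⟨hx, hj⟩ ⟨x, hxm⟩
    rw [hl] at hxm ⊢
    refine mem_direction_of_face hxm fun k hk => ?_
    rcases hreg i j k hi hj hk with e | e | e
    · exact absurd e hij
    · exact hy _ (by simp [e])
    · exact hy _ (by simp [e])

lemma isRidge_inter_facet [Finite ι] (hx : x ∈ Q.carrier) (hi : Q.slack i x = 0)
    (hj : Q.slack j x = 0) (hij : i ≠ j) (hreg : Q.Regular x) :
    IsRidge Q.carrier (Q.facet i ∩ Q.facet j) := by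
  have h2 := finrank_orthogonal_add (Submodule.span ℝ {Q.normal i, Q.normal j})
  rw [finrank_span_pair hi hj hij] at h2
  refine ⟨Module.finrank ℝ (Submodule.span ℝ {Q.normal i, Q.normal j})ᗮ, by omega,
    ⟨x, ⟨hx, hi⟩, ⟨hx, hj⟩⟩, isExposed_inter_facet ⟨hx, hi⟩ ⟨hx, hj⟩, ?_⟩
  rw [direction_inter_facet hx hi hj hij hreg]

lemma ne_of_isRidge [Finite ι] (h : IsRidge Q.carrier (Q.facet i ∩ Q.facet j)) : i ≠ j := by
  rintro rfl
  obtain ⟨k, hk, -, -, h⟩ := h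
  rw [inter_self, direction_facet, finrank_orthogonal_normal] at h
  omega

end Presentation

/-- A face through a relatively interior point of `G` contains `G`, so its dimension is too large
for a warped point. -/
lemma not_isWarped_of_mem_intrinsicInterior {d : ℕ} {P G : Set (Ambient d)} {x : Ambient d}
    {k : ℕ} (hG : IsFace P G k) (hk : d ≤ k + 1) (hx : x ∈ intrinsicInterior ℝ G) :
    ¬ IsWarped P x := by
  rintro ⟨K, m, hm, hK, hxK⟩
  obtain ⟨l, hl⟩ := hK.exists_functional
  obtain ⟨l', hl'⟩ := hG.exists_functional
  have hGP : G ⊆ P := hl' ▸ sep_subset _ _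
  have hxK' := hxK
  rw [hl] at hxK'
  have hsub : G ⊆ K := by
    intro y hy
    have := eq_of_isMaxOn_of_mem_intrinsicInterior hx (fun y hy => hxK'.2 y (hGP hy)) hy
    rw [hl]
    exact ⟨hGP hy, fun z hz => this ▸ hxK'.2 z hz⟩
  have h1 := finrank_direction_mono hsub
  rw [hG.2.2, hK.2.2] at h1
  omega

/-! ### Reflections and folding maps -/

namespace Presentation

variable {d : ℕ} {ι : Type} (Q : Presentation d ι)

/-- The reflection that carries the `i`-th hyperplane to the `j`-th one and fixes their
intersection; it unfolds the `j`-th facet around the common ridge to the outside of the `i`-th. -/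
noncomputable def refl (i j : ι) (x : Ambient d) : Ambient d :=
  x + (2 * (Q.slack i x + Q.slack j x) / ‖Q.normal i + Q.normal j‖ ^ 2) •
    (Q.normal i + Q.normal j)

variable {Q} {i j k : ι} {x y z : Ambient d}

lemma refl_comm : Q.refl i j x = Q.refl j i x := by
  simp only [refl, add_comm]

/-- `refl i j` is the reflection in the hyperplane where the two slacks add up to zero; it exchanges
them up to sign. -/
lemma slack_refl (hu : Q.normal i + Q.normal j ≠ 0) :
    Q.slack j (Q.refl i j x) = -Q.slack i x := by
  have h1 : ‖Q.normal i + Q.normal j‖ ^ 2 =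
      2 + 2 * inner ℝ (Q.normal j) (Q.normal i) := by
    rw [norm_add_sq_real, Q.norm_normal, Q.norm_normal, real_inner_comm]
    ring
  have h2 : ‖Q.normal i + Q.normal j‖ ^ 2 ≠ 0 := by
    have := norm_pos_iff.2 hu
    positivity
  rw [refl, slack_add, inner_smul_right, inner_add_right, real_inner_self_eq_norm_sq,
    Q.norm_normal]
  rw [h1] at h2 ⊢
  have h3 : 1 + inner ℝ (Q.normal j) (Q.normal i) ≠ (0 : ℝ) := fun h => h2 (by linarith)
  field_simp
  ring

lemma slack_refl' (hu : Q.normal i + Q.normal j ≠ 0) :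
    Q.slack i (Q.refl i j x) = -Q.slack j x := by
  rw [refl_comm, slack_refl (by rwa [add_comm])]

lemma refl_refl : Q.refl i j (Q.refl i j x) = x := by
  by_cases hu : Q.normal i + Q.normal j = 0
  · simp [refl, hu]
  · have h : Q.slack i (Q.refl i j x) + Q.slack j (Q.refl i j x) =
        -(Q.slack i x + Q.slack j x) := by
      rw [slack_refl hu, slack_refl' hu]
      ring
    conv_lhs => rw [refl, h]
    rw [refl, add_assoc, ← add_smul]
    have : 2 * (Q.slack i x + Q.slack j x) / ‖Q.normal i + Q.normal j‖ ^ 2 +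
        2 * -(Q.slack i x + Q.slack j x) / ‖Q.normal i + Q.normal j‖ ^ 2 = 0 := by ring
    rw [this, zero_smul, add_zero]

lemma refl_of_tight (hi : Q.slack i x = 0) (hj : Q.slack j x = 0) : Q.refl i j x = x := by
  simp [refl, hi, hj]

lemma dist_refl : dist (Q.refl i j x) (Q.refl i j y) = dist x y := by
  by_cases hu : Q.normal i + Q.normal j = 0
  · simp [refl, hu]
  · have hpos := norm_pos_iff.2 hu
    set u := Q.normal i + Q.normal j with hu_def
    set c := 2 * inner ℝ (x - y) u / ‖u‖ ^ 2 with hc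
    have h1 : Q.refl i j x - Q.refl i j y = (x - y) - c • u := by
      have e : inner ℝ (x - y) u = (Q.slack i y + Q.slack j y) - (Q.slack i x + Q.slack j x) := by
        rw [real_inner_comm, hu_def, inner_add_left, inner_sub_eq, inner_sub_eq]
        ring
      rw [hc, e, refl, refl, ← hu_def]
      have : ∀ a b : ℝ, x + a • u - (y + b • u) = (x - y) - (b - a) • u := fun a b => by
        rw [sub_smul]
        abel
      rw [this]
      congr 2
      ring
    rw [dist_eq_norm, dist_eq_norm, h1]
    rw [← sq_eq_sq₀ (norm_nonneg _) (norm_nonneg _), norm_sub_sq_real, inner_smul_right,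
      norm_smul, mul_pow, Real.norm_eq_abs, sq_abs, hc]
    field_simp
    ring

/-- `refl` as an affine isometry. -/
noncomputable def reflEquiv (Q : Presentation d ι) (i j : ι) : Ambient d ≃ᵃⁱ[ℝ] Ambient d :=
  IsometryEquiv.toRealAffineIsometryEquiv
    { toFun := Q.refl i j
      invFun := Q.refl i j
      left_inv := fun _ => refl_refl
      right_inv := fun _ => refl_refl
      isometry_toFun := Isometry.of_dist_eq fun _ _ => dist_refl }

@[simp] lemma reflEquiv_apply : Q.reflEquiv i j x = Q.refl i j x := rfl

lemma refl_injective : Function.Injective (Q.refl i j) :=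
  (Q.reflEquiv i j).injective

lemma wbtw_refl_iff : Wbtw ℝ (Q.refl i j x) (Q.refl i j y) (Q.refl i j z) ↔ Wbtw ℝ x y z := by
  rw [← dist_add_dist_eq_iff, ← dist_add_dist_eq_iff, dist_refl, dist_refl, dist_refl]

lemma continuous_refl : Continuous (Q.refl i j) := (Q.reflEquiv i j).continuous

lemma normal_add_ne_zero (hi : Q.slack i z = 0) (hj : Q.slack j z = 0) (hij : i ≠ j) :
    Q.normal i + Q.normal j ≠ 0 := fun h =>
  one_ne_zero (normal_independent_two hi hj hij
    (by simpa using h : (1 : ℝ) • Q.normal i + (1 : ℝ) • Q.normal j = 0)).1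

lemma isFoldingMap_reflEquiv [Finite ι] (hz : z ∈ Q.carrier) (hi : Q.slack i z = 0)
    (hj : Q.slack j z = 0) (hij : i ≠ j) (hreg : Q.Regular z) :
    IsFoldingMap Q.carrier (Q.facet i) (Q.facet j) (Q.reflEquiv i j) where
  ridge := isRidge_inter_facet hz hi hj hij hreg
  image_span := by
    have hu := normal_add_ne_zero hi hj hij
    ext y
    constructor
    · rintro ⟨x, hx, rfl⟩
      rw [SetLike.mem_coe, mem_affineSpan_facet] at hx ⊢
      rw [reflEquiv_apply, slack_refl hu, hx, neg_zero]
    · intro hy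
      rw [SetLike.mem_coe, mem_affineSpan_facet] at hy
      refine ⟨Q.refl i j y, ?_, refl_refl⟩
      rw [SetLike.mem_coe, mem_affineSpan_facet, slack_refl' hu, hy, neg_zero]
  fixes := fun x hx => refl_of_tight hx.1.2 hx.2.2
  opposite := by
    have hu := normal_add_ne_zero hi hj hij
    rw [Set.disjoint_left]
    rintro _ ⟨y, hy, rfl⟩ hint
    -- The reflected facet lies where the `i`-th slack is nonpositive, so a common point has `i`
    -- tight. Tightness at a relatively interior point spreads to the whole `j`-th facet, its center
    -- included, which is absurd.
    have h1 : Q.slack i (Q.refl i j y) = 0 := by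
      refine le_antisymm ?_ ((intrinsicInterior_subset hint).1 i)
      rw [slack_refl' hu]
      linarith [hy.1 j]
    have := slack_eq_zero_of_mem_intrinsicInterior (fun _ h => h.1) hint h1
      (center_mem_facet (Q := Q) (i := j))
    exact (slack_center_pos hij).ne' this

lemma mem_intrinsicInterior_facet [Finite ι] (hx : Q.slack i x = 0)
    (h : ∀ k, k ≠ i → 0 < Q.slack k x) : x ∈ intrinsicInterior ℝ (Q.facet i) := by
  rw [mem_intrinsicInterior]
  refine ⟨⟨x, mem_affineSpan_facet.2 hx⟩, ?_, rfl⟩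
  rw [mem_interior_iff_mem_nhds]
  have := continuous_subtype_val.continuousAt (x := (⟨x, mem_affineSpan_facet.2 hx⟩ :
    affineSpan ℝ (Q.facet i))) |>.eventually (slack_eventually_pos (Q := Q) x)
  filter_upwards [this] with y hy
  have hyi := mem_affineSpan_facet.1 y.2
  refine ⟨fun k => ?_, hyi⟩
  by_cases hk : k = i
  · subst hk
    exact hyi.ge
  · exact (hy k (h k hk)).le

/-- A folding map is determined on the span of its first facet. -/
lemma foldingMap_eq_refl [Finite ι] {Φ : Ambient d ≃ᵃⁱ[ℝ] Ambient d}
    (hΦ : IsFoldingMap Q.carrier (Q.facet i) (Q.facet j) Φ) (hz : z ∈ Q.carrier)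
    (hi : Q.slack i z = 0) (hj : Q.slack j z = 0) (hreg : Q.Regular z)
    (hy : Q.slack i y = 0) : Φ y = Q.refl i j y := by
  have hij := ne_of_isRidge hΦ.ridge
  have hu := normal_add_ne_zero hi hj hij
  have hdir := direction_inter_facet hz hi hj hij hreg
  -- It suffices that `Ψ` is the identity on the span of the `i`-th facet. It already fixes the
  -- ridge.
  let Ψ : Ambient d ≃ᵃⁱ[ℝ] Ambient d := Φ.trans (Q.reflEquiv i j)
  let L := Ψ.linearIsometryEquiv
  have hzm : z ∈ Q.facet i ∩ Q.facet j := ⟨⟨hz, hi⟩, ⟨hz, hj⟩⟩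
  have hΨ : ∀ w, Ψ w = Q.refl i j (Φ w) := fun _ => rfl
  have hΨfix : ∀ w ∈ Q.facet i ∩ Q.facet j, Ψ w = w := fun w hw => by
    rw [hΨ, hΦ.fixes w hw, refl_of_tight hw.1.2 hw.2.2]
  have hΨz : Ψ z = z := hΨfix z hzm
  have hΨL : ∀ w, Ψ w = z + L (w - z) := fun w => by
    have := Ψ.map_vsub w z
    rw [vsub_eq_sub, vsub_eq_sub, hΨz] at this
    rw [show L (w - z) = Ψ w - z from this]
    abel
  have hLfix : ∀ w, w ∈ (Submodule.span ℝ {Q.normal i, Q.normal j})ᗮ → L w = w := by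
    intro w hw
    rw [← hdir, direction_affineSpan, vectorSpan_def] at hw
    induction hw using Submodule.span_induction with
    | mem w hw =>
      obtain ⟨a, ha, b, hb, rfl⟩ := hw
      have := Ψ.map_vsub a b
      rw [hΨfix a ha, hΨfix b hb] at this
      exact this
    | zero => simp
    | add a b _ _ ha hb => rw [map_add, ha, hb]
    | smul a b _ hb => rw [map_smul, hb]
  have hLdir : ∀ w, inner ℝ (Q.normal i) w = 0 → inner ℝ (Q.normal i) (L w) = 0 := by
    intro w hw
    have h1 : Q.slack i (z + w) = 0 := by rw [slack_add, hi, hw, sub_zero]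
    have h2 : Φ (z + w) ∈ (affineSpan ℝ (Q.facet j) : Set (Ambient d)) := by
      rw [← hΦ.image_span]
      exact mem_image_of_mem _ (mem_affineSpan_facet.2 h1)
    rw [SetLike.mem_coe, mem_affineSpan_facet] at h2
    have h3 : Q.slack i (Ψ (z + w)) = 0 := by rw [hΨ, slack_refl' hu, h2, neg_zero]
    rw [hΨL, slack_add, hi, add_sub_cancel_left] at h3
    linarith
  set c := inner ℝ (Q.normal i) (Q.normal j) with hc
  -- Within the direction of the `i`-th facet, `m` spans the orthogonal complement of the direction
  -- of the ridge; hence the linear part of `Ψ` sends `m` to `m` or `-m`.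
  set m := Q.normal j - c • Q.normal i with hm
  have hni : inner ℝ (Q.normal i) (Q.normal i) = (1 : ℝ) := by
    rw [real_inner_self_eq_norm_sq, Q.norm_normal, one_pow]
  have hnj : inner ℝ (Q.normal j) (Q.normal j) = (1 : ℝ) := by
    rw [real_inner_self_eq_norm_sq, Q.norm_normal, one_pow]
  have him : inner ℝ (Q.normal i) m = 0 := by
    rw [hm, inner_sub_right, inner_smul_right, hni]
    ring
  have hjm : inner ℝ (Q.normal j) m = ‖m‖ ^ 2 := by
    rw [← real_inner_self_eq_norm_sq]
    conv_rhs => rw [hm, inner_sub_left, real_inner_smul_left, ← hm, him]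
    ring
  have hm0 : m ≠ 0 := fun h => by
    have : (-c) • Q.normal i + (1 : ℝ) • Q.normal j = 0 := by
      rw [← h, hm]
      module
    exact one_ne_zero (normal_independent_two hi hj hij this).2
  have hmpos : 0 < ‖m‖ ^ 2 := by
    have := norm_pos_iff.2 hm0
    positivity
  have hdecomp : ∀ w, inner ℝ (Q.normal i) w = 0 →
      ∃ t : ℝ, w - t • m ∈ (Submodule.span ℝ {Q.normal i, Q.normal j})ᗮ := by
    intro w hw
    refine ⟨inner ℝ (Q.normal j) w / ‖m‖ ^ 2, ?_⟩
    rw [mem_orthogonal_span_iff]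
    rintro n (rfl | rfl)
    · rw [inner_sub_right, inner_smul_right, hw, him]
      ring
    · rw [inner_sub_right, inner_smul_right, hjm]
      field_simp
      ring
  have hortho : ∀ w ∈ (Submodule.span ℝ {Q.normal i, Q.normal j})ᗮ, inner ℝ w m = 0 := by
    intro w hw
    rw [mem_orthogonal_span_iff] at hw
    rw [real_inner_comm, hm, inner_sub_left, real_inner_smul_left, hw _ (by simp),
      hw _ (by simp)]
    ring
  have hLm : L m = m := by
    obtain ⟨t, ht⟩ := hdecomp (L m) (hLdir m him)
    have h1 : L m = t • m := by
      have h2 : inner ℝ (L m - t • m) (L m - t • m) = (0 : ℝ) := by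
        conv_lhs => rw [inner_sub_right, inner_smul_right, hortho _ ht]
        have := L.inner_map_map (L m - t • m) m
        rw [hLfix _ ht, hortho _ ht] at this
        rw [this]
        ring
      exact sub_eq_zero.1 (inner_self_eq_zero.1 h2)
    have h2 : |t| = 1 := by
      have := L.norm_map m
      rw [h1, norm_smul, Real.norm_eq_abs] at this
      have hm1 := norm_pos_iff.2 hm0
      exact mul_right_cancel₀ hm1.ne' (by rw [this, one_mul])
    rcases (abs_eq zero_le_one).1 h2 with rfl | rfl
    · rw [h1, one_smul]
    -- If `m` went to `-m`, then `Φ` would map the point `z - t • m` of the `i`-th facet into the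
    -- relative interior of the `j`-th one, against `opposite`.
    · exfalso
      have hother : ∀ k, k ≠ i → k ≠ j → 0 < Q.slack k z := by
        intro k hki hkj
        refine (hz k).lt_of_ne' fun hk => ?_
        rcases hreg i j k hi hj hk with e | e | e
        · exact hij e
        · exact hki e.symm
        · exact hkj e.symm
      have hc1 : Filter.Tendsto (fun t : ℝ => z - t • m) (nhds 0) (nhds z) := by
        have : Continuous (fun t : ℝ => z - t • m) := by fun_prop
        simpa using this.tendsto 0
      have hc2 : Filter.Tendsto (fun t : ℝ => Q.refl i j (z + t • m)) (nhds 0) (nhds z) := by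
        have : Continuous (fun t : ℝ => Q.refl i j (z + t • m)) :=
          continuous_refl.comp (by fun_prop)
        have := this.tendsto 0
        simpa [refl_of_tight hi hj] using this
      obtain ⟨t, ⟨ht1, ht2⟩, ht0⟩ :=
        ((((hc1.eventually (slack_eventually_pos (Q := Q) z)).and
        (hc2.eventually (slack_eventually_pos (Q := Q) z))).filter_mono
          nhdsWithin_le_nhds).and (self_mem_nhdsWithin (a := (0 : ℝ)) (s := Ioi 0))).exists
      have ht0 : 0 < t := ht0
      have e1 : Q.slack i (z - t • m) = 0 := by
        rw [sub_eq_add_neg, slack_add, inner_neg_right, inner_smul_right, him, hi]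
        ring
      have e2 : 0 < Q.slack j (z - t • m) := by
        rw [sub_eq_add_neg, slack_add, inner_neg_right, inner_smul_right, hjm, hj]
        have := mul_pos ht0 hmpos
        linarith
      have hmem : z - t • m ∈ Q.facet i := by
        refine ⟨fun k => ?_, e1⟩
        by_cases hki : k = i
        · exact hki ▸ e1.ge
        · by_cases hkj : k = j
          · exact hkj ▸ e2.le
          · exact (ht1 k (hother k hki hkj)).le
      have hΨv : Ψ (z - t • m) = z + t • m := by
        rw [hΨL, sub_sub_cancel_left, map_neg, map_smul, h1]
        module
      have hΦv : Φ (z - t • m) = Q.refl i j (z + t • m) := by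
        rw [← hΨv, hΨ, refl_refl]
      refine Set.disjoint_left.1 hΦ.opposite (mem_image_of_mem _ hmem) ?_
      rw [hΦv]
      refine mem_intrinsicInterior_facet ?_ fun k hkj => ?_
      · rw [slack_refl hu, slack_add, inner_smul_right, him, hi]
        ring
      · by_cases hki : k = i
        · subst hki
          rw [slack_refl' hu, slack_add, inner_smul_right, hjm, hj]
          have := mul_pos ht0 hmpos
          linarith
        · exact ht2 k (hother k hki hkj)
  have hyz : inner ℝ (Q.normal i) (y - z) = 0 := by rw [inner_sub_eq, hi, hy, sub_zero]
  obtain ⟨t, ht⟩ := hdecomp _ hyz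
  have h1 : L (y - z) = y - z := by
    have : L (y - z) = L (y - z - t • m) + t • L m := by
      rw [← map_smul, ← map_add]
      congr 1
      abel
    rw [this, hLfix _ ht, hLm]
    abel
  have h2 : Ψ y = y := by
    rw [hΨL, h1]
    abel
  rw [hΨ] at h2
  rw [← h2, refl_refl]
  exact congrArg _ (h2.symm ▸ rfl)

end Presentation

/-! ### Shortest paths parametrized by arc length -/

namespace Presentation

variable {d : ℕ} {ι : Type} (Q : Presentation d ι)

/-- The intrinsic distance on the boundary of the polyhedron. -/
noncomputable abbrev idist (x y : Ambient d) : ℝ≥0∞ := intrinsicDist (frontier Q.carrier) x y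

/-- `Γ` restricted to `[0, D]` is a shortest path in the boundary that starts at `v`,
parametrized by arc length. -/
structure Geo (v : Ambient d) (Γ : ℝ → Ambient d) (D : ℝ) : Prop where
  nonneg : 0 ≤ D
  zero : Γ 0 = v
  mem : ∀ r ∈ Icc 0 D, Γ r ∈ frontier Q.carrier
  -- Distances are taken from the later point to the earlier one, that is, toward `v`; symmetry of
  -- `idist` is not needed.
  le : ∀ r r', 0 ≤ r → r ≤ r' → r' ≤ D → Q.idist (Γ r') (Γ r) ≤ ENNReal.ofReal (r' - r)
  ge : ENNReal.ofReal D ≤ Q.idist (Γ D) v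

variable {Q} {i j k : ι} {v x y z p : Ambient d} {Γ : ℝ → Ambient d} {D : ℝ}

lemma idist_facet [Finite ι] (hx : x ∈ Q.facet i) (hy : y ∈ Q.facet i) :
    Q.idist x y = ENNReal.ofReal (dist x y) := by
  rw [← edist_dist]
  exact intrinsicDist_eq_edist (segment_subset_frontier hx hy)

namespace Geo

/-- Minimality is assumed only for the total length; a shorter middle piece would shorten the whole
by the triangle inequality. -/
lemma idist_eq (h : Q.Geo v Γ D) {r r' : ℝ} (h0 : 0 ≤ r) (hr : r ≤ r') (hD : r' ≤ D) :
    Q.idist (Γ r') (Γ r) = ENNReal.ofReal (r' - r) := by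
  refine le_antisymm (h.le r r' h0 hr hD) ?_
  by_contra! hlt
  have h1 := h.le r' D (h0.trans hr) hD le_rfl
  have h2 := h.le 0 r le_rfl h0 (hr.trans hD)
  rw [h.zero] at h2
  have h3 : Q.idist (Γ D) v ≤ Q.idist (Γ D) (Γ r') + (Q.idist (Γ r') (Γ r) + Q.idist (Γ r) v) :=
    intrinsicDist_triangle.trans (add_le_add le_rfl intrinsicDist_triangle)
  have h4 : Q.idist (Γ D) (Γ r') + (Q.idist (Γ r') (Γ r) + Q.idist (Γ r) v) <
      ENNReal.ofReal (D - r') + (ENNReal.ofReal (r' - r) + ENNReal.ofReal (r - 0)) := by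
    refine ENNReal.add_lt_add_of_le_of_lt (ne_top_of_le_ne_top ENNReal.ofReal_ne_top h1) h1 ?_
    exact ENNReal.add_lt_add_of_lt_of_le (ne_top_of_le_ne_top ENNReal.ofReal_ne_top h2) hlt h2
  rw [← ENNReal.ofReal_add (by linarith) (by linarith),
    ← ENNReal.ofReal_add (by linarith) (by linarith)] at h4
  have h5 : D - r' + (r' - r + (r - 0)) = D := by ring
  rw [h5] at h4
  exact (h.ge.trans h3).not_gt h4

lemma idist_start (h : Q.Geo v Γ D) {r : ℝ} (hr : r ∈ Icc 0 D) :
    Q.idist (Γ r) v = ENNReal.ofReal r := by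
  have := h.idist_eq le_rfl hr.1 hr.2
  rwa [h.zero, sub_zero] at this

lemma dist_le (h : Q.Geo v Γ D) {r r' : ℝ} (h0 : 0 ≤ r) (hr : r ≤ r') (hD : r' ≤ D) :
    dist (Γ r') (Γ r) ≤ r' - r := by
  have h1 := edist_le_intrinsicDist.trans (h.le r r' h0 hr hD)
  rw [edist_dist] at h1
  exact (ENNReal.ofReal_le_ofReal_iff (by linarith)).1 h1

lemma lipschitzOnWith (h : Q.Geo v Γ D) : LipschitzOnWith 1 Γ (Icc 0 D) := by
  refine LipschitzOnWith.of_dist_le_mul fun r hr r' hr' => ?_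
  rw [NNReal.coe_one, one_mul, Real.dist_eq]
  rcases le_total r r' with h' | h'
  · rw [dist_comm, abs_sub_comm]
    exact (h.dist_le hr.1 h' hr'.2).trans (le_abs_self _)
  · exact (h.dist_le hr'.1 h' hr.2).trans (le_abs_self _)

lemma dist_facet [Finite ι] (h : Q.Geo v Γ D) {r r' : ℝ} (h0 : 0 ≤ r) (hr : r ≤ r')
    (hD : r' ≤ D) (hi : Γ r ∈ Q.facet i) (hi' : Γ r' ∈ Q.facet i) :
    dist (Γ r') (Γ r) = r' - r := by
  have h1 := h.idist_eq h0 hr hD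
  rw [idist_facet hi' hi] at h1
  exact (ENNReal.ofReal_eq_ofReal_iff dist_nonneg (by linarith)).1 h1

lemma wbtw [Finite ι] (h : Q.Geo v Γ D) {r s t : ℝ} (h0 : 0 ≤ r) (hr : r ≤ s) (hs : s ≤ t)
    (hD : t ≤ D) (hi : Γ r ∈ Q.facet i) (hi' : Γ t ∈ Q.facet i) :
    Wbtw ℝ (Γ t) (Γ s) (Γ r) := by
  rw [← dist_add_dist_eq_iff]
  refine le_antisymm ?_ (dist_triangle _ _ _)
  rw [h.dist_facet h0 (hr.trans hs) hD hi hi']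
  have := h.dist_le h0 hr (hs.trans hD)
  have := h.dist_le (h0.trans hr) hs hD
  linarith

/-- Between two visits to a facet the path follows the chord, so each facet is occupied during a
single time interval. -/
lemma mem_facet [Finite ι] (h : Q.Geo v Γ D) {r s t : ℝ} (h0 : 0 ≤ r) (hr : r ≤ s) (hs : s ≤ t)
    (hD : t ≤ D) (hi : Γ r ∈ Q.facet i) (hi' : Γ t ∈ Q.facet i) : Γ s ∈ Q.facet i :=
  segment_subset_facet hi' hi ((h.wbtw h0 hr hs hD hi hi').mem_segment)

lemma exists_facet [Finite ι] (h : Q.Geo v Γ D) {r : ℝ} (hr : r ∈ Icc 0 D) :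
    ∃ i, Γ r ∈ Q.facet i := mem_frontier_iff.1 (h.mem r hr)

lemma mem_carrier [Finite ι] (h : Q.Geo v Γ D) {r : ℝ} (hr : r ∈ Icc 0 D) :
    Γ r ∈ Q.carrier := (h.exists_facet hr).choose_spec.1

/-- Appending a segment inside a facet keeps the upper bounds on partial lengths, so only the lower
bound on the new total has to be supplied. The old path is kept verbatim up to `D`, which lets
`Good` be carried over. -/
lemma exists_extension [Finite ι] (h : Q.Geo v Γ D) (hi : Γ D ∈ Q.facet i) (hz : z ∈ Q.facet i)
    (hge : ENNReal.ofReal (D + dist z (Γ D)) ≤ Q.idist z v) :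
    ∃ Γ' : ℝ → Ambient d, Q.Geo v Γ' (D + dist z (Γ D)) ∧ Γ' (D + dist z (Γ D)) = z ∧
      ∀ r ≤ D, Γ' r = Γ r := by
  set ℓ := dist z (Γ D) with hℓ
  rcases (dist_nonneg : 0 ≤ dist z (Γ D)).eq_or_lt with h0 | h0
  · refine ⟨Γ, ?_, ?_, fun _ _ => rfl⟩
    · rw [hℓ, ← h0, add_zero]
      exact h
    · rw [hℓ, ← h0, add_zero]
      exact (dist_eq_zero.1 h0.symm).symm
  rw [← hℓ] at h0
  let e : ℝ → Ambient d := fun r => AffineMap.lineMap (Γ D) z ((r - D) / ℓ)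
  let Γ' : ℝ → Ambient d := fun r => if r ≤ D then Γ r else e r
  have hle : ∀ r ≤ D, Γ' r = Γ r := fun r hr => if_pos hr
  have heD : e D = Γ D := by simp [e]
  have hge' : ∀ r, D ≤ r → Γ' r = e r := by
    intro r hr
    rcases hr.eq_or_lt with rfl | hr
    · rw [hle _ le_rfl, heD]
    · exact if_neg hr.not_ge
  have hmem : ∀ r, D ≤ r → r ≤ D + ℓ → e r ∈ Q.facet i := by
    intro r h1 h2
    refine segment_subset_facet hi hz ?_
    rw [segment_eq_image_lineMap]
    refine mem_image_of_mem _ ⟨div_nonneg (by linarith) h0.le, ?_⟩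
    rw [div_le_one h0]
    linarith
  have hdist : ∀ r r', D ≤ r → r ≤ r' → r' ≤ D + ℓ →
      Q.idist (e r') (e r) ≤ ENNReal.ofReal (r' - r) := by
    intro r r' h1 h2 h3
    rw [idist_facet (hmem r' (h1.trans h2) h3) (hmem r h1 (h2.trans h3))]
    refine ENNReal.ofReal_le_ofReal ?_
    rw [dist_lineMap_lineMap, dist_comm (Γ D) z, ← hℓ, Real.dist_eq, ← sub_div, abs_div,
      abs_of_pos h0, div_mul_cancel₀ _ h0.ne']
    rw [abs_of_nonneg (by linarith)]
    linarith
  refine ⟨Γ', ⟨add_nonneg h.nonneg h0.le, ?_, ?_, ?_, ?_⟩, ?_, hle⟩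
  · rw [hle 0 h.nonneg, h.zero]
  · intro r hr
    rcases le_total r D with h1 | h1
    · rw [hle r h1]
      exact h.mem r ⟨hr.1, h1⟩
    · rw [hge' r h1]
      exact facet_subset_frontier (hmem r h1 hr.2)
  · intro r r' hr0 hrr hr'
    rcases le_total r' D with h1 | h1
    · rw [hle r' h1, hle r (hrr.trans h1)]
      exact h.le r r' hr0 hrr h1
    · rw [hge' r' h1]
      rcases le_total r D with h2 | h2
      · rw [hle r h2]
        calc Q.idist (e r') (Γ r) ≤ Q.idist (e r') (e D) + Q.idist (Γ D) (Γ r) := by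
              rw [heD]
              exact intrinsicDist_triangle
          _ ≤ ENNReal.ofReal (r' - D) + ENNReal.ofReal (D - r) :=
              add_le_add (hdist D r' le_rfl h1 hr') (h.le r D hr0 h2 le_rfl)
          _ = ENNReal.ofReal (r' - r) := by
              rw [← ENNReal.ofReal_add (by linarith) (by linarith)]
              congr 1
              ring
      · rw [hge' r h2]
        exact hdist r r' h2 hrr hr'
  · rw [hge' _ (by linarith)]
    have : e (D + ℓ) = z := by simp [e, h0.ne']
    rwa [this]
  · rw [hge' _ (by linarith)]
    simp [e, h0.ne']

lemma exists_path (h : Q.Geo v Γ D) : ∃ γ : Path (Γ D) v,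
    IsShortestPath (frontier Q.carrier) γ ∧ range γ = Γ '' Icc 0 D := by
  obtain ⟨γ, hγ, hlen⟩ := exists_path_pathLength_le h.nonneg h.lipschitzOnWith
  obtain rfl := h.zero
  have hsub : range γ ⊆ frontier Q.carrier := by
    rw [hγ]
    rintro _ ⟨r, hr, rfl⟩
    exact h.mem r hr
  exact ⟨γ, ⟨hsub, ne_top_of_le_ne_top ENNReal.ofReal_ne_top hlen,
    le_antisymm (hlen.trans h.ge) (intrinsicDist_le_pathLength hsub)⟩, hγ⟩

end Geo

section OfPath

variable {γ : Path x v}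

/-- Subpaths of shortest paths are shortest: the lengths of the two outer pieces are finite and
cancel from the triangle inequality. -/
lemma eVariationOn_eq_idist (hγ : IsShortestPath (frontier Q.carrier) γ) {s t : ℝ} (h0 : 0 ≤ s)
    (hst : s ≤ t) (h1 : t ≤ 1) :
    eVariationOn γ.extend (Icc s t) = Q.idist (γ.extend s) (γ.extend t) := by
  have hmem : ∀ u, γ.extend u ∈ frontier Q.carrier := fun u =>
    hγ.1 (γ.extend_range ▸ mem_range_self u)
  have hle : ∀ {a b : ℝ}, a ≤ b →
      Q.idist (γ.extend a) (γ.extend b) ≤ eVariationOn γ.extend (Icc a b) := fun hab =>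
    intrinsicDist_le_eVariationOn hab γ.continuous_extend.continuousOn fun u _ => hmem u
  refine le_antisymm ?_ (hle hst)
  have e1 := eVariationOn.Icc_add_Icc γ.extend (s := univ) h0 (hst.trans h1) (mem_univ _)
  have e2 := eVariationOn.Icc_add_Icc γ.extend (s := univ) hst h1 (mem_univ _)
  simp only [univ_inter] at e1 e2
  have hL := hγ.2.2
  have hfin := hγ.2.1
  rw [pathLength_eq_extend, ← e1, ← e2] at hL hfin
  have f1 : eVariationOn γ.extend (Icc 0 s) ≠ ∞ := fun h => hfin (by simp [h])
  have f2 : eVariationOn γ.extend (Icc t 1) ≠ ∞ := fun h => hfin (by simp [h])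
  have htri : Q.idist x v ≤ eVariationOn γ.extend (Icc 0 s) +
      (Q.idist (γ.extend s) (γ.extend t) + eVariationOn γ.extend (Icc t 1)) := by
    have g1 := hle h0
    have g2 := hle h1
    rw [γ.extend_zero] at g1
    rw [γ.extend_one] at g2
    exact intrinsicDist_triangle.trans (add_le_add g1
      (intrinsicDist_triangle.trans (add_le_add le_rfl g2)))
  replace htri := hL.le.trans htri
  exact (ENNReal.add_le_add_iff_right f2).1 ((ENNReal.add_le_add_iff_left f1).1 htri)

/-- A shortest path, parametrized by the distance to its endpoint. -/
lemma exists_geo_of_path [Finite ι] (hγ : IsShortestPath (frontier Q.carrier) γ) :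
    ∃ (Γ : ℝ → Ambient d) (D : ℝ) (ρ : I → ℝ), Q.Geo v Γ D ∧ Γ D = x ∧
      range γ = Γ '' Icc 0 D ∧ Antitone ρ ∧ ρ 0 = D ∧ ρ 1 = 0 ∧ (∀ s, ρ s ∈ Icc 0 D) ∧
      (∀ s, γ s = Γ (ρ s)) ∧ ∀ r ∈ Icc 0 D, ∃ s, ρ s = r := by
  have hfin : eVariationOn γ.extend (Icc 0 1) ≠ ∞ := by
    have := hγ.2.1
    rwa [pathLength_eq_extend] at this
  have hfin' : ∀ {s t : ℝ}, 0 ≤ s → t ≤ 1 → eVariationOn γ.extend (Icc s t) ≠ ∞ := fun hs ht =>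
    ne_top_of_le_ne_top hfin (eVariationOn.mono _ (Icc_subset_Icc hs ht))
  have hext : ∀ s : I, γ.extend s = γ s := fun s => by simp
  let ρ : I → ℝ := fun s => (eVariationOn γ.extend (Icc s 1)).toReal
  have hdiff : ∀ s t : I, s ≤ t → Q.idist (γ s) (γ t) = ENNReal.ofReal (ρ s - ρ t) := by
    intro s t hst
    have hst' : (s : ℝ) ≤ t := hst
    have e := eVariationOn.Icc_add_Icc γ.extend (s := univ) hst' t.2.2 (mem_univ _)
    simp only [univ_inter] at e
    have : ρ s - ρ t = (eVariationOn γ.extend (Icc (s : ℝ) t)).toReal := by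
      simp only [ρ]
      rw [← e, ENNReal.toReal_add (hfin' s.2.1 t.2.2) (hfin' t.2.1 le_rfl)]
      ring
    rw [this, ENNReal.ofReal_toReal (hfin' s.2.1 t.2.2), eVariationOn_eq_idist hγ s.2.1 hst' t.2.2,
      hext, hext]
  have hanti : Antitone ρ := by
    intro s t hst
    refine ENNReal.toReal_mono (hfin' s.2.1 le_rfl) (eVariationOn.mono _ ?_)
    exact Icc_subset_Icc_left hst
  have hρ1 : ρ 1 = 0 := by
    have : eVariationOn γ.extend (Icc ((1 : I) : ℝ) 1) = 0 := by
      apply eVariationOn.subsingleton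
      simp
    simp only [ρ, this, ENNReal.toReal_zero]
  have hmem : ∀ s, γ s ∈ frontier Q.carrier := fun s => hγ.1 (mem_range_self s)
  -- On each of the finitely many closed sets where `γ` lies in a given facet, `ρ` changes exactly
  -- as much as `γ` moves; continuity follows by gluing.
  have hcont : Continuous ρ := by
    refine LocallyFinite.continuous (f := fun i => {s | γ s ∈ Q.facet i})
      (locallyFinite_of_finite _) ?_ (fun i => isClosed_facet.preimage γ.continuous) fun i => ?_
    · ext s
      simpa using mem_frontier_iff.1 (hmem s)
    · have hd : ∀ s ∈ {s | γ s ∈ Q.facet i}, ∀ t ∈ {s | γ s ∈ Q.facet i},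
          dist (ρ s) (ρ t) = dist (γ s) (γ t) := by
        have hd' : ∀ s ∈ {s | γ s ∈ Q.facet i}, ∀ t ∈ {s | γ s ∈ Q.facet i}, s ≤ t →
            dist (ρ s) (ρ t) = dist (γ s) (γ t) := by
          intro s hs t ht hst
          have h1 := hdiff s t hst
          have h2 := sub_nonneg.2 (hanti hst)
          rw [idist_facet hs ht, ENNReal.ofReal_eq_ofReal_iff dist_nonneg h2] at h1
          rw [h1, Real.dist_eq, abs_of_nonneg h2]
        intro s hs t ht
        rcases le_total s t with h | h
        · exact hd' s hs t ht h
        · rw [dist_comm, hd' t ht s hs h, dist_comm]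
      intro s hs
      rw [ContinuousWithinAt, tendsto_iff_dist_tendsto_zero]
      have h1 : Filter.Tendsto (fun t => dist (γ t) (γ s))
          (nhdsWithin s {s | γ s ∈ Q.facet i}) (nhds 0) := by
        rw [← tendsto_iff_dist_tendsto_zero]
        exact γ.continuous.continuousWithinAt
      refine h1.congr' ?_
      filter_upwards [self_mem_nhdsWithin] with t ht
      exact (hd t ht s hs).symm
  have hnn : ∀ s, 0 ≤ ρ s := fun s => ENNReal.toReal_nonneg
  have hleD : ∀ s, ρ s ≤ ρ 0 := fun s => hanti s.2.1
  have hsurj : ∀ r ∈ Icc 0 (ρ 0), ∃ s, ρ s = r := by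
    intro r hr
    have := mem_range_of_exists_le_of_exists_ge hcont ⟨1, hρ1.trans_le hr.1⟩ ⟨0, hr.2⟩
    exact this
  have hex : ∀ r : ℝ, ∃ s : I, r ∈ Icc 0 (ρ 0) → ρ s = r := by
    intro r
    by_cases hr : r ∈ Icc 0 (ρ 0)
    · obtain ⟨s, hs⟩ := hsurj r hr
      exact ⟨s, fun _ => hs⟩
    · exact ⟨0, fun h => (hr h).elim⟩
  -- `γ` may pause, so `ρ` need not be injective and `g` is only a section of it. By `hinj` the
  -- choice does not affect `γ ∘ g`.
  choose g hg using hex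
  have hinj : ∀ s t, ρ s = ρ t → γ s = γ t := by
    have hinj' : ∀ s t, s ≤ t → ρ s = ρ t → γ s = γ t := by
      intro s t hst h
      have h1 := hdiff s t hst
      rw [h, sub_self, ENNReal.ofReal_zero] at h1
      have h2 : edist (γ s) (γ t) ≤ 0 := h1 ▸ edist_le_intrinsicDist
      exact edist_eq_zero.1 (le_antisymm h2 bot_le)
    intro s t h
    rcases le_total s t with h' | h'
    · exact hinj' s t h' h
    · exact (hinj' t s h' h.symm).symm
  have hγΓ : ∀ s, γ s = γ (g (ρ s)) := fun s =>
    hinj _ _ (hg (ρ s) ⟨hnn s, hleD s⟩).symm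
  have hΓ0 : γ (g 0) = v := by
    rw [hinj (g 0) 1 (by rw [hg 0 ⟨le_rfl, hnn 0⟩, hρ1])]
    exact γ.target
  have hΓD : γ (g (ρ 0)) = x := by
    rw [← hγΓ]
    exact γ.source
  refine ⟨fun r => γ (g r), ρ 0, ρ, ⟨hnn 0, hΓ0, fun r _ => hmem _, ?_, ?_⟩, hΓD, ?_, hanti, rfl,
    hρ1, fun s => ⟨hnn s, hleD s⟩, hγΓ, hsurj⟩
  · intro r r' h0 hr hD
    have e := hg r ⟨h0, hr.trans hD⟩
    have e' := hg r' ⟨h0.trans hr, hD⟩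
    rcases hr.eq_or_lt with rfl | hlt
    · have : Q.idist (γ (g r)) (γ (g r)) = ENNReal.ofReal (ρ (g r) - ρ (g r)) :=
        hdiff _ _ le_rfl
      rw [this]
      simp
    · have hle : g r' ≤ g r := by
        by_contra! hc
        have := hanti hc.le
        rw [e, e'] at this
        exact hlt.not_ge this
      rw [show Q.idist (γ (g r')) (γ (g r)) = _ from hdiff _ _ hle, e, e']
  · have := hdiff 0 1 (by exact zero_le_one)
    rw [hρ1, sub_zero, γ.source, γ.target] at this
    rw [hΓD]
    exact this.ge
  · ext y
    constructor
    · rintro ⟨s, rfl⟩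
      exact ⟨ρ s, ⟨hnn s, hleD s⟩, (hγΓ s).symm⟩
    · rintro ⟨r, -, rfl⟩
      exact mem_range_self _

end OfPath

/-! ### Existence of shortest paths -/

section Existence

variable (Q) in
/-- `z` is joined to `v` by a polygon of length at most `ℓ` with `k` edges, each in a facet. -/
def Conn (v : Ambient d) : ℕ → Ambient d → ℝ → Prop
  | 0, z, ℓ => z = v ∧ 0 ≤ ℓ
  | n + 1, z, ℓ => ∃ p, (∃ i, z ∈ Q.facet i ∧ p ∈ Q.facet i) ∧ Conn v n p (ℓ - dist z p)

lemma Conn.mono {n : ℕ} {ℓ ℓ' : ℝ} (h : Q.Conn v n z ℓ) (hℓ : ℓ ≤ ℓ') : Q.Conn v n z ℓ' := by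
  induction n generalizing z ℓ ℓ' with
  | zero => exact ⟨h.1, h.2.trans hℓ⟩
  | succ n ih =>
    obtain ⟨p, hp, h⟩ := h
    exact ⟨p, hp, ih h (by linarith)⟩

lemma Conn.nonneg {n : ℕ} {ℓ : ℝ} (h : Q.Conn v n z ℓ) : 0 ≤ ℓ := by
  induction n generalizing z ℓ with
  | zero => exact h.2
  | succ n ih =>
    obtain ⟨p, hp, h⟩ := h
    have := ih h
    linarith [dist_nonneg (x := z) (y := p)]

lemma Conn.succ {n : ℕ} {ℓ : ℝ} (hv : ∃ i, v ∈ Q.facet i) (h : Q.Conn v n z ℓ) :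
    Q.Conn v (n + 1) z ℓ := by
  have hz : ∃ i, z ∈ Q.facet i := by
    cases n with
    | zero => exact h.1 ▸ hv
    | succ n =>
      obtain ⟨p, ⟨i, hi, -⟩, -⟩ := h
      exact ⟨i, hi⟩
  obtain ⟨i, hi⟩ := hz
  exact ⟨z, ⟨i, hi, hi⟩, by simpa using h⟩

lemma Conn.of_le {m n : ℕ} (hmn : m ≤ n) {ℓ : ℝ} (hv : ∃ i, v ∈ Q.facet i)
    (h : Q.Conn v m z ℓ) : Q.Conn v n z ℓ := by
  induction hmn with
  | refl => exact h
  | step _ ih => exact ih.succ hv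

/-- The first edge has length at most `ℓ`, so the vertices `p` stay bounded along a convergent
sequence and a subsequence converges. This makes the infimum of polygon lengths attained. -/
lemma isClosed_conn [Finite ι] (v : Ambient d) (n : ℕ) :
    IsClosed {q : Ambient d × ℝ | Q.Conn v n q.1 q.2} := by
  induction n with
  | zero =>
    exact (isClosed_eq continuous_fst continuous_const).inter
      (isClosed_le continuous_const continuous_snd)
  | succ n ih =>
    apply IsSeqClosed.isClosed
    intro u q hu hq
    choose p hp hc using hu
    obtain ⟨M, hM⟩ := (Metric.isBounded_range_of_tendsto u hq).exists_norm_le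
    have hpM : ∀ m, p m ∈ Metric.closedBall (0 : Ambient d) (M + M) := by
      intro m
      have h1 := hM _ (mem_range_self m)
      have h2 := (hc m).nonneg
      have h3 := (norm_fst_le (u m)).trans h1
      have h4 := (norm_snd_le (u m)).trans h1
      rw [Real.norm_eq_abs] at h4
      have h5 := le_of_abs_le h4
      rw [mem_closedBall_zero_iff]
      have h6 : ‖p m‖ ≤ ‖(u m).1‖ + dist (u m).1 (p m) := by
        rw [dist_eq_norm, norm_sub_rev]
        have := norm_add_le (u m).1 (p m - (u m).1)
        rwa [add_sub_cancel] at this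
      linarith
    obtain ⟨p', -, φ, hφ, hlim⟩ := (isCompact_closedBall _ _).tendsto_subseq hpM
    have hq' := hq.comp hφ.tendsto_atTop
    refine ⟨p', ?_, ?_⟩
    · have hcl : IsClosed {w : Ambient d × Ambient d | ∃ i, w.1 ∈ Q.facet i ∧ w.2 ∈ Q.facet i} := by
        have : {w : Ambient d × Ambient d | ∃ i, w.1 ∈ Q.facet i ∧ w.2 ∈ Q.facet i} =
            ⋃ i, (Q.facet i) ×ˢ (Q.facet i) := by
          ext w
          simp
        rw [this]
        exact isClosed_iUnion_of_finite fun i => isClosed_facet.prod isClosed_facet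
      exact hcl.mem_of_tendsto
        (((continuous_fst.tendsto q).comp hq').prodMk_nhds hlim)
        (Filter.Eventually.of_forall fun m => hp (φ m))
    · have hl := hlim.prodMk_nhds (((continuous_snd.tendsto q).comp hq').sub
        (((continuous_fst.tendsto q).comp hq').dist hlim))
      exact ih.mem_of_tendsto hl (Filter.Eventually.of_forall fun m => hc (φ m))

lemma Conn.exists_geo [Finite ι] (hv : ∃ i, v ∈ Q.facet i) {n : ℕ} {ℓ : ℝ}
    (h : Q.Conn v n z ℓ) (hge : ENNReal.ofReal ℓ ≤ Q.idist z v) :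
    ∃ Γ D, Q.Geo v Γ D ∧ Γ D = z := by
  have key : ∀ n z ℓ, Q.Conn v n z ℓ → ENNReal.ofReal ℓ ≤ Q.idist z v →
      ∃ Γ, Q.Geo v Γ ℓ ∧ Γ ℓ = z := by
    intro n
    induction n with
    | zero =>
      rintro z ℓ ⟨rfl, h0⟩ hge
      obtain ⟨i, hi⟩ := hv
      have hzz : Q.idist z z = 0 := by
        rw [idist_facet hi hi]
        simp
      rw [hzz] at hge
      have hℓ : ℓ = 0 := le_antisymm (by simpa using hge) h0
      subst hℓ
      refine ⟨fun _ => z, ⟨le_rfl, rfl, fun _ _ => facet_subset_frontier hi, ?_, ?_⟩, rfl⟩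
      · intro r r' _ _ _
        rw [hzz]
        exact bot_le
      · simp
    | succ n ih =>
      rintro z ℓ ⟨p, ⟨i, hzi, hpi⟩, hc⟩ hge
      have hnn := hc.nonneg
      have hge' : ENNReal.ofReal (ℓ - dist z p) ≤ Q.idist p v := by
        have h1 : Q.idist z v ≤ ENNReal.ofReal (dist z p) + Q.idist p v := by
          rw [← idist_facet hzi hpi]
          exact intrinsicDist_triangle
        rw [ENNReal.ofReal_sub _ dist_nonneg]
        exact tsub_le_iff_left.2 (hge.trans h1)
      obtain ⟨Γ, hΓ, hΓp⟩ := ih p _ hc hge'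
      obtain ⟨Γ', h1, h2, -⟩ := hΓ.exists_extension (i := i) (by rwa [hΓp]) hzi
        (by rwa [hΓp, sub_add_cancel])
      rw [hΓp, sub_add_cancel] at h1 h2
      exact ⟨Γ', h1, h2⟩
  obtain ⟨Γ, h1, h2⟩ := key n z ℓ h hge
  exact ⟨Γ, ℓ, h1, h2⟩

/-- Greedy shortcut: the facet met just after time `s` also contains `γ s`; jump along a chord to
the last visit to that facet. It never recurs, so the number of edges is at most the number of
facets. -/
lemma conn_of_path [Fintype ι] {γ : Path z v} (hγ : range γ ⊆ frontier Q.carrier)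
    (hfin : pathLength γ ≠ ∞) :
    Q.Conn v (Fintype.card ι) z (pathLength γ).toReal := by
  classical
  have hmem : ∀ u, γ.extend u ∈ frontier Q.carrier := fun u =>
    hγ (γ.extend_range ▸ mem_range_self u)
  have hv : ∃ i, v ∈ Q.facet i := mem_frontier_iff.1 (γ.extend_one ▸ hmem 1)
  rw [pathLength_eq_extend] at hfin ⊢
  have hfin' : ∀ {s t : ℝ}, 0 ≤ s → t ≤ 1 → eVariationOn γ.extend (Icc s t) ≠ ∞ := fun hs ht =>
    ne_top_of_le_ne_top hfin (eVariationOn.mono _ (Icc_subset_Icc hs ht))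
  have key : ∀ (n : ℕ) (s : ℝ), 0 ≤ s → s ≤ 1 →
      (Finset.univ.filter fun i => ∃ s' ∈ Ioc s 1, γ.extend s' ∈ Q.facet i).card ≤ n →
      Q.Conn v n (γ.extend s) (eVariationOn γ.extend (Icc s 1)).toReal := by
    intro n
    induction n with
    | zero =>
      intro s h0 h1 hcard
      rcases h1.eq_or_lt with rfl | h1
      · exact ⟨γ.extend_one, ENNReal.toReal_nonneg⟩
      · obtain ⟨i, hi⟩ := mem_frontier_iff.1 (hmem 1)
        rw [Nat.le_zero, Finset.card_eq_zero] at hcard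
        have : i ∈ (∅ : Finset ι) := by
          rw [← hcard]
          simp only [Finset.mem_filter, Finset.mem_univ, true_and]
          exact ⟨1, ⟨h1, le_rfl⟩, hi⟩
        simp at this
    | succ n ih =>
      intro s h0 h1 hcard
      rcases h1.eq_or_lt with rfl | h1
      · exact Conn.of_le (Nat.zero_le _) hv ⟨γ.extend_one, ENNReal.toReal_nonneg⟩
      · have hsP : γ.extend s ∈ Q.carrier := (mem_frontier_iff.1 (hmem s)).choose_spec.1
        have hev := (γ.continuous_extend.continuousAt (x := s)).eventually
          (tight_eventually_subset (Q := Q) hsP)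
        obtain ⟨s', hs', hss', hs'1⟩ := ((hev.filter_mono nhdsWithin_le_nhds).and
          (Ioc_mem_nhdsGT h1)).exists
        obtain ⟨i, hi⟩ := mem_frontier_iff.1 (hmem s')
        have hsi : γ.extend s ∈ Q.facet i := ⟨hsP, hs' i hi.2⟩
        have hcomp : IsCompact (Icc s' 1 ∩ γ.extend ⁻¹' Q.facet i) :=
          isCompact_Icc.inter_right (isClosed_facet.preimage γ.continuous_extend)
        obtain ⟨t, ⟨⟨ht1, ht2⟩, hti⟩, hmax⟩ := hcomp.exists_isGreatest
          ⟨s', ⟨le_rfl, hs'1⟩, hi⟩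
        have hst : s < t := hss'.trans_le ht1
        have hlt : (Finset.univ.filter fun i => ∃ s' ∈ Ioc t 1, γ.extend s' ∈ Q.facet i).card <
            (Finset.univ.filter fun i => ∃ s' ∈ Ioc s 1, γ.extend s' ∈ Q.facet i).card := by
          apply Finset.card_lt_card
          rw [Finset.ssubset_iff_of_subset]
          · refine ⟨i, ?_, ?_⟩
            · simp only [Finset.mem_filter, Finset.mem_univ, true_and]
              exact ⟨t, ⟨hst, ht2⟩, hti⟩
            · simp only [Finset.mem_filter, Finset.mem_univ, true_and]
              rintro ⟨u, hu, hui⟩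
              exact hu.1.not_ge (hmax ⟨⟨ht1.trans hu.1.le, hu.2⟩, hui⟩)
          · intro j
            simp only [Finset.mem_filter, Finset.mem_univ, true_and]
            rintro ⟨u, hu, huj⟩
            exact ⟨u, ⟨hst.trans hu.1, hu.2⟩, huj⟩
        have hc := ih t (h0.trans hst.le) ht2 (by omega)
        refine ⟨γ.extend t, ⟨i, hsi, hti⟩, hc.mono ?_⟩
        have e := eVariationOn.Icc_add_Icc γ.extend (s := univ) hst.le ht2 (mem_univ _)
        simp only [univ_inter] at e
        rw [← e, ENNReal.toReal_add (hfin' h0 ht2) (hfin' (h0.trans hst.le) le_rfl)]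
        have h2 := eVariationOn.edist_le γ.extend (left_mem_Icc.2 hst.le) (right_mem_Icc.2 hst.le)
        rw [edist_dist] at h2
        have := (ENNReal.ofReal_le_iff_le_toReal (hfin' h0 ht2)).1 h2
        linarith
  have := key (Fintype.card ι) 0 le_rfl zero_le_one (Finset.card_le_univ _)
  rwa [γ.extend_zero] at this

/-- Points at finite intrinsic distance are joined by a shortest path. -/
lemma exists_geo [Fintype ι] (hv : ∃ i, v ∈ Q.facet i) (hz : Q.idist z v ≠ ∞) :
    ∃ Γ D, Q.Geo v Γ D ∧ Γ D = z := by
  set A : Set ℝ := {ℓ | Q.Conn v (Fintype.card ι) z ℓ} with hA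
  have hcl : IsClosed A :=
    (isClosed_conn (Q := Q) v (Fintype.card ι)).preimage (Continuous.prodMk_right z)
  have hbdd : BddBelow A := ⟨0, fun ℓ h => Conn.nonneg h⟩
  have hpath : ∃ γ : Path z v, range γ ⊆ frontier Q.carrier ∧ pathLength γ ≠ ∞ := by
    by_contra! hne
    refine hz ?_
    rw [idist, intrinsicDist]
    simp only [iInf_eq_top]
    exact hne
  have hne : A.Nonempty := by
    obtain ⟨γ, h1, h2⟩ := hpath
    exact ⟨_, conn_of_path h1 h2⟩
  have hmem : sInf A ∈ A := hcl.csInf_mem hne hbdd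
  refine Conn.exists_geo hv hmem ?_
  refine le_iInf₂ fun γ hγ => ?_
  by_cases hfin : pathLength γ = ∞
  · rw [hfin]
    exact le_top
  · rw [ENNReal.ofReal_le_iff_le_toReal hfin]
    exact csInf_le hbdd (conn_of_path hγ hfin)

end Existence

end Presentation

/-! ### Nearest-point projection and first-order length estimates -/

section Projection

variable {E : Type*} [NormedAddCommGroup E] [InnerProductSpace ℝ E]

/-- The first-order expansion of the norm with an explicit quadratic error, from `2ab ≤ a² + b²`. -/
lemma norm_sub_smul_le {u w : E} (hu : u ≠ 0) (ε : ℝ) :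
    ‖u - ε • w‖ ≤ ‖u‖ + ε * (-(inner ℝ u w / ‖u‖)) + ε ^ 2 * (‖w‖ ^ 2 / (2 * ‖u‖)) := by
  have hpos := norm_pos_iff.2 hu
  have h1 : ‖u - ε • w‖ ^ 2 = ‖u‖ ^ 2 - 2 * (ε * inner ℝ u w) + ε ^ 2 * ‖w‖ ^ 2 := by
    rw [norm_sub_sq_real, inner_smul_right, norm_smul, mul_pow, Real.norm_eq_abs, sq_abs]
  have h2 : 2 * ‖u - ε • w‖ * ‖u‖ ≤ ‖u - ε • w‖ ^ 2 + ‖u‖ ^ 2 := two_mul_le_add_sq _ _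
  have h3 : ‖u‖ + ε * (-(inner ℝ u w / ‖u‖)) + ε ^ 2 * (‖w‖ ^ 2 / (2 * ‖u‖)) =
      (‖u - ε • w‖ ^ 2 + ‖u‖ ^ 2) / (2 * ‖u‖) := by
    rw [h1]
    field_simp
    ring
  rw [h3, le_div_iff₀ (by positivity)]
  linarith

/-- The nearest-point map. Were the nearest point of some `x ∉ K` interior to `K`, a small step from
it toward `x` would stay in `K` and come closer to `x`. -/
lemma exists_projection [CompleteSpace E] {K : Set E} (hne : K.Nonempty) (hcl : IsClosed K)
    (hK : Convex ℝ K) :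
    ∃ π : E → E, LipschitzWith 1 π ∧ (∀ x ∈ K, π x = x) ∧
      ∀ x, x ∉ interior K → π x ∈ frontier K := by
  have hex : ∀ x, ∃ p ∈ K, ∀ w ∈ K, inner ℝ (x - p) (w - p) ≤ 0 := fun x => by
    obtain ⟨p, hp, hmin⟩ := exists_norm_eq_iInf_of_complete_convex hne hcl.isComplete hK x
    exact ⟨p, hp, (norm_eq_iInf_iff_real_inner_le_zero hK hp).1 hmin⟩
  choose π hπ hin using hex
  have hfix : ∀ x ∈ K, π x = x := fun x hx => by
    have := hin x x hx
    rw [real_inner_self_eq_norm_sq] at this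
    have h0 : ‖x - π x‖ = 0 := by nlinarith [norm_nonneg (x - π x)]
    exact (sub_eq_zero.1 (norm_eq_zero.1 h0)).symm
  refine ⟨π, LipschitzWith.of_dist_le_mul fun x y => ?_, hfix, fun x hx => ?_⟩
  · rw [NNReal.coe_one, one_mul, dist_eq_norm, dist_eq_norm]
    have h1 := hin x (π y) (hπ y)
    have h2 := hin y (π x) (hπ x)
    have h3 : ‖π x - π y‖ ^ 2 ≤ inner ℝ (x - y) (π x - π y) := by
      rw [← real_inner_self_eq_norm_sq]
      have e : inner ℝ (π x - π y) (π x - π y) = inner ℝ (x - y) (π x - π y) +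
          inner ℝ (x - π x) (π y - π x) + inner ℝ (y - π y) (π x - π y) := by
        simp only [inner_sub_left, inner_sub_right]
        ring
      linarith
    have h4 := real_inner_le_norm (x - y) (π x - π y)
    rcases (norm_nonneg (π x - π y)).eq_or_lt with h | h
    · rw [← h]
      positivity
    · nlinarith
  · rw [hcl.frontier_eq]
    refine ⟨hπ x, fun hint => ?_⟩
    by_cases hxK : x ∈ K
    · exact hx (hfix x hxK ▸ hint)
    · have hc : Filter.Tendsto (fun t : ℝ => π x + t • (x - π x)) (nhds 0) (nhds (π x)) := by
        have : Continuous (fun t : ℝ => π x + t • (x - π x)) := by fun_prop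
        simpa using this.tendsto 0
      have := (hc.eventually (mem_interior_iff_mem_nhds.1 hint)).filter_mono
        (nhdsWithin_le_nhds (s := Ioi 0))
      obtain ⟨t, ht, ht0⟩ := (this.and self_mem_nhdsWithin).exists
      have ht0 : 0 < t := ht0
      have h1 := hin x _ ht
      rw [add_sub_cancel_left, inner_smul_right, real_inner_self_eq_norm_sq] at h1
      have h2 : ‖x - π x‖ ^ 2 ≤ 0 := by
        by_contra! h
        nlinarith
      have h0 : ‖x - π x‖ = 0 := by nlinarith [norm_nonneg (x - π x)]
      exact hxK (sub_eq_zero.1 (norm_eq_zero.1 h0) ▸ hπ x)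

lemma dist_add_smul_sub (z a b : E) {t : ℝ} (ht : 0 ≤ t) :
    dist (z + t • (a - z)) (z + t • (b - z)) = t * dist a b := by
  rw [dist_add_left, dist_smul₀, dist_sub_right, Real.norm_eq_abs, abs_of_nonneg ht]

lemma dist_self_add_smul_sub (z a : E) {t : ℝ} (ht : t ≤ 1) :
    dist a (z + t • (a - z)) = (1 - t) * dist a z := by
  have : a - (z + t • (a - z)) = (1 - t) • (a - z) := by module
  rw [dist_eq_norm, this, norm_smul, Real.norm_eq_abs, abs_of_nonneg (by linarith), dist_eq_norm]

end Projection

/-! ### Shortest paths at warped points and across ridges -/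

namespace Presentation

variable {d : ℕ} {ι : Type} {Q : Presentation d ι} {i j k : ι} {v x y z a b p q : Ambient d}
  {Γ : ℝ → Ambient d} {D : ℝ}

lemma notMem_interior [Finite ι] (h : Q.slack i x ≤ 0) : x ∉ interior Q.carrier := by
  intro hx
  have h0 : Q.slack i x = 0 := le_antisymm h (interior_subset hx i)
  have := facet_subset_frontier (Q := Q) ⟨interior_subset hx, h0⟩
  exact this.2 hx

lemma notMem_interior_of_segment [Finite ι] (hx : Q.slack i x = 0) (hy : Q.slack i y = 0) :
    ∀ w ∈ segment ℝ x y, w ∉ interior Q.carrier := by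
  rintro _ ⟨s, t, -, -, hst, rfl⟩
  refine notMem_interior (i := i) ?_
  rw [slack_combo hst, hx, hy]
  simp

/-- A polygon outside the interior of the polyhedron is no shorter than the boundary distance. -/
lemma idist_le_of_outside [Finite ι] (ha : a ∈ Q.carrier) (hb : b ∈ Q.carrier)
    (h1 : ∀ x ∈ segment ℝ a p, x ∉ interior Q.carrier)
    (h2 : ∀ x ∈ segment ℝ p q, x ∉ interior Q.carrier)
    (h3 : ∀ x ∈ segment ℝ q b, x ∉ interior Q.carrier) :
    Q.idist a b ≤ ENNReal.ofReal (dist a p + dist p q + dist q b) := by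
  obtain ⟨π, hπ, hfix, hfr⟩ := exists_projection ⟨a, ha⟩ isClosed_carrier convex_carrier
  have e1 := intrinsicDist_le_edist_of_lipschitz hπ fun x hx => hfr x (h1 x hx)
  have e2 := intrinsicDist_le_edist_of_lipschitz hπ fun x hx => hfr x (h2 x hx)
  have e3 := intrinsicDist_le_edist_of_lipschitz hπ fun x hx => hfr x (h3 x hx)
  rw [hfix a ha] at e1
  rw [hfix b hb] at e3
  rw [ENNReal.ofReal_add (by positivity) dist_nonneg, ENNReal.ofReal_add dist_nonneg dist_nonneg,
    ← edist_dist, ← edist_dist, ← edist_dist]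
  exact intrinsicDist_triangle.trans
    (add_le_add (intrinsicDist_triangle.trans (add_le_add e1 e2)) e3)

lemma slack_eq_zero_of_wbtw (ha : a ∈ Q.carrier) (hb : b ∈ Q.carrier) (h : Wbtw ℝ a z b)
    (hza : z ≠ a) (hz : Q.slack i z = 0) : Q.slack i b = 0 := by
  obtain ⟨t, ht, rfl⟩ := h
  rw [slack_lineMap] at hz
  have ht0 : 0 < t := ht.1.lt_of_ne' fun h => hza (by simp [h])
  have h1 := mul_nonneg (sub_nonneg.2 ht.2) (ha i)
  have h2 := hb i
  nlinarith

/-- The third normal is not in the span of the other two, so one can move along the `i`-th and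
`j`-th hyperplanes while changing the `k`-th slack. -/
lemma exists_inner_eq_one (hi : Q.slack i z = 0) (hj : Q.slack j z = 0) (hk : Q.slack k z = 0)
    (hki : k ≠ i) (hkj : k ≠ j) :
    ∃ e, inner ℝ (Q.normal i) e = (0 : ℝ) ∧ inner ℝ (Q.normal j) e = (0 : ℝ) ∧
      inner ℝ (Q.normal k) e = (1 : ℝ) := by
  have hex : ∃ e ∈ (Submodule.span ℝ {Q.normal i, Q.normal j})ᗮ,
      inner ℝ (Q.normal k) e ≠ (0 : ℝ) := by
    by_contra! hne
    have hmem : Q.normal k ∈ (Submodule.span ℝ {Q.normal i, Q.normal j})ᗮᗮ := by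
      rw [Submodule.mem_orthogonal]
      intro u hu
      rw [real_inner_comm]
      exact hne u hu
    rw [Submodule.orthogonal_orthogonal, Submodule.mem_span_pair] at hmem
    obtain ⟨s, t, hst⟩ := hmem
    by_cases hij : i = j
    · subst hij
      have : (s + t) • Q.normal i + (-1 : ℝ) • Q.normal k = 0 := by
        rw [← hst]
        module
      have := (normal_independent_two hi hk hki.symm this).2
      norm_num at this
    · have : s • Q.normal i + t • Q.normal j + (-1 : ℝ) • Q.normal k = 0 := by
        rw [← hst]
        module
      have := (normal_independent_three hi hj hk hij hki.symm hkj.symm this).2.2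
      norm_num at this
  obtain ⟨e, he, hne⟩ := hex
  rw [mem_orthogonal_span_iff] at he
  refine ⟨(inner ℝ (Q.normal k) e)⁻¹ • e, ?_, ?_, ?_⟩
  · rw [inner_smul_right, he (Q.normal i) (by simp), mul_zero]
  · rw [inner_smul_right, he (Q.normal j) (by simp), mul_zero]
  · rw [inner_smul_right, inv_mul_cancel₀ hne]

/-- A polygon that bends at a warped point can be shortened. -/
lemma idist_lt_of_three [Finite ι] (hi : Q.slack i z = 0) (hj : Q.slack j z = 0)
    (hk : Q.slack k z = 0) (hki : k ≠ i) (hkj : k ≠ j) (ha : a ∈ Q.facet i) (hb : b ∈ Q.facet j)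
    (haz : a ≠ z) (hbz : b ≠ z) (hw : ¬ Wbtw ℝ a z b) :
    Q.idist a b < ENNReal.ofReal (dist a z + dist z b) := by
  have hlt : dist a b < dist a z + dist z b := by
    refine (dist_triangle a z b).lt_of_ne fun h => hw (dist_add_dist_eq_iff.1 h.symm)
  have hpos : 0 < dist a z + dist z b := dist_nonneg.trans_lt hlt
  by_cases hja : Q.slack j a = 0
  · rw [idist_facet (i := j) ⟨ha.1, hja⟩ hb]
    exact (ENNReal.ofReal_lt_ofReal_iff hpos).2 hlt
  by_cases hib : Q.slack i b = 0
  · rw [idist_facet (i := i) ha ⟨hb.1, hib⟩]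
    exact (ENNReal.ofReal_lt_ofReal_iff hpos).2 hlt
  obtain ⟨e, hie, hje, hke⟩ := exists_inner_eq_one hi hj hk hki hkj
  set A := a - z with hA
  set B := b - z with hB
  have hA0 : A ≠ 0 := sub_ne_zero.2 haz
  have hB0 : B ≠ 0 := sub_ne_zero.2 hbz
  have hApos := norm_pos_iff.2 hA0
  have hBpos := norm_pos_iff.2 hB0
  have hdA : dist a z = ‖A‖ := dist_eq_norm _ _
  have hdB : dist z b = ‖B‖ := by rw [dist_comm, dist_eq_norm]
  have hsmall : ∀ {s M : ℝ}, s < 0 → 0 ≤ M → ∃ ε > 0, ε * s + ε ^ 2 * M < 0 := by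
    intro s M hs hM
    refine ⟨-s / (M + 1), by apply div_pos <;> linarith, ?_⟩
    have h1 : 0 < -s / (M + 1) := by apply div_pos <;> linarith
    have h2 : -s / (M + 1) * (M + 1) = -s := by field_simp
    nlinarith
  have hiA : inner ℝ (Q.normal i) A = 0 := by rw [hA, inner_sub_eq, hi, ha.2, sub_zero]
  have hjB : inner ℝ (Q.normal j) B = 0 := by rw [hB, inner_sub_eq, hj, hb.2, sub_zero]
  have hdist : ∀ (c : Ambient d) (ε : ℝ) (w : Ambient d), dist c (z + ε • w) = ‖c - z - ε • w‖ :=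
    fun c ε w => by rw [dist_eq_norm, sub_sub]
  -- The tested quantity is the first-order gain from moving the bend along `e`. If it is negative,
  -- moving the bend along `-e`, inside the two hyperplanes, shortens the polygon.
  rcases lt_or_ge (inner ℝ A e / ‖A‖ + inner ℝ B e / ‖B‖) 0 with hκ | hκ
  · obtain ⟨ε, hε, hlt⟩ := hsmall hκ
      (by positivity : 0 ≤ ‖e‖ ^ 2 / (2 * ‖A‖) + ‖e‖ ^ 2 / (2 * ‖B‖))
    have hpi : Q.slack i (z + ε • -e) = 0 := by
      rw [slack_add, hi, inner_smul_right, inner_neg_right, hie]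
      ring
    have hpj : Q.slack j (z + ε • -e) = 0 := by
      rw [slack_add, hj, inner_smul_right, inner_neg_right, hje]
      ring
    refine (idist_le_of_outside ha.1 hb.1 (notMem_interior_of_segment ha.2 hpi)
      (notMem_interior_of_segment hpi hpi) (notMem_interior_of_segment hpj hb.2)).trans_lt ?_
    refine (ENNReal.ofReal_lt_ofReal_iff hpos).2 ?_
    rw [dist_self, dist_comm _ b, hdist, hdist, hdA, hdB, ← hA, ← hB]
    have n1 := norm_sub_smul_le (w := -e) hA0 ε
    have n2 := norm_sub_smul_le (w := -e) hB0 ε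
    rw [inner_neg_right, norm_neg, neg_div, neg_neg] at n1 n2
    linarith
  · have hα : 0 < Q.slack i a + Q.slack j a + Q.slack k a := by
      have := (ha.1 j).lt_of_ne' hja
      linarith [ha.1 i, ha.1 k]
    have hβ : 0 < Q.slack i b + Q.slack j b + Q.slack k b := by
      have := (hb.1 i).lt_of_ne' hib
      linarith [hb.1 j, hb.1 k]
    set α := Q.slack i a + Q.slack j a + Q.slack k a with hαdef
    set β := Q.slack i b + Q.slack j b + Q.slack k b with hβdef
    -- Otherwise the corner is cut off. With this scaling, `z + ε • X` and `z + ε • Y` lie on the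
    -- `i`-th and `j`-th hyperplanes and also on the supporting hyperplane where the slacks `i`,
    -- `j`, `k` add up to zero, so the new edge avoids the interior. Since the path bends at `z`,
    -- `‖X - Y‖` is strictly below `‖A‖ / α + ‖B‖ / β`, and the first-order change of length is
    -- negative.
    set X := e + α⁻¹ • A with hX
    set Y := e + β⁻¹ • B with hY
    have hXY : ‖X - Y‖ < ‖A‖ / α + ‖B‖ / β := by
      have e1 : X - Y = α⁻¹ • A - β⁻¹ • B := by
        rw [hX, hY]
        abel
      have n1 : ‖α⁻¹ • A‖ = ‖A‖ / α := by
        rw [norm_smul, Real.norm_eq_abs, abs_of_pos (inv_pos.2 hα)]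
        ring
      have n2 : ‖β⁻¹ • B‖ = ‖B‖ / β := by
        rw [norm_smul, Real.norm_eq_abs, abs_of_pos (inv_pos.2 hβ)]
        ring
      rw [e1, ← n1, ← n2]
      refine (norm_sub_le _ _).lt_of_ne fun h => hw ?_
      have h' : ‖α⁻¹ • A + -(β⁻¹ • B)‖ = ‖α⁻¹ • A‖ + ‖-(β⁻¹ • B)‖ := by
        rw [norm_neg, ← sub_eq_add_neg, h]
      rw [← sameRay_iff_norm_add] at h'
      have h2 : SameRay ℝ A (-B) := by
        rw [← smul_neg] at h'
        have h3 := (h'.pos_smul_left hα).pos_smul_right hβ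
        rwa [smul_inv_smul₀ hα.ne', smul_inv_smul₀ hβ.ne'] at h3
      have h3 : SameRay ℝ (z - a) (b - z) := by
        rw [← sameRay_neg_iff, neg_sub]
        exact h2
      exact wbtw_iff_sameRay_vsub.2 h3
    have hs : -(inner ℝ A X / ‖A‖) + -(inner ℝ B Y / ‖B‖) + ‖X - Y‖ < 0 := by
      have e1 : inner ℝ A X / ‖A‖ = inner ℝ A e / ‖A‖ + ‖A‖ / α := by
        rw [hX, inner_add_right, inner_smul_right, real_inner_self_eq_norm_sq]
        field_simp
      have e2 : inner ℝ B Y / ‖B‖ = inner ℝ B e / ‖B‖ + ‖B‖ / β := by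
        rw [hY, inner_add_right, inner_smul_right, real_inner_self_eq_norm_sq]
        field_simp
      linarith
    obtain ⟨ε, hε, hlt⟩ := hsmall hs
      (by positivity : 0 ≤ ‖X‖ ^ 2 / (2 * ‖A‖) + ‖Y‖ ^ 2 / (2 * ‖B‖))
    have hpi : Q.slack i (z + ε • X) = 0 := by
      rw [slack_add, hi, inner_smul_right, hX, inner_add_right, inner_smul_right, hie, hiA]
      ring
    have hqj : Q.slack j (z + ε • Y) = 0 := by
      rw [slack_add, hj, inner_smul_right, hY, inner_add_right, inner_smul_right, hje, hjB]
      ring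
    have hsum : ∀ w, Q.slack i (z + w) + Q.slack j (z + w) + Q.slack k (z + w) =
        -(inner ℝ (Q.normal i) w + inner ℝ (Q.normal j) w + inner ℝ (Q.normal k) w) := fun w => by
      rw [slack_add, slack_add, slack_add, hi, hj, hk]
      ring
    have hsumA : inner ℝ (Q.normal i) A + inner ℝ (Q.normal j) A + inner ℝ (Q.normal k) A = -α := by
      rw [hA, inner_sub_eq, inner_sub_eq, inner_sub_eq, hi, hj, hk, hαdef]
      ring
    have hsumB : inner ℝ (Q.normal i) B + inner ℝ (Q.normal j) B + inner ℝ (Q.normal k) B = -β := by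
      rw [hB, inner_sub_eq, inner_sub_eq, inner_sub_eq, hi, hj, hk, hβdef]
      ring
    have hp : Q.slack i (z + ε • X) + Q.slack j (z + ε • X) + Q.slack k (z + ε • X) = 0 := by
      rw [hsum]
      simp only [hX, inner_smul_right, inner_add_right, hie, hje, hke]
      have : α⁻¹ * inner ℝ (Q.normal i) A + α⁻¹ * inner ℝ (Q.normal j) A +
          α⁻¹ * inner ℝ (Q.normal k) A = -1 := by
        rw [← mul_add, ← mul_add, hsumA]
        field_simp
      linear_combination (-ε) * this
    have hq : Q.slack i (z + ε • Y) + Q.slack j (z + ε • Y) + Q.slack k (z + ε • Y) = 0 := by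
      rw [hsum]
      simp only [hY, inner_smul_right, inner_add_right, hie, hje, hke]
      have : β⁻¹ * inner ℝ (Q.normal i) B + β⁻¹ * inner ℝ (Q.normal j) B +
          β⁻¹ * inner ℝ (Q.normal k) B = -1 := by
        rw [← mul_add, ← mul_add, hsumB]
        field_simp
      linear_combination (-ε) * this
    have hmid : ∀ w ∈ segment ℝ (z + ε • X) (z + ε • Y), w ∉ interior Q.carrier := by
      rintro _ ⟨s, t, -, -, hst, rfl⟩ hint
      have hw0 : Q.slack i (s • (z + ε • X) + t • (z + ε • Y)) +
          Q.slack j (s • (z + ε • X) + t • (z + ε • Y)) +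
          Q.slack k (s • (z + ε • X) + t • (z + ε • Y)) = 0 := by
        rw [slack_combo hst, slack_combo hst, slack_combo hst]
        linear_combination s * hp + t * hq
      have c := interior_subset hint
      refine notMem_interior (i := i) ?_ hint
      linarith [c i, c j, c k]
    refine (idist_le_of_outside ha.1 hb.1 (notMem_interior_of_segment ha.2 hpi)
      hmid (notMem_interior_of_segment hqj hb.2)).trans_lt ?_
    refine (ENNReal.ofReal_lt_ofReal_iff hpos).2 ?_
    have hpq : dist (z + ε • X) (z + ε • Y) = ε * ‖X - Y‖ := by
      rw [dist_add_left, dist_smul₀, dist_eq_norm, Real.norm_eq_abs, abs_of_pos hε]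
    rw [hpq, dist_comm _ b, hdist, hdist, hdA, hdB, ← hA, ← hB]
    have n1 := norm_sub_smul_le (w := X) hA0 ε
    have n2 := norm_sub_smul_le (w := Y) hB0 ε
    linarith

lemma regular_eventually [Finite ι] (hz : z ∈ Q.carrier) (hreg : Q.Regular z) :
    ∀ᶠ y in nhds z, Q.Regular y := by
  filter_upwards [tight_eventually_subset hz] with y hy i j k hi hj hk
  exact hreg i j k (hy i hi) (hy j hj) (hy k hk)

namespace Geo

lemma tendsto [Finite ι] (h : Q.Geo v Γ D) {r : ℝ} (hr : r ∈ Icc 0 D) :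
    Filter.Tendsto Γ (nhdsWithin r (Icc 0 D)) (nhds (Γ r)) :=
  h.lipschitzOnWith.continuousOn r hr

lemma exists_facet_before [Finite ι] (h : Q.Geo v Γ D) {r : ℝ} (h0 : 0 < r) (hr : r ≤ D) :
    ∃ i, ∃ s ∈ Ico 0 r, Γ s ∈ Q.facet i ∧ Γ r ∈ Q.facet i := by
  have hrm : r ∈ Icc 0 D := ⟨h0.le, hr⟩
  have hev := (h.tendsto hrm).eventually (tight_eventually_subset (h.mem_carrier hrm))
  have hle : nhdsWithin r (Ico 0 r) ≤ nhdsWithin r (Icc 0 D) :=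
    nhdsWithin_mono _ fun s hs => ⟨hs.1, hs.2.le.trans hr⟩
  have hne : (nhdsWithin r (Ico 0 r)).NeBot := by
    rw [nhdsWithin_Ico_eq_nhdsLT h0]
    infer_instance
  obtain ⟨s, hs, hsr⟩ := ((hev.filter_mono hle).and self_mem_nhdsWithin).exists
  obtain ⟨i, hi⟩ := h.exists_facet ⟨hsr.1, hsr.2.le.trans hr⟩
  exact ⟨i, s, hsr, hi, h.mem_carrier hrm, hs i hi.2⟩

lemma exists_facet_after [Finite ι] (h : Q.Geo v Γ D) {r : ℝ} (h0 : 0 ≤ r) (hr : r < D) :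
    ∃ i, ∃ s ∈ Ioc r D, Γ s ∈ Q.facet i ∧ Γ r ∈ Q.facet i := by
  have hrm : r ∈ Icc 0 D := ⟨h0, hr.le⟩
  have hev := (h.tendsto hrm).eventually (tight_eventually_subset (h.mem_carrier hrm))
  have hle : nhdsWithin r (Ioc r D) ≤ nhdsWithin r (Icc 0 D) :=
    nhdsWithin_mono _ fun s hs => ⟨h0.trans hs.1.le, hs.2⟩
  have hne : (nhdsWithin r (Ioc r D)).NeBot := by
    rw [nhdsWithin_Ioc_eq_nhdsGT hr]
    infer_instance
  obtain ⟨s, hs, hsr⟩ := ((hev.filter_mono hle).and self_mem_nhdsWithin).exists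
  obtain ⟨i, hi⟩ := h.exists_facet ⟨h0.trans hsr.1.le, hsr.2⟩
  exact ⟨i, s, hsr, hi, h.mem_carrier hrm, hs i hi.2⟩

/-- A shortest path between regular points avoids the warped points. -/
lemma regular [Finite ι] (h : Q.Geo v Γ D) (hv : Q.Regular v) (hD : Q.Regular (Γ D)) :
    ∀ r ∈ Icc 0 D, Q.Regular (Γ r) := by
  by_contra! hne
  obtain ⟨r₁, hr₁, hnr⟩ := hne
  set B : Set ℝ := {r | r ∈ Icc 0 D ∧ ¬ Q.Regular (Γ r)} with hB
  have hclosed : IsClosed B := by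
    apply IsSeqClosed.isClosed
    intro u r hu hur
    have hr : r ∈ Icc 0 D := isClosed_Icc.mem_of_tendsto hur
      (Filter.Eventually.of_forall fun n => (hu n).1)
    refine ⟨hr, fun hreg => ?_⟩
    have h1 := (h.tendsto hr).eventually (regular_eventually (h.mem_carrier hr) hreg)
    have h2 : Filter.Tendsto u Filter.atTop (nhdsWithin r (Icc 0 D)) :=
      tendsto_nhdsWithin_iff.2 ⟨hur, Filter.Eventually.of_forall fun n => (hu n).1⟩
    obtain ⟨n, hn⟩ := (h2.eventually h1).exists
    exact (hu n).2 hn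
  have hcomp : IsCompact B := isCompact_Icc.of_isClosed_subset hclosed fun r hr => hr.1
  -- The earliest irregular time: the path arrives there through a facet `j` and leaves through a
  -- facet `i`, and some third facet `k` contains the point.
  obtain ⟨r, ⟨hr, hrn⟩, hmin⟩ := hcomp.exists_isLeast ⟨r₁, hr₁, hnr⟩
  have hr0 : 0 < r := hr.1.lt_of_ne fun e => hrn (by rw [← e, h.zero]; exact hv)
  have hrD : r < D := hr.2.lt_of_ne fun e => hrn (e ▸ hD)
  obtain ⟨j, s, hs, hsj, hrj⟩ := h.exists_facet_before hr0 hr.2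
  obtain ⟨i, t, ht, hti, hri⟩ := h.exists_facet_after hr.1 hrD
  have hk : ∃ k, Q.slack k (Γ r) = 0 ∧ k ≠ i ∧ k ≠ j := by
    by_contra! hc
    refine hrn fun k l m hk hl hm => ?_
    have h1 := hc k hk
    have h2 := hc l hl
    have h3 := hc m hm
    by_cases e1 : k = i
    · by_cases e2 : l = i
      · exact Or.inl (e1.trans e2.symm)
      · by_cases e3 : m = i
        · exact Or.inr (Or.inl (e1.trans e3.symm))
        · exact Or.inr (Or.inr ((h2 e2).trans (h3 e3).symm))
    · by_cases e2 : l = i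
      · by_cases e3 : m = i
        · exact Or.inr (Or.inr (e2.trans e3.symm))
        · exact Or.inr (Or.inl ((h1 e1).trans (h3 e3).symm))
      · exact Or.inl ((h1 e1).trans (h2 e2).symm)
  obtain ⟨k, hk, hki, hkj⟩ := hk
  have d1 := h.dist_facet hs.1 hs.2.le hr.2 hsj hrj
  have d2 := h.dist_facet hr.1 ht.1.le ht.2 hri hti
  have hsr : Γ s ≠ Γ r := fun e => by
    rw [e, dist_self] at d1
    linarith [hs.2]
  have htr : Γ t ≠ Γ r := fun e => by
    rw [e, dist_self] at d2
    linarith [ht.1]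
  -- If the path went straight through `Γ r`, the inequalities tight there would be tight at `Γ s`
  -- too, giving an earlier irregular time.
  have hw : ¬ Wbtw ℝ (Γ t) (Γ r) (Γ s) := by
    intro hw
    have hsB : s ∈ B := by
      refine ⟨⟨hs.1, hs.2.le.trans hr.2⟩, fun hreg => hrn fun k l m hk hl hm => ?_⟩
      exact hreg k l m (slack_eq_zero_of_wbtw hti.1 hsj.1 hw htr.symm hk)
        (slack_eq_zero_of_wbtw hti.1 hsj.1 hw htr.symm hl)
        (slack_eq_zero_of_wbtw hti.1 hsj.1 hw htr.symm hm)
    exact (hmin hsB).not_gt hs.2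
  have hlt := idist_lt_of_three hri.2 hrj.2 hk hki hkj hti hsj htr hsr hw
  rw [h.idist_eq hs.1 (hs.2.le.trans ht.1.le) ht.2, d1, d2] at hlt
  refine hlt.ne ?_
  congr 1
  ring

/-- Across a ridge, a shortest path is straight in the unfolding. -/
lemma wbtw_refl [Finite ι] (h : Q.Geo v Γ D) {r s t : ℝ} (h0 : 0 ≤ r) (hrs : r ≤ s)
    (hst : s ≤ t) (hD : t ≤ D) (hreg : Q.Regular (Γ s)) (hij : i ≠ j) (hi : Γ s ∈ Q.facet i)
    (hj : Γ s ∈ Q.facet j) (ht : Γ t ∈ Q.facet i) (hr : Γ r ∈ Q.facet j) :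
    Wbtw ℝ (Γ t) (Γ s) (Q.refl i j (Γ r)) := by
  have hu := normal_add_ne_zero hi.2 hj.2 hij
  set z := Γ s
  set a := Γ t
  set b := Γ r
  set b' := Q.refl i j b
  have hja : 0 ≤ Q.slack j a := ht.1 j
  have hjb : Q.slack j b' ≤ 0 := by
    rw [slack_refl hu]
    linarith [hr.1 i]
  have hib : Q.slack i b' = 0 := by rw [slack_refl' hu, hr.2, neg_zero]
  -- `c` is where the unfolded chord from `a` to `b'` meets the span of the ridge.
  obtain ⟨c, hcw, hcj⟩ : ∃ c, Wbtw ℝ a c b' ∧ Q.slack j c = 0 := by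
    by_cases h0 : Q.slack j a = 0
    · exact ⟨a, wbtw_self_left _ _ _, h0⟩
    · have hpos : 0 < Q.slack j a := hja.lt_of_ne' h0
      have hden : 0 < Q.slack j a - Q.slack j b' := by linarith
      refine ⟨AffineMap.lineMap a b' (Q.slack j a / (Q.slack j a - Q.slack j b')),
        ⟨_, ⟨by positivity, ?_⟩, rfl⟩, ?_⟩
      · rw [div_le_one hden]
        linarith
      · rw [slack_lineMap]
        field_simp
        ring
  have hci : Q.slack i c = 0 := by
    obtain ⟨τ, -, rfl⟩ := hcw
    rw [slack_lineMap, ht.2, hib]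
    ring
  -- `c` itself may lie outside the polyhedron. Contracting toward `z` by a small factor brings it
  -- into the ridge, because only `i` and `j` are tight at `z`. Comparing lengths after the
  -- contraction still gives `|az| + |zb| ≤ |ac| + |cb| = |ab'|`.
  have hev : ∀ᶠ ε in nhdsWithin (0 : ℝ) (Ioi 0), z + ε • (c - z) ∈ Q.carrier := by
    refine add_smul_mem_carrier_eventually hi.1 fun k hk => ?_
    rcases hreg i j k hi.2 hj.2 hk with e | e | e
    · exact absurd e hij
    · rw [← e, inner_sub_eq, hi.2, hci, sub_zero]
    · rw [← e, inner_sub_eq, hj.2, hcj, sub_zero]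
  obtain ⟨ε, hε, hε0, hε1⟩ := (hev.and (Ioo_mem_nhdsGT (zero_lt_one' ℝ))).exists
  have hslack : ∀ (l : ι) (w : Ambient d), Q.slack l z = 0 → Q.slack l w = 0 →
      Q.slack l (z + ε • (w - z)) = 0 := by
    intro l w h1 h2
    rw [slack_add, inner_smul_right, inner_sub_eq, h1, h2]
    ring
  have hseg : ∀ w ∈ Q.carrier, z + ε • (w - z) ∈ Q.carrier := fun w hw =>
    convex_carrier.add_smul_sub_mem hi.1 hw ⟨hε0.le, hε1.le⟩
  have hci' : z + ε • (c - z) ∈ Q.facet i := ⟨hε, hslack i c hi.2 hci⟩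
  have hcj' : z + ε • (c - z) ∈ Q.facet j := ⟨hε, hslack j c hj.2 hcj⟩
  have ha' : z + ε • (a - z) ∈ Q.facet i := ⟨hseg a ht.1, hslack i a hi.2 ht.2⟩
  have hb' : z + ε • (b - z) ∈ Q.facet j := ⟨hseg b hr.1, hslack j b hj.2 hr.2⟩
  have hle : Q.idist a b ≤ ENNReal.ofReal ((1 - ε) * dist a z + ε * dist a c +
      (ε * dist c b + (1 - ε) * dist b z)) := by
    have e1 := idist_facet ht ha'
    have e2 := idist_facet ha' hci'
    have e3 := idist_facet hcj' hb'
    have e4 := idist_facet hb' hr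
    rw [dist_self_add_smul_sub _ _ hε1.le] at e1
    rw [dist_add_smul_sub _ _ _ hε0.le] at e2 e3
    rw [dist_comm, dist_self_add_smul_sub _ _ hε1.le] at e4
    have p1 : 0 ≤ (1 - ε) * dist a z := mul_nonneg (by linarith) dist_nonneg
    have p2 : 0 ≤ ε * dist a c := by positivity
    have p3 : 0 ≤ ε * dist c b := by positivity
    have p4 : 0 ≤ (1 - ε) * dist b z := mul_nonneg (by linarith) dist_nonneg
    rw [ENNReal.ofReal_add (add_nonneg p1 p2) (add_nonneg p3 p4), ENNReal.ofReal_add p1 p2,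
      ENNReal.ofReal_add p3 p4, ← e1, ← e2, ← e3, ← e4]
    exact intrinsicDist_triangle.trans (add_le_add intrinsicDist_triangle intrinsicDist_triangle)
  rw [h.idist_eq h0 (hrs.trans hst) hD, ENNReal.ofReal_le_ofReal_iff] at hle
  swap
  · have := sub_nonneg.2 hε1.le
    positivity
  have d1 := h.dist_facet h0 hrs (hst.trans hD) hr hj
  have d2 := h.dist_facet (h0.trans hrs) hst hD hi ht
  have hz : Q.refl i j z = z := refl_of_tight hi.2 hj.2
  have hc : Q.refl i j c = c := refl_of_tight hci hcj
  have e1 : dist c b' = dist c b := by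
    conv_lhs => rw [← hc]
    exact dist_refl
  have e2 : dist z b' = dist z b := by
    conv_lhs => rw [← hz]
    exact dist_refl
  have e3 := dist_add_dist_eq_iff.2 hcw
  rw [← dist_add_dist_eq_iff]
  refine le_antisymm ?_ (dist_triangle _ _ _)
  rw [dist_comm b z] at hle
  rw [e2, ← e3, e1]
  have d1' : dist z b = s - r := d1
  have d2' : dist a z = t - s := d2
  rw [d1', d2'] at hle ⊢
  nlinarith

end Geo

end Presentation

lemma eq_of_wbtw_of_dist_eq {E : Type*} [NormedAddCommGroup E] [NormedSpace ℝ E] {a b x y : E}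
    (hx : Wbtw ℝ a x b) (hy : Wbtw ℝ a y b) (h : dist x b = dist y b) : x = y := by
  obtain ⟨s, hs, rfl⟩ := hx
  obtain ⟨t, ht, rfl⟩ := hy
  rw [dist_lineMap_right, dist_lineMap_right, Real.norm_eq_abs, Real.norm_eq_abs,
    abs_of_nonneg (sub_nonneg.2 hs.2), abs_of_nonneg (sub_nonneg.2 ht.2)] at h
  by_cases hab : dist a b = 0
  · obtain rfl := dist_eq_zero.1 hab
    simp
  · have := mul_right_cancel₀ hab h
    rw [show s = t by linarith]

/-! ### Images of the source under unfolding along a shortest path -/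

namespace Presentation

variable {d : ℕ} {ι : Type} (Q : Presentation d ι)

/-- `v` lies on exactly one facet. -/
def Source (v : Ambient d) : Prop := v ∈ Q.carrier ∧ ∃ i, ∀ j, Q.slack j v = 0 ↔ j = i

/-- `ν` is the image of the start of `Γ` under the unfolding along `Γ` into the span of the
`i`-th facet. -/
inductive Good (Γ : ℝ → Ambient d) (D : ℝ) : ι → Ambient d → Prop
  | base {i : ι} : Γ 0 ∈ Q.facet i → Good Γ D i (Γ 0)
  -- Here `r` is the first time in the `i`-th facet, and `j` is a facet through which the path
  -- arrives there.
  | step {i j : ι} {r s : ℝ} {ν : Ambient d} : r ∈ Icc 0 D → Γ r ∈ Q.facet i →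
      (∀ t, 0 ≤ t → t < r → Γ t ∉ Q.facet i) → Γ r ∈ Q.facet j → 0 ≤ s → s < r →
      Γ s ∈ Q.facet j → Good Γ D j ν → Good Γ D i (Q.refl i j ν)

/-- `[z, ν]` is the unfolding into the span of the `i`-th facet of a path from `z` to `v` that
traverses at most `n + 1` facets. -/
def Dev (v : Ambient d) : ℕ → ι → Ambient d → Ambient d → Prop
  | 0, i, z, ν => v ∈ Q.facet i ∧ z ∈ Q.facet i ∧ ν = v
  | n + 1, i, z, ν => Dev v n i z ν ∨ ∃ j p, i ≠ j ∧ z ∈ Q.facet i ∧ p ∈ Q.facet i ∧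
      p ∈ Q.facet j ∧ Wbtw ℝ z p ν ∧ Dev v n j p (Q.refl i j ν)

open Classical in
/-- The facets that `Γ` visits strictly before the `i`-th one. -/
noncomputable def before [Fintype ι] (Γ : ℝ → Ambient d) (i : ι) : Finset ι :=
  Finset.univ.filter fun j => ∃ s, 0 ≤ s ∧ Γ s ∈ Q.facet j ∧ ∀ t, 0 ≤ t → t ≤ s → Γ t ∉ Q.facet i

variable {Q} {i j k : ι} {v x y z a b p q ν ν' : Ambient d} {Γ Γ' : ℝ → Ambient d} {D D' r s : ℝ}

lemma mem_before [Fintype ι] : j ∈ Q.before Γ i ↔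
    ∃ s, 0 ≤ s ∧ Γ s ∈ Q.facet j ∧ ∀ t, 0 ≤ t → t ≤ s → Γ t ∉ Q.facet i := by
  simp [before]

/-- What is visited before `j` is also visited before `i`, and `j` itself is new. This number is the
measure for induction along the path. -/
lemma before_card_lt [Fintype ι] (hmin : ∀ t, 0 ≤ t → t < r → Γ t ∉ Q.facet i) (hs : 0 ≤ s)
    (hsr : s < r) (hj : Γ s ∈ Q.facet j) : (Q.before Γ j).card < (Q.before Γ i).card := by
  apply Finset.card_lt_card
  rw [Finset.ssubset_iff_of_subset]
  · refine ⟨j, mem_before.2 ⟨s, hs, hj, fun t h0 ht => hmin t h0 (ht.trans_lt hsr)⟩, ?_⟩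
    intro hjj
    obtain ⟨t, h0, ht, hno⟩ := mem_before.1 hjj
    exact hno t h0 le_rfl ht
  · intro k hk
    obtain ⟨t, h0, ht, hno⟩ := mem_before.1 hk
    refine mem_before.2 ⟨t, h0, ht, fun u hu hut => hmin u hu ?_⟩
    by_contra! hc
    exact hno s hs (hsr.le.trans (hc.trans hut)) hj

lemma Source.regular (hv : Q.Source v) : Q.Regular v := by
  obtain ⟨-, i, hi⟩ := hv
  intro j k l hj hk _
  exact Or.inl (((hi j).1 hj).trans ((hi k).1 hk).symm)

lemma Source.exists_facet (hv : Q.Source v) : ∃ i, v ∈ Q.facet i := by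
  obtain ⟨hc, i, hi⟩ := hv
  exact ⟨i, hc, (hi i).2 rfl⟩

lemma Source.eq (hv : Q.Source v) (hi : v ∈ Q.facet i) (hj : v ∈ Q.facet j) : i = j := by
  obtain ⟨-, k, hk⟩ := hv
  exact ((hk i).1 hi.2).trans ((hk j).1 hj.2).symm

lemma Regular.eq_of_ne (h : Q.Regular x) (hi : x ∈ Q.facet i) (hj : x ∈ Q.facet j)
    (hk : x ∈ Q.facet k) (hij : i ≠ j) (hik : i ≠ k) : j = k := by
  rcases h i j k hi.2 hj.2 hk.2 with e | e | e
  · exact absurd e hij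
  · exact absurd e hik
  · exact e

lemma Good.congr (h : Q.Good Γ D i ν) (hD : D ≤ D') (hΓ : ∀ r ∈ Icc 0 D, Γ' r = Γ r)
    (h0 : 0 ≤ D) : Q.Good Γ' D' i ν := by
  induction h with
  | base hi =>
    have e := hΓ 0 ⟨le_rfl, h0⟩
    rw [← e] at hi ⊢
    exact Good.base hi
  | step hr hi hmin hj hs hsr hsj _ ih =>
    refine Good.step ⟨hr.1, hr.2.trans hD⟩ ?_ ?_ ?_ hs hsr ?_ ih
    · rwa [hΓ _ hr]
    · intro t ht htr
      rw [hΓ t ⟨ht, htr.le.trans hr.2⟩]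
      exact hmin t ht htr
    · rwa [hΓ _ hr]
    · rwa [hΓ _ ⟨hs, hsr.le.trans hr.2⟩]

lemma ne_of_first (hmin : ∀ t, 0 ≤ t → t < r → Γ t ∉ Q.facet i) (hs : 0 ≤ s)
    (hsr : s < r) (hj : Γ s ∈ Q.facet j) : i ≠ j := fun e => hmin s hs hsr (e ▸ hj)

namespace Geo

lemma exists_first [Finite ι] (h : Q.Geo v Γ D) (hr : r ∈ Icc 0 D) (hi : Γ r ∈ Q.facet i) :
    ∃ r₀ ∈ Icc 0 r, Γ r₀ ∈ Q.facet i ∧ ∀ t, 0 ≤ t → t < r₀ → Γ t ∉ Q.facet i := by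
  have hcl : IsClosed (Icc 0 D ∩ Γ ⁻¹' Q.facet i) :=
    h.lipschitzOnWith.continuousOn.preimage_isClosed_of_isClosed isClosed_Icc isClosed_facet
  obtain ⟨r₀, ⟨hr₀, hi₀⟩, hmin⟩ :=
    (isCompact_Icc.of_isClosed_subset hcl inter_subset_left).exists_isLeast ⟨r, hr, hi⟩
  have hle := hmin ⟨hr, hi⟩
  exact ⟨r₀, ⟨hr₀.1, hle⟩, hi₀, fun t ht htr hti =>
    htr.not_ge (hmin ⟨⟨ht, htr.le.trans hr₀.2⟩, hti⟩)⟩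

lemma exists_good [Fintype ι] (h : Q.Geo v Γ D) (hr : r ∈ Icc 0 D) (hi : Γ r ∈ Q.facet i) :
    ∃ ν, Q.Good Γ D i ν := by
  induction hn : (Q.before Γ i).card using Nat.strong_induction_on generalizing i r with
  | _ n ih =>
    obtain ⟨r₀, hr₀, hi₀, hmin⟩ := h.exists_first hr hi
    rcases hr₀.1.eq_or_lt with e | hpos
    · rw [← e] at hi₀
      exact ⟨_, Good.base hi₀⟩
    · have hr₀D : r₀ ∈ Icc 0 D := ⟨hr₀.1, hr₀.2.trans hr.2⟩
      obtain ⟨j, s, hs, hsj, hrj⟩ := h.exists_facet_before hpos hr₀D.2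
      obtain ⟨ν, hν⟩ := ih _ (hn ▸ before_card_lt hmin hs.1 hs.2 hsj)
        ⟨hs.1, hs.2.le.trans hr₀D.2⟩ hsj rfl
      exact ⟨_, Good.step hr₀D hi₀ hmin hrj hs.1 hs.2 hsj hν⟩

/-- At a regular point at most two facets meet, so the first entry into a facet determines the facet
of arrival. -/
lemma good_unique (hreg : ∀ r ∈ Icc 0 D, Q.Regular (Γ r))
    (h₁ : Q.Good Γ D i ν) (h₂ : Q.Good Γ D i ν') : ν = ν' := by
  induction h₁ generalizing ν' with
  | base hi =>
    cases h₂ with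
    | base _ => rfl
    | step hr _ hmin _ hs hsr _ _ => exact absurd hi (hmin 0 le_rfl (hs.trans_lt hsr))
  | step hr hi hmin hj hs hsr hsj _ ih =>
    cases h₂ with
    | base hi' => exact absurd hi' (hmin 0 le_rfl (hs.trans_lt hsr))
    | step hr' hi' hmin' hj' hs' hsr' hsj' h' =>
      have e := le_antisymm (not_lt.1 fun hlt => hmin _ hr'.1 hlt hi')
        (not_lt.1 fun hlt => hmin' _ hr.1 hlt hi)
      subst e
      obtain rfl := (hreg _ hr).eq_of_ne hi hj hj' (ne_of_first hmin hs hsr hsj)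
        (ne_of_first hmin' hs' hsr' hsj')
      rw [ih h']

/-- The part of `Γ` in the `i`-th facet lies on the unfolded segment. -/
lemma good_spec [Finite ι] (h : Q.Geo v Γ D) (hreg : ∀ r ∈ Icc 0 D, Q.Regular (Γ r))
    (hg : Q.Good Γ D i ν) : Q.slack i ν = 0 ∧ ∀ r ∈ Icc 0 D, Γ r ∈ Q.facet i →
      dist (Γ r) ν = r ∧ ∀ s ∈ Icc 0 r, Γ s ∈ Q.facet i → Wbtw ℝ (Γ r) (Γ s) ν := by
  induction hg with
  | base hi =>
    refine ⟨hi.2, fun r hr hri => ⟨?_, fun s hs hsi => ?_⟩⟩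
    · rw [h.dist_facet le_rfl hr.1 hr.2 hi hri, sub_zero]
    · exact h.wbtw le_rfl hs.1 hs.2 hr.2 hi hri
  | @step i j r₀ s₀ ν hr₀ hi₀ hmin hj₀ hs₀ hsr hsj _ ih =>
    have hij := ne_of_first hmin hs₀ hsr hsj
    have hu := normal_add_ne_zero hi₀.2 hj₀.2 hij
    have hp : Q.refl i j (Γ r₀) = Γ r₀ := refl_of_tight hi₀.2 hj₀.2
    obtain ⟨ih1, ih2⟩ := ih
    obtain ⟨hd, hw⟩ := ih2 r₀ hr₀ hj₀
    have hw0 := hw s₀ ⟨hs₀, hsr.le⟩ hsj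
    rw [← Q.wbtw_refl_iff (i := i) (j := j), hp] at hw0
    have hd' : dist (Γ r₀) (Q.refl i j ν) = r₀ := by
      conv_lhs => rw [← hp]
      rw [dist_refl, hd]
    have hne : Γ r₀ ≠ Q.refl i j (Γ s₀) := by
      rw [← hp]
      intro e
      have := refl_injective e
      exact hmin s₀ hs₀ hsr (this ▸ hi₀)
    refine ⟨by rw [slack_refl' hu, ih1, neg_zero], fun r hr hri => ?_⟩
    have hle : r₀ ≤ r := not_lt.1 fun hlt => hmin r hr.1 hlt hri
    -- The path is straight across the ridge from `Γ s₀`, and by induction the reflected earlier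
    -- part continues from there toward the reflected image.
    have hwr : Wbtw ℝ (Γ r) (Γ r₀) (Q.refl i j ν) := by
      rcases hle.eq_or_lt with rfl | hlt
      · exact wbtw_self_left _ _ _
      · exact (h.wbtw_refl hs₀ hsr.le hle hr.2 (hreg _ hr₀) hij hi₀ hj₀ hri hsj).trans_expand_left
          hw0 hne
    refine ⟨?_, fun s hs hsi => ?_⟩
    · rw [← dist_add_dist_eq_iff.2 hwr, hd', h.dist_facet hr₀.1 hle hr.2 hi₀ hri]
      ring
    · have hle' : r₀ ≤ s := not_lt.1 fun hlt => hmin s hs.1 hlt hsi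
      exact hwr.trans_left (h.wbtw hr₀.1 hle' hs.2 hr.2 hi₀ hri)

/-- `Γ s` has positive `i`-th slack and lies on the segment from `Γ r`, where this slack is zero, to
`ν`; so `ν` has positive `i`-th slack, and reflection turns it into a negative `j`-th one. The image
thus lies strictly beyond the hyperplane that was crossed. -/
lemma slack_neg_of_step [Finite ι] (h : Q.Geo v Γ D) (hreg : ∀ r ∈ Icc 0 D, Q.Regular (Γ r))
    (hr : r ∈ Icc 0 D) (hi : Γ r ∈ Q.facet i) (hmin : ∀ t, 0 ≤ t → t < r → Γ t ∉ Q.facet i)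
    (hj : Γ r ∈ Q.facet j) (hs : 0 ≤ s) (hsr : s < r) (hsj : Γ s ∈ Q.facet j)
    (hg : Q.Good Γ D j ν) : Q.slack j (Q.refl i j ν) < 0 := by
  rw [slack_refl (normal_add_ne_zero hi.2 hj.2 (ne_of_first hmin hs hsr hsj)), neg_lt_zero]
  obtain ⟨t, ht, e⟩ := ((h.good_spec hreg hg).2 r hr hj).2 s ⟨hs, hsr.le⟩ hsj
  have h0 : 0 < Q.slack i (Γ s) :=
    (hsj.1 i).lt_of_ne' fun h0 => hmin s hs hsr ⟨hsj.1, h0⟩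
  rw [← e, slack_lineMap, hi.2, mul_zero, zero_add] at h0
  exact (pos_iff_pos_of_mul_pos h0).1 (ht.1.lt_of_ne' fun e => by simp [e] at h0)

/-- Whichever facet is entered first, the other is later entered from it. A simultaneous first entry
would put the source on two facets or the path on three. -/
lemma good_transfer [Fintype ι] (h : Q.Geo v Γ D) (hv : Q.Source v)
    (hreg : ∀ r ∈ Icc 0 D, Q.Regular (Γ r)) (hr : r ∈ Icc 0 D) (hij : i ≠ j)
    (hi : Γ r ∈ Q.facet i) (hj : Γ r ∈ Q.facet j) (hg : Q.Good Γ D i ν) :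
    Q.Good Γ D j (Q.refl i j ν) := by
  obtain ⟨a, ha, hai, hamin⟩ := h.exists_first hr hi
  obtain ⟨b, hb, hbj, hbmin⟩ := h.exists_first hr hj
  rcases lt_trichotomy a b with hlt | rfl | hlt
  · have hbi := h.mem_facet ha.1 hlt.le hb.2 hr.2 hai hi
    rw [refl_comm]
    exact Good.step ⟨hb.1, hb.2.trans hr.2⟩ hbj hbmin hbi ha.1 hlt hai hg
  · exfalso
    rcases ha.1.eq_or_lt with rfl | hpos
    · rw [h.zero] at hai hbj
      exact hij (hv.eq hai hbj)
    · obtain ⟨k, s, hs, hsk, hak⟩ := h.exists_facet_before hpos (ha.2.trans hr.2)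
      have hik := ne_of_first hamin hs.1 hs.2 hsk
      have hjk := ne_of_first hbmin hs.1 hs.2 hsk
      exact hjk ((hreg a ⟨ha.1, ha.2.trans hr.2⟩).eq_of_ne hai hbj hak hij hik)
  · have haj := h.mem_facet hb.1 hlt.le ha.2 hr.2 hbj hj
    obtain ⟨ν', hν'⟩ := h.exists_good hr hj
    have hg' := Good.step ⟨ha.1, ha.2.trans hr.2⟩ hai hamin haj hb.1 hlt hbj hν'
    rw [good_unique hreg hg hg', refl_refl]
    exact hν'

/-- A shortest path is determined by its endpoint and its source image. -/
lemma eqOn_of_good [Finite ι] (h₁ : Q.Geo v Γ D) (h₂ : Q.Geo v Γ' D')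
    (hreg₁ : ∀ r ∈ Icc 0 D, Q.Regular (Γ r)) (hreg₂ : ∀ r ∈ Icc 0 D', Q.Regular (Γ' r))
    (hg₁ : Q.Good Γ D i ν) (hg₂ : Q.Good Γ' D' i ν) (hr : 0 ≤ r) (hrD : r ≤ D) (hrD' : r ≤ D')
    (he : Γ r = Γ' r) (hi : Γ r ∈ Q.facet i) : ∀ s ∈ Icc 0 r, Γ s = Γ' s := by
  induction hg₁ generalizing r with
  | @base i h0 =>
    intro s hs
    have w₁ := h₁.wbtw le_rfl hs.1 hs.2 hrD h0 hi
    have h0' : Γ' 0 ∈ Q.facet i := by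
      rw [h₂.zero, ← h₁.zero]
      exact h0
    have w₂ := h₂.wbtw le_rfl hs.1 hs.2 hrD' h0' (he ▸ hi)
    have m₁ := h₁.mem_facet le_rfl hs.1 hs.2 hrD h0 hi
    have m₂ := h₂.mem_facet le_rfl hs.1 hs.2 hrD' h0' (he ▸ hi)
    have d₁ := h₁.dist_facet le_rfl hs.1 (hs.2.trans hrD) h0 m₁
    have d₂ := h₂.dist_facet le_rfl hs.1 (hs.2.trans hrD') h0' m₂
    rw [← he] at w₂
    rw [h₂.zero, ← h₁.zero] at w₂ d₂
    exact eq_of_wbtw_of_dist_eq w₁ w₂ (d₁.trans d₂.symm)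
  | @step i j r₁ s₁ ν₁ hr₁ hi₁ hmin₁ hj₁ hs₁ hsr₁ hsj₁ hν₁ ih =>
    have sp₁ := h₁.good_spec hreg₁ (Good.step hr₁ hi₁ hmin₁ hj₁ hs₁ hsr₁ hsj₁ hν₁)
    have sp₂ := h₂.good_spec hreg₂ hg₂
    have neg₁ := h₁.slack_neg_of_step hreg₁ hr₁ hi₁ hmin₁ hj₁ hs₁ hsr₁ hsj₁ hν₁
    have hi' : Γ' r ∈ Q.facet i := he ▸ hi
    generalize hν : Q.refl i j ν₁ = ν at *
    cases hg₂ with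
    | base h0 => exact absurd (h0.1 j) (not_le.2 neg₁)
    | @step _ j₂ r₂ s₂ ν₂ hr₂ hi₂ hmin₂ hj₂ hs₂ hsr₂ hsj₂ hν₂ =>
      have neg₂ := h₂.slack_neg_of_step hreg₂ hr₂ hi₂ hmin₂ hj₂ hs₂ hsr₂ hsj₂ hν₂
      have hle₁ : r₁ ≤ r := not_lt.1 fun hlt => hmin₁ r hr hlt hi
      have hle₂ : r₂ ≤ r := not_lt.1 fun hlt => hmin₂ r hr hlt hi'
      have w₁ := (sp₁.2 r ⟨hr, hrD⟩ hi).2 r₁ ⟨hr₁.1, hle₁⟩ hi₁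
      have w₂ := (sp₂.2 r ⟨hr, hrD'⟩ hi').2 r₂ ⟨hr₂.1, hle₂⟩ hi₂
      rw [← he] at w₂
      have hnlt : ∀ {t₁ t₂ : ℝ} {l : ι} {w : Ambient d}, t₁ < t₂ → Q.slack l w < 0 →
          0 ≤ Q.slack l (Γ r) →
          Q.slack l (AffineMap.lineMap (Γ r) w t₁) = 0 →
          Q.slack l (AffineMap.lineMap (Γ r) w t₂) < 0 := by
        intro t₁ t₂ l w hlt hneg hpos h0
        rw [slack_lineMap] at h0 ⊢
        nlinarith
      -- Both entry points lie on the segment from `Γ r` to the image. Past the hyperplane of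
      -- arrival of one path the corresponding slack is negative, so the entry point of the other
      -- cannot be farther on.
      have hpp : Γ r₁ = Γ' r₂ := by
        obtain ⟨t₁, ht₁, e₁⟩ := w₁
        obtain ⟨t₂, ht₂, e₂⟩ := w₂
        rcases lt_trichotomy t₁ t₂ with hlt | rfl | hlt
        · have := hnlt hlt neg₁ (hi.1 j) (by rw [e₁]; exact hj₁.2)
          rw [e₂] at this
          exact absurd (hi₂.1 j) (not_le.2 this)
        · exact e₁.symm.trans e₂
        · have := hnlt hlt neg₂ (hi.1 j₂) (by rw [e₂]; exact hj₂.2)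
          rw [e₁] at this
          exact absurd (hi₁.1 j₂) (not_le.2 this)
      have hrr : r₁ = r₂ := by
        have e₁ := (sp₁.2 r₁ hr₁ hi₁).1
        have e₂ := (sp₂.2 r₂ hr₂ hi₂).1
        rw [← e₁, ← e₂, hpp]
      subst hrr
      obtain rfl := (hreg₁ _ hr₁).eq_of_ne hi₁ hj₁ (hpp ▸ hj₂)
        (ne_of_first hmin₁ hs₁ hsr₁ hsj₁) (ne_of_first hmin₂ hs₂ hsr₂ hsj₂)
      obtain rfl := refl_injective hν
      intro s hs
      rcases le_total s r₁ with hsr | hsr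
      · exact ih hν₂ hr₁.1 hr₁.2 hr₂.2 hpp hj₁ s ⟨hs.1, hsr⟩
      · have m₁ := h₁.mem_facet hr₁.1 hsr hs.2 hrD hi₁ hi
        have m₂ := h₂.mem_facet hr₂.1 hsr hs.2 hrD' hi₂ hi'
        have w₁ := (sp₁.2 r ⟨hr, hrD⟩ hi).2 s hs m₁
        have w₂ := (sp₂.2 r ⟨hr, hrD'⟩ hi').2 s hs m₂
        rw [← he] at w₂
        exact eq_of_wbtw_of_dist_eq w₁ w₂
          ((sp₁.2 s ⟨hs.1, hs.2.trans hrD⟩ m₁).1.trans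
            (sp₂.2 s ⟨hs.1, hs.2.trans hrD'⟩ m₂).1.symm)

end Geo

/-! ### Unfolded segments -/

section Dev

variable {n m : ℕ}

lemma Dev.mono (h : Q.Dev v n i z ν) (hnm : n ≤ m) : Q.Dev v m i z ν := by
  induction hnm with
  | refl => exact h
  | step _ ih => exact Or.inl ih

lemma dist_refl_of_tight (hi : p ∈ Q.facet i) (hj : p ∈ Q.facet j) :
    dist p (Q.refl i j ν) = dist p ν := by
  conv_lhs => rw [← refl_of_tight hi.2 hj.2]
  exact dist_refl

/-- Folding the segment back, facet by facet, gives a path of the same length. `Dev` demands no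
minimality, and hence is stable under limits. -/
lemma Dev.idist_le [Finite ι] (h : Q.Dev v n i z ν) : Q.idist z v ≤ ENNReal.ofReal (dist z ν) := by
  induction n generalizing i z ν with
  | zero =>
    obtain ⟨hv, hz, rfl⟩ := h
    exact (idist_facet hz hv).le
  | succ n ih =>
    rcases h with h | ⟨j, p, -, hz, hpi, hpj, hw, h⟩
    · exact ih h
    · have h1 := ih h
      rw [dist_refl_of_tight hpi hpj] at h1
      rw [← dist_add_dist_eq_iff.2 hw, ENNReal.ofReal_add dist_nonneg dist_nonneg]
      exact intrinsicDist_triangle.trans (add_le_add (idist_facet hz hpi).le h1)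

lemma finite_dev [Finite ι] (v : Ambient d) (n : ℕ) (i : ι) :
    {ν | ∃ z, Q.Dev v n i z ν}.Finite := by
  induction n generalizing i with
  | zero =>
    refine (finite_singleton v).subset ?_
    rintro ν ⟨z, -, -, rfl⟩
    rfl
  | succ n ih =>
    refine ((ih i).union (finite_iUnion fun j => (ih j).image (Q.refl i j))).subset ?_
    rintro ν ⟨z, h | ⟨j, p, -, -, -, -, -, h⟩⟩
    · exact Or.inl ⟨z, h⟩
    · exact Or.inr (mem_iUnion.2 ⟨j, _, ⟨p, h⟩, refl_refl⟩)

/-- The crossing points `p` lie between `z` and `ν`, so they stay bounded and subconverge. -/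
lemma isClosed_dev [Finite ι] (v : Ambient d) (n : ℕ) (i : ι) (ν : Ambient d) :
    IsClosed {z | Q.Dev v n i z ν} := by
  induction n generalizing i ν with
  | zero =>
    by_cases h : v ∈ Q.facet i ∧ ν = v
    · have : {z | Q.Dev v 0 i z ν} = Q.facet i := by
        ext z
        exact ⟨fun hz => hz.2.1, fun hz => ⟨h.1, hz, h.2⟩⟩
      rw [this]
      exact isClosed_facet
    · have : {z | Q.Dev v 0 i z ν} = ∅ := by
        ext z
        simp only [mem_empty_iff_false, iff_false]
        exact fun hz => h ⟨hz.1, hz.2.2⟩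
      rw [this]
      exact isClosed_empty
  | succ n ih =>
    have : {z | Q.Dev v (n + 1) i z ν} = {z | Q.Dev v n i z ν} ∪
        ⋃ j, {z | ∃ p, i ≠ j ∧ z ∈ Q.facet i ∧ p ∈ Q.facet i ∧ p ∈ Q.facet j ∧ Wbtw ℝ z p ν ∧
          Q.Dev v n j p (Q.refl i j ν)} := by
      ext z
      rw [mem_union, mem_iUnion]
      rfl
    rw [this]
    refine (ih i ν).union (isClosed_iUnion_of_finite fun j => ?_)
    apply IsSeqClosed.isClosed
    intro u q hu hq
    choose p hij hui hpi hpj hw hdev using hu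
    obtain ⟨M, hM⟩ := (Metric.isBounded_range_of_tendsto u hq).exists_norm_le
    have hpM : ∀ m, p m ∈ Metric.closedBall ν (M + ‖ν‖) := by
      intro m
      have h1 := hM _ (mem_range_self m)
      have h2 := dist_add_dist_eq_iff.2 (hw m)
      have h3 : dist (u m) ν ≤ ‖u m‖ + ‖ν‖ := dist_le_norm_add_norm _ _
      have h4 := dist_nonneg (x := u m) (y := p m)
      rw [Metric.mem_closedBall]
      linarith
    obtain ⟨p', -, φ, hφ, hlim⟩ := (isCompact_closedBall _ _).tendsto_subseq hpM
    have hq' := hq.comp hφ.tendsto_atTop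
    have all : ∀ {P : ℕ → Prop}, (∀ m, P m) → ∀ᶠ m in Filter.atTop, P (φ m) :=
      fun h => Filter.Eventually.of_forall fun m => h (φ m)
    refine ⟨p', hij 0, isClosed_facet.mem_of_tendsto hq' (all hui),
      isClosed_facet.mem_of_tendsto hlim (all hpi), isClosed_facet.mem_of_tendsto hlim (all hpj),
      ?_, (ih j (Q.refl i j ν)).mem_of_tendsto hlim (all hdev)⟩
    rw [← dist_add_dist_eq_iff]
    refine tendsto_nhds_unique ((hq'.dist hlim).add (hlim.dist tendsto_const_nhds)) ?_
    refine (hq'.dist tendsto_const_nhds).congr fun m => ?_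
    exact (dist_add_dist_eq_iff.2 (hw (φ m))).symm

/-- The unfolding along a shortest path persists at nearby points of the facet. -/
lemma Geo.dev_eventually [Fintype ι] (h : Q.Geo v Γ D) (hreg : ∀ r ∈ Icc 0 D, Q.Regular (Γ r))
    (hg : Q.Good Γ D i ν) (hr : r ∈ Icc 0 D) (hi : Γ r ∈ Q.facet i) :
    ∀ᶠ z in nhds (Γ r), z ∈ Q.facet i → Q.Dev v (Q.before Γ i).card i z ν := by
  induction hg generalizing r with
  | base h0 =>
    refine Filter.Eventually.of_forall fun z hz => Dev.mono (n := 0) ?_ (Nat.zero_le _)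
    rw [h.zero] at h0 ⊢
    exact ⟨h0, hz, rfl⟩
  | @step i j r₀ s₀ ν' hr₀ hi₀ hmin hj₀ hs₀ hsr hsj hν' ih =>
    have hij := ne_of_first hmin hs₀ hsr hsj
    have hneg := h.slack_neg_of_step hreg hr₀ hi₀ hmin hj₀ hs₀ hsr hsj hν'
    obtain ⟨hν0, hsp⟩ := h.good_spec hreg (Good.step hr₀ hi₀ hmin hj₀ hs₀ hsr hsj hν')
    have hle : r₀ ≤ r := not_lt.1 fun hlt => hmin r hr.1 hlt hi
    have hw := (hsp r hr hi).2 r₀ ⟨hr₀.1, hle⟩ hi₀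
    set ν := Q.refl i j ν' with hν
    have hcard := before_card_lt hmin hs₀ hsr hsj
    -- The parameter at which the segment from `z` to `ν` meets the `j`-th hyperplane. It is
    -- continuous since `ν` lies strictly beyond, and for `z` near `Γ r` the crossing point stays in
    -- the ridge.
    let τ : Ambient d → ℝ := fun z => Q.slack j z / (Q.slack j z - Q.slack j ν)
    let c : Ambient d → Ambient d := fun z => AffineMap.lineMap z ν (τ z)
    have hden : ∀ z ∈ Q.facet i, 0 < Q.slack j z - Q.slack j ν := fun z hz => by
      linarith [hz.1 j]
    have hcp : c (Γ r) = Γ r₀ := by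
      obtain ⟨t, ht, e⟩ := hw
      have h1 : (1 - t) * Q.slack j (Γ r) + t * Q.slack j ν = 0 := by
        rw [← slack_lineMap, e, hj₀.2]
      have h2 : τ (Γ r) = t := by
        have := hden _ hi
        simp only [τ]
        rw [div_eq_iff this.ne']
        linarith
      simp only [c, h2, e]
    have hτc : ContinuousAt τ (Γ r) :=
      continuous_slack.continuousAt.div (continuous_slack.continuousAt.sub continuousAt_const)
        (hden _ hi).ne'
    have hcc : ContinuousAt c (Γ r) := by
      have : c = fun z => z + τ z • (ν - z) := by
        funext z
        simp only [c, AffineMap.lineMap_apply, vsub_eq_sub, vadd_eq_add]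
        abel
      rw [this]
      exact continuousAt_id.add (hτc.smul (continuousAt_const.sub continuousAt_id))
    have hct : Filter.Tendsto c (nhds (Γ r)) (nhds (Γ r₀)) := hcp ▸ hcc
    filter_upwards [hct.eventually (ih hr₀ hj₀),
      hct.eventually (slack_eventually_pos (Q := Q) (Γ r₀))] with z hz1 hz2 hz
    have hd := hden z hz
    have hτ0 : 0 ≤ τ z := div_nonneg (hz.1 j) hd.le
    have hτ1 : τ z ≤ 1 := by
      rw [div_le_one hd]
      linarith
    have hci : Q.slack i (c z) = 0 := by
      rw [slack_lineMap, hz.2, hν0]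
      ring
    have hcj : Q.slack j (c z) = 0 := by
      rw [slack_lineMap]
      simp only [τ]
      field_simp
      ring
    have hcP : c z ∈ Q.carrier := by
      intro k
      by_cases hki : k = i
      · exact hki ▸ hci.ge
      by_cases hkj : k = j
      · exact hkj ▸ hcj.ge
      refine (hz2 k ((hi₀.1 k).lt_of_ne' fun hk => ?_)).le
      exact hkj ((hreg _ hr₀).eq_of_ne hi₀ hj₀ ⟨hi₀.1, hk⟩ hij (Ne.symm hki)).symm
    have hdev := hz1 ⟨hcP, hcj⟩
    refine Dev.mono (n := (Q.before Γ j).card + 1) (Or.inr ⟨j, c z, hij, hz, ⟨hcP, hci⟩,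
      ⟨hcP, hcj⟩, ⟨τ z, ⟨hτ0, hτ1⟩, rfl⟩, ?_⟩) hcard
    rwa [hν, refl_refl]

lemma Geo.dev_of_good [Fintype ι] (h : Q.Geo v Γ D) (hreg : ∀ r ∈ Icc 0 D, Q.Regular (Γ r))
    (hg : Q.Good Γ D i ν) (hr : r ∈ Icc 0 D) (hi : Γ r ∈ Q.facet i) :
    Q.Dev v (Fintype.card ι) i (Γ r) ν :=
  ((h.dev_eventually hreg hg hr hi).self_of_nhds hi).mono (Finset.card_le_univ _)

/-- An unfolded segment whose length is the boundary distance comes from a shortest path. -/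
lemma Dev.exists_good [Fintype ι] (hv : Q.Source v) (h : Q.Dev v n i z ν) (hz : Q.Regular z)
    (hge : ENNReal.ofReal (dist z ν) ≤ Q.idist z v) :
    ∃ Γ D, Q.Geo v Γ D ∧ Γ D = z ∧ Q.Good Γ D i ν := by
  induction n generalizing i z ν with
  | zero =>
    obtain ⟨hvi, hzi, rfl⟩ := h
    have h0 : Q.Geo ν (fun _ => ν) 0 := by
      have hvv : Q.idist ν ν = 0 := by
        rw [idist_facet hvi hvi]
        simp
      refine ⟨le_rfl, rfl, fun _ _ => facet_subset_frontier hvi, ?_, ?_⟩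
      · intro r r' _ _ _
        rw [hvv]
        exact bot_le
      · simp
    obtain ⟨Γ, hΓ, hΓz, hΓe⟩ := h0.exists_extension hvi hzi (by rwa [zero_add])
    refine ⟨Γ, _, hΓ, hΓz, ?_⟩
    have e : Γ 0 = ν := hΓe 0 le_rfl
    have := Good.base (Q := Q) (Γ := Γ) (D := 0 + dist z ν) (i := i) (by rw [e]; exact hvi)
    rwa [e] at this
  | succ n ih =>
    rcases h with h | ⟨j, p, hij, hzi, hpi, hpj, hw, h⟩
    · exact ih h hz hge
    · have hdp := dist_refl_of_tight (ν := ν) hpi hpj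
      have hd := dist_add_dist_eq_iff.2 hw
      have hle := h.idist_le
      have hge' : ENNReal.ofReal (dist p (Q.refl i j ν)) ≤ Q.idist p v := by
        rw [hdp]
        have h1 : Q.idist z v ≤ ENNReal.ofReal (dist z p) + Q.idist p v := by
          rw [← idist_facet hzi hpi]
          exact intrinsicDist_triangle
        have h2 : dist p ν = dist z ν - dist z p := by linarith
        rw [h2, ENNReal.ofReal_sub _ dist_nonneg]
        exact tsub_le_iff_left.2 (hge.trans h1)
      have extend : ∀ Γ D, Q.Geo v Γ D → Γ D = p → ∃ Γ', Q.Geo v Γ' (D + dist z p) ∧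
          Γ' (D + dist z p) = z ∧ ∀ r ≤ D, Γ' r = Γ r := by
        intro Γ D hΓ hΓp
        have hD : ENNReal.ofReal D = Q.idist p v := by
          rw [← hΓp]
          exact (hΓ.idist_start ⟨hΓ.nonneg, le_rfl⟩).symm
        have hD' : D = dist p ν := by
          have h1 := le_antisymm hle hge'
          rw [← hD, ENNReal.ofReal_eq_ofReal_iff hΓ.nonneg dist_nonneg, hdp] at h1
          exact h1
        have := hΓ.exists_extension (i := i) (by rwa [hΓp]) hzi (by
          rw [hΓp, hD', add_comm, hd]
          exact hge)
        rwa [hΓp] at this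
      -- Any shortest path to `p`, extended by the segment to the regular point `z`, is still
      -- shortest, so it passes no irregular point.
      have hpreg : Q.Regular p := by
        obtain ⟨Γ, D, hΓ, hΓp⟩ := Presentation.exists_geo hv.exists_facet
          (ne_top_of_le_ne_top ENNReal.ofReal_ne_top hle)
        obtain ⟨Γ', hΓ', hz', he⟩ := extend Γ D hΓ hΓp
        have := hΓ'.regular hv.regular (by rwa [hz']) D
          ⟨hΓ.nonneg, le_add_of_nonneg_right dist_nonneg⟩
        rwa [he D le_rfl, hΓp] at this
      obtain ⟨Γ, D, hΓ, hΓp, hg⟩ := ih h hpreg hge'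
      obtain ⟨Γ', hΓ', hz', he⟩ := extend Γ D hΓ hΓp
      have hDD : D ≤ D + dist z p := le_add_of_nonneg_right dist_nonneg
      have hg' : Q.Good Γ' (D + dist z p) j (Q.refl i j ν) :=
        hg.congr hDD (fun r hr => he r hr.2) hΓ.nonneg
      have hΓ'p : Γ' D = p := (he D le_rfl).trans hΓp
      have := hΓ'.good_transfer hv (hΓ'.regular hv.regular (by rwa [hz']))
        ⟨hΓ.nonneg, hDD⟩ hij.symm (by rwa [hΓ'p]) (by rwa [hΓ'p]) hg'
      rw [refl_comm, refl_refl] at this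
      exact ⟨Γ', _, hΓ', hz', this⟩

end Dev

end Presentation

/-! ### Comparison of intrinsic and unfolded distance -/

/-- A minimum principle for functions with local affine upper supports. -/
lemma nonneg_of_affine_support {k : ℝ → ℝ} {c : ℝ} (hk : ContinuousOn k (Icc 0 c))
    (h0 : 0 ≤ k 0) (hc : 0 ≤ k c)
    (hsup : ∀ t ∈ Ioo 0 c, ∃ m : ℝ, ∀ᶠ s in nhds t, k s ≤ k t + m * (s - t)) :
    ∀ t ∈ Icc 0 c, 0 ≤ k t := by
  by_contra! hne
  obtain ⟨t₁, ht₁, hneg⟩ := hne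
  obtain ⟨t₂, ht₂, hmin⟩ := isCompact_Icc.exists_isMinOn ⟨t₁, ht₁⟩ hk
  -- At the leftmost minimum, points to the right force the supporting slope to be nonnegative; then
  -- points just to the left are minima too, a contradiction.
  have hcl : IsClosed (Icc 0 c ∩ k ⁻¹' Iic (k t₂)) :=
    hk.preimage_isClosed_of_isClosed isClosed_Icc isClosed_Iic
  obtain ⟨t, ⟨ht, htle⟩, hleast⟩ :=
    (isCompact_Icc.of_isClosed_subset hcl inter_subset_left).exists_isLeast ⟨t₂, ht₂, le_refl (k t₂)⟩
  have htmin : ∀ s ∈ Icc 0 c, k t ≤ k s := fun s hs =>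
    (show k t ≤ k t₂ from htle).trans (hmin hs)
  have hkt : k t < 0 := (htmin t₁ ht₁).trans_lt hneg
  have htI : t ∈ Ioo 0 c := by
    refine ⟨ht.1.lt_of_ne ?_, ht.2.lt_of_ne ?_⟩
    · rintro rfl
      linarith
    · rintro rfl
      linarith
  obtain ⟨m, hm⟩ := hsup t htI
  have hev := hm.and (Ioo_mem_nhds htI.1 htI.2)
  obtain ⟨s₁, ⟨hs₁, hI₁⟩, hlt₁⟩ :=
    ((hev.filter_mono (nhdsWithin_le_nhds (s := Iio t))).and self_mem_nhdsWithin).exists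
  obtain ⟨s₂, ⟨hs₂, hI₂⟩, hlt₂⟩ :=
    ((hev.filter_mono (nhdsWithin_le_nhds (s := Ioi t))).and self_mem_nhdsWithin).exists
  have hlt₁ : s₁ < t := hlt₁
  have hlt₂ : t < s₂ := hlt₂
  have m₂ := htmin s₂ ⟨hI₂.1.le, hI₂.2.le⟩
  have hm0 : 0 ≤ m := by
    by_contra! h
    nlinarith
  have hks : k s₁ ≤ k t := by nlinarith
  exact hlt₁.not_ge (hleast ⟨⟨hI₁.1.le, hI₁.2.le⟩, hks.trans htle⟩)

namespace Presentation

variable {d : ℕ} {ι : Type} (Q : Presentation d ι)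

/-- The source images for the `i`-th facet. -/
def images (v : Ambient d) (i : ι) : Set (Ambient d) :=
  {ν | ∃ Γ D, Q.Geo v Γ D ∧ Γ D ∈ Q.facet i ∧ Q.Regular (Γ D) ∧ Q.Good Γ D i ν}

variable {Q} {i j k : ι} {v x y z w a b p q ν ν' : Ambient d} {Γ Γ' : ℝ → Ambient d} {D D' r s : ℝ}

lemma dist_lineMap_sq (x w ν : Ambient d) (t : ℝ) :
    dist (AffineMap.lineMap x w t) ν ^ 2 =
      dist x ν ^ 2 + 2 * t * inner ℝ (x - ν) (w - x) + t ^ 2 * dist w x ^ 2 := by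
  have : (AffineMap.lineMap x w t : Ambient d) - ν = (x - ν) + t • (w - x) := by
    rw [AffineMap.lineMap_apply, vsub_eq_sub, vadd_eq_add]
    abel
  rw [dist_eq_norm, this, norm_add_sq_real, inner_smul_right, norm_smul, mul_pow,
    Real.norm_eq_abs, sq_abs, dist_eq_norm, dist_eq_norm]
  ring

lemma Regular.lineMap (hx : Q.Regular x) (hxi : x ∈ Q.carrier) (hw : w ∈ Q.carrier) {t : ℝ}
    (h0 : 0 ≤ t) (h1 : t < 1) : Q.Regular (AffineMap.lineMap x w t) := by
  have key : ∀ k, Q.slack k (AffineMap.lineMap x w t) = 0 → Q.slack k x = 0 := by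
    intro k hk
    rw [slack_lineMap] at hk
    have a := mul_nonneg h0 (hw k)
    have b := hxi k
    nlinarith
  exact fun k l m hk hl hm => hx k l m (key k hk) (key l hl) (key m hm)

lemma lineMap_mem_facet (hx : x ∈ Q.facet i) (hw : w ∈ Q.facet i) {t : ℝ} (ht : t ∈ Icc 0 1) :
    AffineMap.lineMap x w t ∈ Q.facet i := convex_facet.lineMap_mem hx hw ht

/-- Comparison with the unfolded distance, and the case of equality. -/
lemma idist_le_of_good [Fintype ι] (hv : Q.Source v) (hG : Q.Geo v Γ D) (hxi : Γ D ∈ Q.facet i)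
    (hx : Q.Regular (Γ D)) (hg : Q.Good Γ D i ν) (hwi : w ∈ Q.facet i) (hw : Q.Regular w) :
    Q.idist w v ≤ ENNReal.ofReal (dist w ν) ∧
      (ENNReal.ofReal (dist w ν) ≤ Q.idist w v →
        ∃ Γ' D', Q.Geo v Γ' D' ∧ Γ' D' = w ∧ Q.Good Γ' D' i ν) := by
  set x := Γ D with hxdef
  have hDI : D ∈ Icc 0 D := ⟨hG.nonneg, le_rfl⟩
  let y : ℝ → Ambient d := fun t => AffineMap.lineMap x w t
  have hyc : Continuous y := AffineMap.lineMap_continuous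
  have hy0 : y 0 = x := AffineMap.lineMap_apply_zero _ _
  have hy1 : y 1 = w := AffineMap.lineMap_apply_one _ _
  have hyi : ∀ t ∈ Icc (0 : ℝ) 1, y t ∈ Q.facet i := fun t ht => lineMap_mem_facet hxi hwi ht
  have hyr : ∀ t ∈ Icc (0 : ℝ) 1, Q.Regular (y t) := by
    intro t ht
    rcases ht.2.eq_or_lt with rfl | h
    · rwa [hy1]
    · exact hx.lineMap hxi.1 hwi.1 ht.1 h
  have hxfin : Q.idist x v ≠ ∞ := by
    rw [hG.idist_start hDI]
    exact ENNReal.ofReal_ne_top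
  have htri : ∀ a ∈ Q.facet i, ∀ b ∈ Q.facet i,
      Q.idist a v ≤ ENNReal.ofReal (dist a b) + Q.idist b v := fun a ha b hb => by
    rw [← idist_facet ha hb]
    exact intrinsicDist_triangle
  have hfin : ∀ a ∈ Q.facet i, Q.idist a v ≠ ∞ := fun a ha =>
    ne_top_of_le_ne_top (ENNReal.add_ne_top.2 ⟨ENNReal.ofReal_ne_top, hxfin⟩) (htri a ha x hxi)
  let f : ℝ → ℝ := fun t => (Q.idist (y t) v).toReal
  have hf : ∀ t ∈ Icc (0 : ℝ) 1, Q.idist (y t) v = ENNReal.ofReal (f t) := fun t ht =>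
    (ENNReal.ofReal_toReal (hfin _ (hyi t ht))).symm
  have hf0 : ∀ t, 0 ≤ f t := fun t => ENNReal.toReal_nonneg
  have hfle : ∀ s ∈ Icc (0 : ℝ) 1, ∀ t ∈ Icc (0 : ℝ) 1, f s ≤ dist (y s) (y t) + f t := by
    intro s hs t ht
    have := htri _ (hyi s hs) _ (hyi t ht)
    rw [hf s hs, hf t ht, ← ENNReal.ofReal_add dist_nonneg (hf0 t)] at this
    exact (ENNReal.ofReal_le_ofReal_iff (add_nonneg dist_nonneg (hf0 t))).1 this
  have hfc : ContinuousOn f (Icc 0 1) := by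
    intro t ht
    rw [ContinuousWithinAt, tendsto_iff_dist_tendsto_zero]
    have h1 : Filter.Tendsto (fun s => dist (y s) (y t)) (nhdsWithin t (Icc 0 1)) (nhds 0) := by
      rw [← tendsto_iff_dist_tendsto_zero]
      exact hyc.continuousWithinAt
    refine squeeze_zero' (Filter.Eventually.of_forall fun _ => dist_nonneg) ?_ h1
    filter_upwards [self_mem_nhdsWithin] with s hs
    rw [Real.dist_eq, abs_le]
    have a := hfle s hs t ht
    have b := hfle t ht s hs
    rw [dist_comm] at b
    constructor <;> linarith
  have hsupp : ∀ (Γ' : ℝ → Ambient d) (D' : ℝ) (ν' : Ambient d) (t : ℝ), t ∈ Icc (0 : ℝ) 1 →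
      Q.Geo v Γ' D' → Γ' D' = y t → Q.Good Γ' D' i ν' → f t = dist (y t) ν' ∧
        ∀ᶠ s in nhds t, s ∈ Icc (0 : ℝ) 1 →
          Q.Dev v (Fintype.card ι) i (y s) ν' ∧ f s ≤ dist (y s) ν' := by
    intro Γ' D' ν' t ht hG' he hg'
    have hD' : D' ∈ Icc 0 D' := ⟨hG'.nonneg, le_rfl⟩
    have hreg := hG'.regular hv.regular (by rw [he]; exact hyr t ht)
    have hmem : Γ' D' ∈ Q.facet i := by rw [he]; exact hyi t ht
    have h1 := ((hG'.good_spec hreg hg').2 D' hD' hmem).1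
    have h2 := hG'.idist_start hD'
    rw [he] at h1 h2
    rw [hf t ht, ENNReal.ofReal_eq_ofReal_iff (hf0 t) hG'.nonneg] at h2
    refine ⟨h2.trans h1.symm, ?_⟩
    have h3 := hG'.dev_eventually hreg hg' hD' hmem
    rw [he] at h3
    filter_upwards [hyc.continuousAt.eventually h3] with s hs hsI
    have h4 := (hs (hyi s hsI)).mono (Finset.card_le_univ _)
    refine ⟨h4, ?_⟩
    have h5 := h4.idist_le
    rw [hf s hsI] at h5
    exact (ENNReal.ofReal_le_ofReal_iff dist_nonneg).1 h5
  -- Squares are compared because the terms quadratic in `t` cancel, which makes the supports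
  -- affine.
  let h : ℝ → ℝ := fun t => f t ^ 2 - dist (y t) ν ^ 2
  have hhc : ContinuousOn h (Icc 0 1) :=
    (hfc.pow 2).sub ((hyc.dist continuous_const).pow 2).continuousOn
  have hhs : ∀ t ∈ Icc (0 : ℝ) 1, ∃ m : ℝ, ∀ᶠ s in nhds t, s ∈ Icc (0 : ℝ) 1 →
      h s ≤ h t + m * (s - t) := by
    intro t ht
    obtain ⟨Γ', D', hG', he⟩ := Presentation.exists_geo hv.exists_facet (hfin _ (hyi t ht))
    have hD' : D' ∈ Icc 0 D' := ⟨hG'.nonneg, le_rfl⟩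
    obtain ⟨ν', hν'⟩ := hG'.exists_good (i := i) hD' (by rw [he]; exact hyi t ht)
    obtain ⟨e1, e2⟩ := hsupp Γ' D' ν' t ht hG' he hν'
    refine ⟨2 * inner ℝ (x - ν') (w - x) - 2 * inner ℝ (x - ν) (w - x), ?_⟩
    filter_upwards [e2] with s hs hsI
    have h1 := pow_le_pow_left₀ (hf0 s) (hs hsI).2 2
    simp only [h, e1]
    simp only [y, dist_lineMap_sq] at h1 ⊢
    linarith
  obtain ⟨e1, e2⟩ := hsupp Γ D ν 0 ⟨le_rfl, zero_le_one⟩ hG (by rw [hy0]) hg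
  have hh0 : h 0 = 0 := by simp only [h, e1, sub_self]
  have hle : ∀ t ∈ Icc (0 : ℝ) 1, h t ≤ 0 := by
    by_contra! hne
    obtain ⟨c, hc, hpos⟩ := hne
    have hc0 : 0 < c := hc.1.lt_of_ne fun e => by
      rw [← e, hh0] at hpos
      exact lt_irrefl _ hpos
    -- If `h c > 0`, the minimum principle puts `h` above the chord from `(0, 0)` to `(c, h c)`. But
    -- `h ≤ 0` just after 0, since the unfolding with image `ν` persists near `x`.
    have hk := nonneg_of_affine_support (k := fun t => h t - h c / c * t) (c := c)
      ((hhc.mono (Icc_subset_Icc_right hc.2)).sub (by fun_prop)) (by simp [hh0])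
      (by simp [hc0.ne']) (by
        intro t ht
        obtain ⟨m, hm⟩ := hhs t ⟨ht.1.le, ht.2.le.trans hc.2⟩
        refine ⟨m - h c / c, ?_⟩
        filter_upwards [hm, Ioo_mem_nhds ht.1 ht.2] with s hs hsI
        have := hs ⟨hsI.1.le, hsI.2.le.trans hc.2⟩
        linarith)
    obtain ⟨s, hs, hs0, hsc⟩ := ((e2.filter_mono nhdsWithin_le_nhds).and
      (Ioo_mem_nhdsGT hc0)).exists
    have hsI : s ∈ Icc (0 : ℝ) 1 := ⟨hs0.le, hsc.le.trans hc.2⟩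
    have h1 := hk s ⟨hs0.le, hsc.le⟩
    have h2 := pow_le_pow_left₀ (hf0 s) (hs hsI).2 2
    have h3 : 0 < h c / c * s := by positivity
    simp only [h] at h1 h3
    linarith
  have hI1 : (1 : ℝ) ∈ Icc (0 : ℝ) 1 := ⟨zero_le_one, le_rfl⟩
  have hcomp : ∀ t ∈ Icc (0 : ℝ) 1, f t ≤ dist (y t) ν := by
    intro t ht
    have := hle t ht
    simp only [h, sub_nonpos] at this
    exact (pow_le_pow_iff_left₀ (hf0 t) dist_nonneg two_ne_zero).1 this
  constructor
  · have := hcomp 1 hI1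
    rw [← hy1, hf 1 hI1]
    exact ENNReal.ofReal_le_ofReal this
  · intro hge
    rw [← hy1, hf 1 hI1, ENNReal.ofReal_le_ofReal_iff (hf0 1)] at hge
    have hnn := nonneg_of_affine_support hhc hh0.ge
      (sub_nonneg.2 (pow_le_pow_left₀ dist_nonneg hge 2)) (by
        intro t ht
        obtain ⟨m, hm⟩ := hhs t ⟨ht.1.le, ht.2.le⟩
        refine ⟨m, ?_⟩
        filter_upwards [hm, Ioo_mem_nhds ht.1 ht.2] with s hs hsI
        exact hs ⟨hsI.1.le, hsI.2.le⟩)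
    have hdist : ∀ t ∈ Icc (0 : ℝ) 1, ENNReal.ofReal (dist (y t) ν) ≤ Q.idist (y t) v := by
      intro t ht
      rw [hf t ht]
      refine ENNReal.ofReal_le_ofReal ?_
      have := hnn t ht
      simp only [h, sub_nonneg] at this
      exact (pow_le_pow_iff_left₀ dist_nonneg (hf0 t) two_ne_zero).1 this
    -- Continuation along the segment: wherever the unfolding exists, equality of distances makes it
    -- come from a shortest path, so it persists a little further.
    have hsub : Icc (0 : ℝ) 1 ⊆ {t | Q.Dev v (Fintype.card ι) i (y t) ν} := by
      refine IsClosed.Icc_subset_of_forall_mem_nhdsWithin ?_ ?_ ?_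
      · exact ((isClosed_dev v _ i ν).preimage hyc).inter isClosed_Icc
      · exact (e2.self_of_nhds ⟨le_rfl, zero_le_one⟩).1
      · rintro t ⟨htA, ht⟩
        have htI : t ∈ Icc (0 : ℝ) 1 := ⟨ht.1, ht.2.le⟩
        obtain ⟨Γ', D', hG', he, hg'⟩ := Dev.exists_good hv htA (hyr t htI) (hdist t htI)
        obtain ⟨-, e4⟩ := hsupp Γ' D' ν t htI hG' he hg'
        filter_upwards [e4.filter_mono nhdsWithin_le_nhds, Ioo_mem_nhdsGT ht.2] with s hs hsI
        exact (hs ⟨ht.1.trans hsI.1.le, hsI.2.le⟩).1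
    have hd1 : Q.Dev v (Fintype.card ι) i (y 1) ν := hsub hI1
    have := Dev.exists_good hv hd1 (hyr 1 hI1) (hdist 1 hI1)
    rwa [hy1] at this

lemma finite_images [Fintype ι] (hv : Q.Source v) : (Q.images v i).Finite := by
  refine (finite_dev (Q := Q) v (Fintype.card ι) i).subset ?_
  rintro ν ⟨Γ, D, hG, hi, hr, hg⟩
  exact ⟨_, hG.dev_of_good (hG.regular hv.regular hr) hg ⟨hG.nonneg, le_rfl⟩ hi⟩

lemma slack_of_mem_images [Fintype ι] (hv : Q.Source v) (h : ν ∈ Q.images v i) :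
    Q.slack i ν = 0 := by
  obtain ⟨Γ, D, hG, hi, hr, hg⟩ := h
  exact (hG.good_spec (hG.regular hv.regular hr) hg).1

/-- The cut points among the regular points of a facet are those with two nearest images. -/
lemma mem_cutPoints_iff [Fintype ι] (hv : Q.Source v) (hwi : w ∈ Q.facet i) (hw : Q.Regular w) :
    w ∈ cutPoints Q.carrier v ↔ ∃ ν₁ ∈ Q.images v i, ∃ ν₂ ∈ Q.images v i, ν₁ ≠ ν₂ ∧
      ∀ ν' ∈ Q.images v i, dist w ν₁ ≤ dist w ν' ∧ dist w ν₂ ≤ dist w ν' := by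
  have hgeo : ∀ Γ D, Q.Geo v Γ D → Γ D = w → ∃ ν ∈ Q.images v i, Q.Good Γ D i ν ∧
      dist w ν = D ∧ ∀ ν' ∈ Q.images v i, dist w ν ≤ dist w ν' := by
    intro Γ D hG he
    have hD : D ∈ Icc 0 D := ⟨hG.nonneg, le_rfl⟩
    have hi : Γ D ∈ Q.facet i := by rwa [he]
    have hr : Q.Regular (Γ D) := by rwa [he]
    obtain ⟨ν, hν⟩ := hG.exists_good hD hi
    have h1 := ((hG.good_spec (hG.regular hv.regular hr) hν).2 D hD hi).1
    rw [he] at h1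
    refine ⟨ν, ⟨Γ, D, hG, hi, hr, hν⟩, hν, h1, ?_⟩
    rintro ν' ⟨Γ', D', hG', hi', hr', hg'⟩
    have h2 := (idist_le_of_good hv hG' hi' hr' hg' hwi hw).1
    have h3 := hG.idist_start hD
    rw [he] at h3
    rw [h3] at h2
    rw [h1]
    exact (ENNReal.ofReal_le_ofReal_iff dist_nonneg).1 h2
  have huniq : ∀ Γ Γ' D D', Q.Geo v Γ D → Γ D = w → Q.Geo v Γ' D' → Γ' D' = w → D = D' := by
    intro Γ Γ' D D' hG he hG' he'
    have h1 := hG.idist_start ⟨hG.nonneg, le_rfl⟩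
    have h2 := hG'.idist_start ⟨hG'.nonneg, le_rfl⟩
    rw [he] at h1
    rw [he', h1] at h2
    exact (ENNReal.ofReal_eq_ofReal_iff hG.nonneg hG'.nonneg).1 h2
  constructor
  · rintro ⟨-, γ₁, γ₂, hγ₁, hγ₂, hne⟩
    obtain ⟨Γ₁, D₁, -, hG₁, he₁, hr₁, -⟩ := exists_geo_of_path hγ₁
    obtain ⟨Γ₂, D₂, -, hG₂, he₂, hr₂, -⟩ := exists_geo_of_path hγ₂
    obtain rfl := huniq _ _ _ _ hG₁ he₁ hG₂ he₂
    obtain ⟨ν₁, m₁, g₁, -, n₁⟩ := hgeo _ _ hG₁ he₁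
    obtain ⟨ν₂, m₂, g₂, -, n₂⟩ := hgeo _ _ hG₂ he₂
    refine ⟨ν₁, m₁, ν₂, m₂, ?_, fun ν' h => ⟨n₁ ν' h, n₂ ν' h⟩⟩
    rintro rfl
    refine hne ?_
    rw [hr₁, hr₂]
    refine image_congr ?_
    exact hG₁.eqOn_of_good hG₂ (hG₁.regular hv.regular (by rwa [he₁]))
      (hG₂.regular hv.regular (by rwa [he₂])) g₁ g₂ hG₁.nonneg le_rfl le_rfl
      (he₁.trans he₂.symm) (by rwa [he₁])
  · rintro ⟨ν₁, m₁, ν₂, m₂, hne, hmin⟩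
    obtain ⟨Γ₀, D₀, hG₀, he₀⟩ : ∃ Γ D, Q.Geo v Γ D ∧ Γ D = w := by
      refine Presentation.exists_geo hv.exists_facet ?_
      obtain ⟨Γ, D, hG, hi, hr, hg⟩ := m₁
      exact ne_top_of_le_ne_top ENNReal.ofReal_ne_top (idist_le_of_good hv hG hi hr hg hwi hw).1
    obtain ⟨ν₀, m₀, -, d₀, -⟩ := hgeo _ _ hG₀ he₀
    have h₀ := hG₀.idist_start ⟨hG₀.nonneg, le_rfl⟩
    rw [he₀] at h₀
    -- A nearest image attains the intrinsic distance, so the equality case of the comparison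
    -- produces a shortest path with that image.
    have hex : ∀ ν ∈ Q.images v i, dist w ν ≤ dist w ν₀ →
        ∃ Γ D, Q.Geo v Γ D ∧ Γ D = w ∧ Q.Good Γ D i ν := by
      rintro ν ⟨Γ, D, hG, hi, hr, hg⟩ hle
      refine (idist_le_of_good hv hG hi hr hg hwi hw).2 ?_
      rw [h₀]
      exact ENNReal.ofReal_le_ofReal (hle.trans_eq d₀)
    obtain ⟨Γ₁, D₁, hG₁, he₁, g₁⟩ := hex ν₁ m₁ (hmin ν₀ m₀).1
    obtain ⟨Γ₂, D₂, hG₂, he₂, g₂⟩ := hex ν₂ m₂ (hmin ν₀ m₀).2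
    obtain rfl := huniq _ _ _ _ hG₁ he₁ hG₂ he₂
    obtain ⟨γ₁, hγ₁, hr₁⟩ := hG₁.exists_path
    obtain ⟨γ₂, hγ₂, hr₂⟩ := hG₂.exists_path
    have hrange : range γ₁ ≠ range γ₂ := by
      intro hrr
      rw [hr₁, hr₂] at hrr
      -- The parameter is the intrinsic distance to `v`, so paths with the same range agree
      -- pointwise, and then their images agree.
      have heq : ∀ r ∈ Icc 0 D₁, Γ₁ r = Γ₂ r := by
        intro r hr
        obtain ⟨s, hs, hsr⟩ : Γ₁ r ∈ Γ₂ '' Icc 0 D₁ := hrr ▸ mem_image_of_mem _ hr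
        have e1 := hG₁.idist_start hr
        have e2 := hG₂.idist_start hs
        rw [hsr, e1, ENNReal.ofReal_eq_ofReal_iff hr.1 hs.1] at e2
        rw [e2, hsr, ← e2]
      exact hne (Geo.good_unique (hG₂.regular hv.regular (by rwa [he₂]))
        (g₁.congr le_rfl (fun r hr => (heq r hr).symm) hG₁.nonneg) g₂)
    refine ⟨facet_subset_frontier hwi, ?_⟩
    have : ∀ u, u = w → ∀ γ : Path u v, IsShortestPath (frontier Q.carrier) γ →
        ∃ γ' : Path w v, IsShortestPath (frontier Q.carrier) γ' ∧ range γ' = range γ := by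
      rintro u rfl γ hγ
      exact ⟨γ, hγ, rfl⟩
    obtain ⟨γ₁', h₁', e₁'⟩ := this _ he₁ γ₁ hγ₁
    obtain ⟨γ₂', h₂', e₂'⟩ := this _ he₂ γ₂ hγ₂
    exact ⟨γ₁', γ₂', h₁', h₂', by rwa [e₁', e₂']⟩

end Presentation

/-! ### Sequential unfolding along facet lists -/

lemma eq_lineMap_of_wbtw {E : Type*} [NormedAddCommGroup E] [NormedSpace ℝ E] {a b c : E}
    (h : Wbtw ℝ a b c) : b = AffineMap.lineMap c a (dist b c / dist a c) := by
  obtain ⟨t, ht, rfl⟩ := h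
  rw [dist_lineMap_right, Real.norm_eq_abs, abs_of_nonneg (sub_nonneg.2 ht.2)]
  rcases eq_or_ne a c with rfl | hne
  · simp
  · rw [mul_div_assoc, div_self (dist_ne_zero.2 hne), mul_one, AffineMap.lineMap_apply_one_sub]

namespace Presentation

variable {d : ℕ} {ι : Type} {Q : Presentation d ι} {i j : ι} {v x y z ν ν₀ : Ambient d}
  {Γ : ℝ → Ambient d} {D r s : ℝ}

lemma foldingMap_symm_eq_refl [Finite ι] {Φ : Ambient d ≃ᵃⁱ[ℝ] Ambient d}
    (hΦ : IsFoldingMap Q.carrier (Q.facet i) (Q.facet j) Φ) (hi : z ∈ Q.facet i)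
    (hj : z ∈ Q.facet j) (hreg : Q.Regular z) (hy : Q.slack j y = 0) :
    Φ.symm y = Q.refl i j y := by
  have hu := normal_add_ne_zero hi.2 hj.2 (ne_of_isRidge hΦ.ridge)
  rw [Φ.symm_apply_eq, foldingMap_eq_refl hΦ hi.1 hi.2 hj.2 hreg
    (by rw [slack_refl' hu, hy, neg_zero]), refl_refl]

/-- Unfolding along a list of facets that a shortest path traverses straightens the path. -/
lemma Geo.unfold_spec [Fintype ι] (h : Q.Geo v Γ D) (hv : Q.Source v)
    (hreg : ∀ r ∈ Icc 0 D, Q.Regular (Γ r)) (L : FacetList Q.carrier) (idx : ℕ → ι) (r : ℕ → ℝ)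
    (hidx : ∀ l ≤ L.len, L.facet l = Q.facet (idx l)) (hr : ∀ l, r l ∈ Icc 0 D)
    (hcross : ∀ l < L.len, Γ (r (l + 1)) ∈ Q.facet (idx l) ∧ Γ (r (l + 1)) ∈ Q.facet (idx (l + 1)))
    (hD : Γ D ∈ Q.facet (idx 0)) (hg : Q.Good Γ D (idx 0) ν₀) :
    ∀ l ≤ L.len, ∃ (e : Ambient d ≃ᵃⁱ[ℝ] Ambient d) (ν : Ambient d), (∀ y, L.unfold l y = e y) ∧
      Q.Good Γ D (idx l) ν ∧ e ν = ν₀ ∧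
      ∀ s ∈ Icc 0 D, Γ s ∈ Q.facet (idx l) → e (Γ s) = AffineMap.lineMap ν₀ (Γ D) (s / D) := by
  intro l
  induction l with
  | zero =>
    intro _
    refine ⟨AffineIsometryEquiv.refl ℝ _, ν₀, fun y => rfl, hg, rfl, fun s hs hsi => ?_⟩
    obtain ⟨hDν, hw⟩ := (h.good_spec hreg hg).2 D ⟨h.nonneg, le_rfl⟩ hD
    have := eq_lineMap_of_wbtw (hw s hs hsi)
    rwa [((h.good_spec hreg hg).2 s hs hsi).1, hDν] at this
  | succ l ih =>
    intro hl
    obtain ⟨e, ν, he, hν, heν, hspec⟩ := ih (by omega)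
    obtain ⟨hpi, hpj⟩ := hcross l (by omega)
    have hfold := L.isFold l (by omega)
    rw [hidx l (by omega), hidx (l + 1) hl] at hfold
    have hij := ne_of_isRidge hfold.ridge
    have hρ := hr (l + 1)
    set ρ := r (l + 1)
    have hsymm : ∀ y, Q.slack (idx (l + 1)) y = 0 →
        (L.fold l).symm y = Q.refl (idx l) (idx (l + 1)) y := fun y hy =>
      foldingMap_symm_eq_refl hfold hpi hpj (hreg _ hρ) hy
    have hg' := h.good_transfer hv hreg hρ hij hpi hpj hν
    obtain ⟨hsl, hsp⟩ := h.good_spec hreg hg'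
    set ν' := Q.refl (idx l) (idx (l + 1)) ν
    let e' := (L.fold l).symm.trans e
    have he' : ∀ y, e' y = e ((L.fold l).symm y) := fun y => rfl
    have hν' : e' ν' = ν₀ := by rw [he', hsymm _ hsl, refl_refl, heν]
    have hp : e' (Γ ρ) = AffineMap.lineMap ν₀ (Γ D) (ρ / D) := by
      rw [he', hsymm _ hpj.2, refl_of_tight hpi.2 hpj.2, hspec _ hρ hpi]
    -- The crossing time is positive because the source lies on only one facet.
    have hρ0 : 0 < ρ := hρ.1.lt_of_ne fun h0 => by
      rw [← h0, h.zero] at hpi hpj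
      exact hij (hv.eq hpi hpj)
    have hD0 : 0 < D := hρ0.trans_le hρ.2
    refine ⟨e', ν', fun y => he _, hg', hν', fun s hs hsj => ?_⟩
    have hmap : ∀ {a b : Ambient d}, Wbtw ℝ a b ν' → e' b =
        AffineMap.lineMap ν₀ (e' a) (dist b ν' / dist a ν') := by
      intro a b hw
      conv_lhs => rw [eq_lineMap_of_wbtw hw]
      rw [← hν']
      exact e'.toAffineEquiv.toAffineMap.apply_lineMap _ _ _
    -- `e'` is affine and known at the image and at the crossing point `Γ ρ`. This fixes it on the
    -- part of the segment before `ρ`, and by rescaling on the part after.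
    rcases le_total s ρ with hle | hle
    · have := hmap ((hsp ρ hρ hpj).2 s ⟨hs.1, hle⟩ hsj)
      rw [this, (hsp ρ hρ hpj).1, (hsp s hs hsj).1, hp, AffineMap.lineMap_lineMap_right]
      congr 1
      field_simp
    · have hs0 := hρ0.trans_le hle
      have := hmap ((hsp s hs hsj).2 ρ ⟨hρ.1, hle⟩ hpj)
      rw [(hsp ρ hρ hpj).1, (hsp s hs hsj).1, hp] at this
      have e1 := congrArg (fun q => AffineMap.lineMap ν₀ q (s / ρ)) this
      simp only [AffineMap.lineMap_lineMap_right] at e1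
      rw [show s / ρ * (ρ / D) = s / D by field_simp, show s / ρ * (ρ / s) = 1 by field_simp,
        AffineMap.lineMap_apply_one] at e1
      exact e1.symm

/-- The list of facets that `Γ` traverses on `[0, r]`, with the crossing times. -/
lemma Good.exists_list [Finite ι] (h : Q.Geo v Γ D) (hg : Q.Good Γ D i ν) (hr : r ∈ Icc 0 D)
    (hi : Γ r ∈ Q.facet i) : ∃ (n : ℕ) (idx : ℕ → ι) (ρ : ℕ → ℝ), idx 0 = i ∧ ρ 0 = r ∧
      ρ (n + 1) = 0 ∧ Antitone ρ ∧ (∀ l, 0 ≤ ρ l) ∧ (∀ l < n, idx l ≠ idx (l + 1)) ∧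
      ∀ l ≤ n, ∀ s ∈ Icc (ρ (l + 1)) (ρ l), Γ s ∈ Q.facet (idx l) := by
  induction hg generalizing r with
  | @base i h0 =>
    refine ⟨0, fun _ => i, fun l => if l = 0 then r else 0, rfl, rfl, rfl, ?_, ?_, by simp, ?_⟩
    · refine antitone_nat_of_succ_le fun l => ?_
      rcases l with _ | l
      · simpa using hr.1
      · simp
    · intro l
      dsimp only
      split_ifs
      exacts [hr.1, le_rfl]
    · intro l hl s hs
      obtain rfl : l = 0 := by omega
      simp only [zero_add, one_ne_zero, if_false, if_true] at hs
      exact h.mem_facet le_rfl hs.1 hs.2 hr.2 h0 hi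
  | @step i j r₀ s₀ ν hr₀ hi₀ hmin hj₀ hs₀ hsr hsj _ ih =>
    obtain ⟨n, idx, ρ, hidx, hρ0, hρn, hanti, hnn, hne, hmem⟩ := ih hr₀ hj₀
    have hle : r₀ ≤ r := not_lt.1 fun hlt => hmin r hr.1 hlt hi
    refine ⟨n + 1, fun l => l.casesOn i idx, fun l => l.casesOn r ρ, rfl, rfl, hρn, ?_, ?_, ?_, ?_⟩
    · refine antitone_nat_of_succ_le fun l => ?_
      rcases l with _ | l
      · exact hρ0.trans_le hle
      · exact hanti l.le_succ
    · rintro (_ | l)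
      exacts [hr.1, hnn l]
    · rintro (_ | l) hl
      · exact fun e => ne_of_first hmin hs₀ hsr hsj (e.trans hidx)
      · exact hne l (by omega)
    · rintro (_ | l) hl s hs
      · have hs' : s ∈ Icc r₀ r := hρ0 ▸ hs
        exact h.mem_facet hr₀.1 hs'.1 hs'.2 hr.2 hi₀ hi
      · exact hmem l (by omega) s hs

/-- The source images in the sense of sequential unfoldings are the images under unfolding. -/
theorem sourceImages_eq [Fintype ι] (hv : Q.Source v) :
    sourceImages Q.carrier v (Q.facet i) = Q.images v i := by
  apply Subset.antisymm
  · rintro ν ⟨x, hx, hw, γ, hγ, L, hL0, ⟨t, ht, ht0, ht1, hmem⟩, hseq⟩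
    obtain ⟨Γ, D, ρ, hG, hΓD, hrange, hanti, hρ0, hρ1, hρ, hγρ, hsurj⟩ := exists_geo_of_path hγ
    have hxreg := regular_of_not_isWarped hx.1 hw
    rw [← hΓD] at hx hxreg
    have hreg := hG.regular hv.regular hxreg
    have hfac : ∀ l, ∃ k, l ≤ L.len → L.facet l = Q.facet k := by
      intro l
      by_cases hl : l ≤ L.len
      · obtain ⟨k, hk⟩ := exists_eq_facet (L.isFacet l hl)
        exact ⟨k, fun _ => hk⟩
      · exact ⟨i, fun h => absurd h hl⟩
    choose idx hidx using hfac
    obtain rfl : i = idx 0 := facet_injective (hL0.symm.trans (hidx 0 (Nat.zero_le _)))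
    obtain ⟨ν₀, hν₀⟩ := hG.exists_good ⟨hG.nonneg, le_rfl⟩ hx
    have hspec := hG.unfold_spec hv hreg L idx (fun l => ρ (t l)) hidx (fun l => hρ _)
      (fun l hl => by
        constructor
        · rw [← hidx l hl.le, ← hγρ]
          exact hmem l hl.le _ ⟨ht l.le_succ, le_rfl⟩
        · rw [← hidx (l + 1) hl, ← hγρ]
          exact hmem (l + 1) hl _ ⟨le_rfl, ht (l + 1).le_succ⟩) hx hν₀
    have h0 : Γ 0 ∈ Q.facet (idx L.len) := by
      rw [← hidx _ le_rfl, ← hρ1, ← hγρ, ← ht1]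
      exact hmem _ le_rfl _ ⟨ht L.len.le_succ, le_rfl⟩
    -- The list need not be the one that defines `ν₀`, but both unfoldings put the path on `[ν₀,
    -- x]`. Each of `ν`, `ν₀` lies between the other and `x`, so they coincide.
    have hmem₀ : ν₀ ∈ segment ℝ ν x := by
      rw [← hseq]
      obtain ⟨e, ν', he, -, -, hs⟩ := hspec L.len le_rfl
      refine mem_iUnion₂.2 ⟨L.len, mem_Iic.2 le_rfl, Γ 0, ⟨?_, ?_⟩, ?_⟩
      · rw [hrange]
        exact mem_image_of_mem _ ⟨le_rfl, hG.nonneg⟩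
      · rw [hidx _ le_rfl]
        exact h0
      · rw [he, hs 0 ⟨le_rfl, hG.nonneg⟩ h0, zero_div, AffineMap.lineMap_apply_zero]
    have hmemν : ν ∈ segment ℝ ν₀ x := by
      obtain ⟨l, hl, y, ⟨hy, hyl⟩, hyν⟩ := mem_iUnion₂.1 (hseq ▸ left_mem_segment ℝ ν x)
      obtain ⟨e, ν', he, -, -, hs⟩ := hspec l hl
      rw [hrange] at hy
      obtain ⟨s, hsD, rfl⟩ := hy
      rw [hidx l hl] at hyl
      rw [he, hs s hsD hyl, hΓD] at hyν
      rw [mem_segment_iff_wbtw]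
      exact ⟨s / D, ⟨div_nonneg hsD.1 hG.nonneg, div_le_one_of_le₀ hsD.2 hG.nonneg⟩, hyν⟩
    rw [mem_segment_iff_wbtw] at hmem₀ hmemν
    obtain rfl := (wbtw_swap_left_iff ℝ x).1 ⟨hmem₀, hmemν⟩
    exact ⟨Γ, D, hG, hx, hxreg, hν₀⟩
  · rintro ν ⟨Γ, D, hG, hx, hxreg, hν⟩
    have hreg := hG.regular hv.regular hxreg
    obtain ⟨γ, hγ, hrange⟩ := hG.exists_path
    obtain ⟨Γ', D', ρ, hG', hΓD', hrange', hanti, hρ0, hρ1, hρ, hγρ, hsurj⟩ :=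
      exists_geo_of_path hγ
    obtain rfl : D' = D := by
      have e1 := hG'.idist_start ⟨hG'.nonneg, le_rfl⟩
      rwa [hΓD', hG.idist_start ⟨hG.nonneg, le_rfl⟩,
        ENNReal.ofReal_eq_ofReal_iff hG.nonneg hG'.nonneg, eq_comm] at e1
    have hγΓ : ∀ s, γ s = Γ (ρ s) := by
      intro s
      obtain ⟨r, hr, hrs⟩ : γ s ∈ Γ '' Icc 0 D' := hrange ▸ mem_range_self s
      have e1 := hG.idist_start hr
      rw [hrs, hγρ, hG'.idist_start (hρ s), ENNReal.ofReal_eq_ofReal_iff (hρ s).1 hr.1] at e1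
      rw [e1, hrs]
    choose! g hg using hsurj
    obtain ⟨n, idx, r, rfl, hr0, hrn, hra, hrnn, hne, hmem⟩ :=
      hν.exists_list hG ⟨hG.nonneg, le_rfl⟩ hx
    have hrD : ∀ l, r l ∈ Icc 0 D' := fun l => ⟨hrnn l, hr0 ▸ hra (Nat.zero_le l)⟩
    have hcross : ∀ l < n, Γ (r (l + 1)) ∈ Q.facet (idx l) ∧
        Γ (r (l + 1)) ∈ Q.facet (idx (l + 1)) := fun l hl =>
      ⟨hmem l hl.le _ ⟨le_rfl, hra l.le_succ⟩, hmem (l + 1) hl _ ⟨hra (l + 1).le_succ, le_rfl⟩⟩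
    let L : FacetList Q.carrier :=
      { len := n
        facet := fun l => Q.facet (idx l)
        fold := fun l => Q.reflEquiv (idx l) (idx (l + 1))
        isFacet := fun l _ => isFacet_facet
        isFold := fun l hl => isFoldingMap_reflEquiv (hcross l hl).1.1 (hcross l hl).1.2
          (hcross l hl).2.2 (hne l hl) (hreg _ (hrD _)) }
    -- The two ends are set by hand: `g` is only a section of `ρ` and need not give the times 0 and
    -- 1 there.
    let t : ℕ → I := fun l => if l = 0 then 0 else if n + 1 ≤ l then 1 else g (r l)
    have hρt : ∀ l ≤ n + 1, ρ (t l) = r l := by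
      intro l hl
      dsimp only [t]
      split_ifs with h1 h2
      · rw [h1, hr0, hρ0]
      · rw [hρ1, ← hrn, le_antisymm hl h2]
      · exact hg _ (hrD l)
    have hgr : ∀ l l', l ≤ l' → g (r l) ≤ g (r l') := by
      intro l l' hl
      by_contra! hlt
      have h1 := hanti hlt.le
      rw [hg _ (hrD l), hg _ (hrD l')] at h1
      rw [le_antisymm h1 (hra hl)] at hlt
      exact lt_irrefl _ hlt
    have htmono : Monotone t := by
      intro l l' hl
      dsimp only [t]
      split_ifs <;>
        first
        | omega
        | exact le_rfl
        | exact unitInterval.nonneg'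
        | exact unitInterval.le_one'
        | exact hgr l l' hl
    have hspec := hG.unfold_spec hv hreg L idx r (fun l _ => rfl) hrD hcross hx hν
    refine ⟨Γ D', hx, hxreg.not_isWarped, γ, hγ, L, rfl, ⟨t, htmono, rfl, ?_, ?_⟩, ?_⟩
    · simp [t, L]
    · intro l (hl : l ≤ n) s hs
      rw [hγΓ]
      refine hmem l hl _ ⟨?_, ?_⟩
      · rw [← hρt (l + 1) (by omega)]
        exact hanti hs.2
      · rw [← hρt l (by omega)]
        exact hanti hs.1
    · apply Subset.antisymm
      · intro _ hmem'
        obtain ⟨l, hl, y, ⟨hy, hyl⟩, rfl⟩ := mem_iUnion₂.1 hmem'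
        clear hmem'
        obtain ⟨e, ν', he, -, -, hs⟩ := hspec l hl
        rw [hrange] at hy
        obtain ⟨s, hsD, rfl⟩ := hy
        rw [he, hs s hsD hyl, mem_segment_iff_wbtw]
        exact ⟨s / D', ⟨div_nonneg hsD.1 hG.nonneg, div_le_one_of_le₀ hsD.2 hG.nonneg⟩, rfl⟩
      · intro y hy
        rw [mem_segment_iff_wbtw] at hy
        obtain ⟨θ, hθ, rfl⟩ := hy
        have hθD : θ * D' ∈ Icc 0 D' :=
          ⟨mul_nonneg hθ.1 hG.nonneg, mul_le_of_le_one_left hG.nonneg hθ.2⟩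
        -- The first `l` with `r (l + 1) ≤ θ * D'` works; such an `l` exists because `r (n + 1) =
        -- 0`.
        have hex : ∃ l ≤ n, θ * D' ∈ Icc (r (l + 1)) (r l) := by
          have hP : ∃ l, r (l + 1) ≤ θ * D' := ⟨n, hrn.trans_le hθD.1⟩
          classical
          refine ⟨Nat.find hP, Nat.find_min' hP (hrn.trans_le hθD.1), Nat.find_spec hP, ?_⟩
          rcases hm : Nat.find hP with _ | m
          · exact hr0 ▸ hθD.2
          · exact (not_le.1 (Nat.find_min hP (m := m) (by omega))).le
        obtain ⟨l, hl, hls⟩ := hex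
        obtain ⟨e, ν', he, -, -, hs⟩ := hspec l hl
        refine mem_iUnion₂.2 ⟨l, hl, Γ (θ * D'), ⟨?_, hmem l hl _ hls⟩, ?_⟩
        · rw [hrange]
          exact mem_image_of_mem _ hθD
        · rw [he, hs _ hθD (hmem l hl _ hls)]
          rcases hG.nonneg.eq_or_lt with h0 | hpos
          · have := ((hG.good_spec hreg hν).2 D' ⟨hG.nonneg, le_rfl⟩ hx).1
            rw [← h0, dist_eq_zero] at this
            rw [← h0, this]
            simp
          · rw [mul_div_cancel_right₀ _ hpos.ne']

end Presentation

/-! ### Walls of the Voronoi diagram -/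

section Voronoi

variable {d : ℕ} {T : AffineSubspace ℝ (Ambient d)} {N : Set (Ambient d)} {z ν : Ambient d}

lemma dist_sq_sub_dist_sq {E : Type*} [NormedAddCommGroup E] [InnerProductSpace ℝ E]
    (z ν ν' : E) : dist z ν' ^ 2 - dist z ν ^ 2 =
      2 * ((‖ν'‖ ^ 2 - ‖ν‖ ^ 2) / 2 - inner ℝ (ν' - ν) z) := by
  rw [dist_eq_norm, dist_eq_norm, norm_sub_sq_real, norm_sub_sq_real, inner_sub_left,
    real_inner_comm z ν, real_inner_comm z ν']
  ring

lemma dist_le_dist_iff_inner {E : Type*} [NormedAddCommGroup E] [InnerProductSpace ℝ E]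
    {z ν ν' : E} : dist z ν ≤ dist z ν' ↔ inner ℝ (ν' - ν) z ≤ (‖ν'‖ ^ 2 - ‖ν‖ ^ 2) / 2 := by
  rw [← sq_le_sq₀ dist_nonneg dist_nonneg]
  have := dist_sq_sub_dist_sq z ν ν'
  constructor <;> intro h <;> linarith

lemma add_smul_mem_of_mem_direction {y : Ambient d} (hz : z ∈ T) (hy : y ∈ T.direction) (t : ℝ) :
    z + t • y ∈ T := by
  rw [add_comm z]
  exact AffineSubspace.vadd_mem_of_mem_direction (T.direction.smul_mem t hy) hz

/-- A point in two Voronoi cells lies on a wall of each of them. -/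
lemma mem_voronoiSkeleton_of_two_nearest (hN : N.Finite) (hNT : N ⊆ T)
    (hdim : Module.finrank ℝ T.direction = d) (hz : z ∈ T) {ν₂ : Ambient d} (h₁ : ν ∈ N)
    (h₂ : ν₂ ∈ N) (hne : ν ≠ ν₂) (hnear : ∀ ν' ∈ N, dist z ν ≤ dist z ν' ∧ dist z ν₂ ≤ dist z ν') :
    z ∈ voronoiSkeleton T N := by
  classical
  have : Finite {ν' // ν' ∈ N ∧ ν' ≠ ν} := (hN.subset fun _ h => h.1).to_subtype
  have := Fintype.ofFinite {ν' // ν' ∈ N ∧ ν' ≠ ν}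
  set a : {ν' // ν' ∈ N ∧ ν' ≠ ν} → Ambient d := fun ν' => ν' - ν with ha
  set b : {ν' // ν' ∈ N ∧ ν' ≠ ν} → ℝ := fun ν' => (‖(ν' : Ambient d)‖ ^ 2 - ‖ν‖ ^ 2) / 2 with hb
  have hcell : ∀ x, x ∈ voronoiCell T N ν ↔ x ∈ T ∧ ∀ i, inner ℝ (a i) x ≤ b i := by
    intro x
    refine and_congr_right fun _ => ⟨fun h i => dist_le_dist_iff_inner.1 (h i i.2.1), ?_⟩
    intro h ν' hν'
    by_cases e : ν' = ν
    · rw [e]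
    · exact dist_le_dist_iff_inner.2 (h ⟨ν', hν', e⟩)
  have hstrict : ∀ i, inner ℝ (a i) ν < b i := by
    intro i
    have h := dist_sq_sub_dist_sq ν ν i
    have h' : 0 < dist ν (i : Ambient d) := dist_pos.2 (Ne.symm i.2.2)
    rw [dist_self] at h
    have : 0 < dist ν (i : Ambient d) ^ 2 := by positivity
    simp only [ha, hb]
    linarith
  obtain ⟨J, hJ, hJc⟩ := exists_irredundant a b T.convex (hNT h₁) hstrict
  have hzc : z ∈ voronoiCell T N ν := ⟨hz, fun ν' h => (hnear ν' h).1⟩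
  -- Otherwise the segment from `ν` to `z` could be prolonged inside the cell. But the constraint of
  -- `ν₂` is strict at `ν` and tight at `z`, hence violated beyond `z`.
  have htight : ∃ j ∈ J, inner ℝ (a j) z = b j := by
    by_contra! hno
    have hlt : ∀ j ∈ J, inner ℝ (a j) z < b j := fun j hj =>
      (((hcell z).1 hzc).2 j).lt_of_ne (hno j hj)
    have hcont : ∀ j, Continuous fun t : ℝ => inner ℝ (a j) (AffineMap.lineMap ν z t) := fun j =>
      continuous_const.inner AffineMap.lineMap_continuous
    have hev : ∀ᶠ t in nhds (1 : ℝ), ∀ j ∈ J, inner ℝ (a j) (AffineMap.lineMap ν z t) < b j := by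
      rw [Filter.eventually_all_finset]
      intro j hj
      refine (hcont j).continuousAt.eventually_lt continuousAt_const ?_
      simpa using hlt j hj
    obtain ⟨t, ht, ht1⟩ := ((hev.filter_mono nhdsWithin_le_nhds).and
      (self_mem_nhdsWithin (s := Ioi 1))).exists
    have h3 := hJ _ (AffineMap.lineMap_mem t (hNT h₁) hz) (fun j hj => (ht j hj).le)
      ⟨ν₂, h₂, hne.symm⟩
    have h4 := hstrict ⟨ν₂, h₂, hne.symm⟩
    have h5 : inner ℝ (a ⟨ν₂, h₂, hne.symm⟩) z = b ⟨ν₂, h₂, hne.symm⟩ := by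
      have h := dist_sq_sub_dist_sq z ν ν₂
      rw [le_antisymm (hnear ν₂ h₂).1 (hnear ν h₁).2, sub_self] at h
      simp only [ha, hb]
      linarith
    rw [AffineMap.lineMap_apply_module', inner_add_right, inner_smul_right, inner_sub_right] at h3
    have ht1 : (1 : ℝ) < t := ht1
    nlinarith
  obtain ⟨j, hj, hzj⟩ := htight
  obtain ⟨c, hcT, hcj, hci⟩ := hJc j hj
  set G : Set (Ambient d) := {x | x ∈ voronoiCell T N ν ∧ inner ℝ (a j) x = b j} with hG
  -- Near the point `c` supplied by irredundancy only the `j`-th constraint matters, so the wall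
  -- fills the bisecting hyperplane within `T`.
  have hdir : (affineSpan ℝ G).direction = (Submodule.span ℝ {a j})ᗮ ⊓ T.direction := by
    apply le_antisymm
    · refine le_inf (direction_le_orthogonal ?_) (AffineSubspace.direction_le
        (affineSpan_le.2 fun x hx => hx.1.1))
      rintro _ rfl x hx y hy
      rw [inner_sub_right, hx.2, hy.2, sub_self]
    · rintro y ⟨hy, hyT⟩
      have hay : inner ℝ (a j) y = 0 := mem_orthogonal_span_iff.1 hy _ rfl
      have hmem : ∀ᶠ t in nhds (0 : ℝ), c + t • y ∈ G := by
        have hev : ∀ᶠ t in nhds (0 : ℝ), ∀ i ∈ J, i ≠ j → inner ℝ (a i) (c + t • y) < b i := by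
          rw [Filter.eventually_all_finset]
          intro i hi
          by_cases hij : i = j
          · simp [hij]
          · have hcont : Continuous fun t : ℝ => inner ℝ (a i) (c + t • y) := by fun_prop
            filter_upwards [hcont.continuousAt.eventually_lt continuousAt_const
              (by simpa using hci i hi hij)] with t ht _ using ht
        filter_upwards [hev] with t ht
        have hT := add_smul_mem_of_mem_direction hcT hyT t
        have hj' : inner ℝ (a j) (c + t • y) = b j := by
          rw [inner_add_right, inner_smul_right, hay, mul_zero, add_zero, hcj]
        refine ⟨(hcell _).2 ⟨hT, hJ _ hT fun i hi => ?_⟩, hj'⟩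
        by_cases hij : i = j
        · rw [hij, hj']
        · exact (ht i hi hij).le
      obtain ⟨t, ht, ht0⟩ := ((hmem.filter_mono nhdsWithin_le_nhds).and
        (self_mem_nhdsWithin (s := Ioi 0))).exists
      have hc : c ∈ G := by simpa using hmem.self_of_nhds
      have := AffineSubspace.vsub_mem_direction (subset_affineSpan ℝ G ht)
        (subset_affineSpan ℝ G hc)
      rw [vsub_eq_sub, add_sub_cancel_left] at this
      exact (Submodule.smul_mem_iff _ (ne_of_gt ht0)).1 this
  refine ⟨ν, h₁, G, Module.finrank ℝ ↥((Submodule.span ℝ {a j})ᗮ ⊓ T.direction), ?_,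
    ⟨⟨z, hzc, hzj⟩, fun _ => ⟨innerSL ℝ (a j), ?_⟩, by rw [hdir]⟩, hzc, hzj⟩
  · have hle : Submodule.span ℝ {a j} ≤ T.direction := by
      rw [Submodule.span_singleton_le_iff_mem]
      exact AffineSubspace.vsub_mem_direction (hNT j.2.1) (hNT h₁)
    have h := Submodule.finrank_add_inf_finrank_orthogonal hle
    rw [finrank_span_singleton (sub_ne_zero.2 j.2.2), hdim] at h
    omega
  · ext x
    simp only [hG, mem_ofPred_eq, innerSL_apply_apply]
    refine and_congr_right fun hx => ⟨fun e y hy => e ▸ ((hcell y).1 hy).2 j, fun h => ?_⟩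
    exact le_antisymm (((hcell x).1 hx).2 j) (hzj ▸ h z hzc)

/-- A point on a wall of a Voronoi cell lies in another Voronoi cell. -/
lemma exists_nearest_of_mem_face (hN : N.Finite) (hdim : Module.finrank ℝ T.direction = d)
    {G : Set (Ambient d)} {k : ℕ} (hk : k < d) (hG : IsFace (voronoiCell T N ν) G k)
    (hz : z ∈ G) : ∃ ν₂ ∈ N, ν ≠ ν₂ ∧ dist z ν₂ ≤ dist z ν := by
  by_contra! hno
  obtain ⟨l, rfl⟩ := hG.exists_functional
  have hzc := hz.1
  -- With `ν` strictly nearest, `z` is interior to the cell relative to `T`. The functional exposing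
  -- `G` is then constant on `T`, so `G` has dimension at least `d`.
  have hmem : ∀ y ∈ T.direction, ∀ᶠ t in nhds (0 : ℝ), z + t • y ∈ voronoiCell T N ν := by
    intro y hy
    have hev : ∀ᶠ t in nhds (0 : ℝ), ∀ ν' ∈ N, dist (z + t • y) ν ≤ dist (z + t • y) ν' := by
      rw [Filter.eventually_all_finite hN]
      intro ν' hν'
      by_cases e : ν = ν'
      · simp [e]
      · have h1 : Continuous fun t : ℝ => dist (z + t • y) ν := by fun_prop
        have h2 : Continuous fun t : ℝ => dist (z + t • y) ν' := by fun_prop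
        filter_upwards [h1.continuousAt.eventually_lt h2.continuousAt
          (by simpa using hno ν' hν' e)] with t ht using ht.le
    filter_upwards [hev] with t ht
    exact ⟨add_smul_mem_of_mem_direction hzc.1 hy t, ht⟩
  have hpos : ∀ y ∈ T.direction, ∃ t : ℝ, 0 < t ∧ z + t • y ∈ voronoiCell T N ν := fun y hy => by
    obtain ⟨t, ht, ht0⟩ := (((hmem y hy).filter_mono nhdsWithin_le_nhds).and
      (self_mem_nhdsWithin (s := Ioi 0))).exists
    exact ⟨t, ht0, ht⟩
  have hle : ∀ y ∈ T.direction, l y ≤ 0 := by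
    intro y hy
    obtain ⟨t, ht0, ht⟩ := hpos y hy
    have := hz.2 _ ht
    rw [map_add, map_smul, smul_eq_mul] at this
    nlinarith
  have hzero : ∀ y ∈ T.direction, l y = 0 := by
    intro y hy
    have := hle _ (T.direction.neg_mem hy)
    rw [map_neg] at this
    linarith [hle y hy]
  have hdir : T.direction ≤ (affineSpan ℝ
      {x ∈ voronoiCell T N ν | ∀ y ∈ voronoiCell T N ν, l y ≤ l x}).direction := by
    intro y hy
    obtain ⟨t, ht0, ht⟩ := hpos y hy
    have hmemG : z + t • y ∈ {x ∈ voronoiCell T N ν | ∀ y ∈ voronoiCell T N ν, l y ≤ l x} := by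
      refine ⟨ht, fun x hx => ?_⟩
      rw [map_add, map_smul, hzero y hy, smul_zero, add_zero]
      exact hz.2 x hx
    have := AffineSubspace.vsub_mem_direction (subset_affineSpan ℝ _ hmemG)
      (subset_affineSpan ℝ _ hz)
    rw [vsub_eq_sub, add_sub_cancel_left] at this
    exact (Submodule.smul_mem_iff _ ht0.ne').1 this
  have := Submodule.finrank_mono hdir
  rw [hdim, hG.2.2] at this
  omega

/-- The walls of the Voronoi diagram of a finite set consist of the points with two nearest
sites. -/
lemma mem_voronoiSkeleton_iff (hN : N.Finite) (hNT : N ⊆ T)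
    (hdim : Module.finrank ℝ T.direction = d) (hz : z ∈ T) :
    z ∈ voronoiSkeleton T N ↔ ∃ ν₁ ∈ N, ∃ ν₂ ∈ N, ν₁ ≠ ν₂ ∧
      ∀ ν' ∈ N, dist z ν₁ ≤ dist z ν' ∧ dist z ν₂ ≤ dist z ν' := by
  constructor
  · rintro ⟨ν, hν, G, k, hk, hG, hzG⟩
    have hzc : z ∈ voronoiCell T N ν := by
      obtain ⟨l, rfl⟩ := hG.exists_functional
      exact hzG.1
    obtain ⟨ν₂, h₂, hne, hle⟩ := exists_nearest_of_mem_face hN hdim (by omega) hG hzG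
    exact ⟨ν, hν, ν₂, h₂, hne, fun ν' h' => ⟨hzc.2 ν' h', hle.trans (hzc.2 ν' h')⟩⟩
  · rintro ⟨ν₁, h₁, ν₂, h₂, hne, h⟩
    exact mem_voronoiSkeleton_of_two_nearest hN hNT hdim hz h₁ h₂ hne h

end Voronoi

/-! ### Conclusion -/

namespace Presentation

variable {d : ℕ} {ι : Type} {Q : Presentation d ι} {i : ι} {v w : Ambient d}

lemma source_of_isSourcePoint [Finite ι] (hv : IsSourcePoint Q.carrier v) : Q.Source v := by
  obtain ⟨F, hF, hvF⟩ := hv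
  obtain ⟨i, rfl⟩ := exists_eq_facet hF
  have hvi := intrinsicInterior_subset hvF
  refine ⟨hvi.1, i, fun j => ⟨fun hj => ?_, fun e => e ▸ hvi.2⟩⟩
  by_contra hne
  exact (slack_center_pos (Q := Q) hne).ne'
    (slack_eq_zero_of_mem_intrinsicInterior (fun x hx => hx.1) hvF hj center_mem_facet)

/-- Facets and ridges are treated alike: what matters is that relatively interior points of faces of
dimension at least `d - 1` are regular. -/
lemma mem_cutPoints_iff_mem_voronoiSkeleton [Fintype ι] (hv : Q.Source v) {K : Set (Ambient d)}
    {k : ℕ} (hK : IsFace Q.carrier K k) (hk : d ≤ k + 1) (hKi : K ⊆ Q.facet i)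
    (hw : w ∈ intrinsicInterior ℝ K) : w ∈ cutPoints Q.carrier v ↔
      w ∈ voronoiSkeleton (affineSpan ℝ (Q.facet i))
        (sourceImages Q.carrier v (Q.facet i)) := by
  have hwi := hKi (intrinsicInterior_subset hw)
  rw [sourceImages_eq hv, mem_voronoiSkeleton_iff (finite_images hv)
    (fun ν hν => mem_affineSpan_facet.2 (slack_of_mem_images hv hν))
    (by rw [direction_facet, finrank_orthogonal_normal]) (subset_affineSpan ℝ _ hwi)]
  exact mem_cutPoints_iff hv hwi
    (regular_of_not_isWarped hwi.1 (not_isWarped_of_mem_intrinsicInterior hK hk hw))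

end Presentation

end PolyhedralBoundary

theorem theorem2 (d : ℕ) (P : Set (PolyhedralBoundary.Ambient d))
    (hP : PolyhedralBoundary.IsConvexPolyhedron P)
    (v : PolyhedralBoundary.Ambient d) (hv : PolyhedralBoundary.IsSourcePoint P v)
    (F : Set (PolyhedralBoundary.Ambient d)) (hF : PolyhedralBoundary.IsFacet P F) :
    (PolyhedralBoundary.sourceImages P v F).Finite ∧
    intrinsicInterior ℝ F ∩ PolyhedralBoundary.cutPoints P v =
      intrinsicInterior ℝ F ∩ PolyhedralBoundary.voronoiSkeleton (affineSpan ℝ F)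
        (PolyhedralBoundary.sourceImages P v F) ∧
    ∀ R : Set (PolyhedralBoundary.Ambient d), PolyhedralBoundary.IsRidge P R → R ⊆ F →
      intrinsicInterior ℝ R ∩ PolyhedralBoundary.cutPoints P v =
        intrinsicInterior ℝ R ∩ PolyhedralBoundary.voronoiSkeleton (affineSpan ℝ F)
          (PolyhedralBoundary.sourceImages P v F) := by
  obtain ⟨ι, _, Q, rfl⟩ := hP.exists_presentation
  have hs := Q.source_of_isSourcePoint hv
  obtain ⟨i, rfl⟩ := PolyhedralBoundary.Presentation.exists_eq_facet hF
  refine ⟨?_, ?_, ?_⟩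
  · rw [PolyhedralBoundary.Presentation.sourceImages_eq hs]
    exact PolyhedralBoundary.Presentation.finite_images hs
  · ext w
    exact and_congr_right fun hw => PolyhedralBoundary.Presentation.mem_cutPoints_iff_mem_voronoiSkeleton
      hs hF (Nat.le_succ d) Subset.rfl hw
  · rintro R ⟨k, hk, hR⟩ hRF
    ext w
    exact and_congr_right fun hw => PolyhedralBoundary.Presentation.mem_cutPoints_iff_mem_voronoiSkeleton
      hs hR hk.ge hRF hw
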